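/- All $L^2$ spaces are complex and taken with respect to Lebesgue measure, and $\mathbb{R}_+=(0,\infty)$. Let $\operatorname{sinc}(x)=\sin(x)/x$ for $x\neq 0$, $\operatorname{sinc}(0)=1$. For $s\in(0,1)$ and $w\in\mathbb{C}\setminus[-1,1]$ put, with principal logarithms, $$Q_s(w)=\frac{w}{w^2-1}\exp\Big(-\tfrac12\ln\frac{w^2}{w^2-1}\Big)\exp\Big(\frac{i}{2\pi}\ln\big(\tfrac1s-1\big)\ln\frac{w-1}{w+1}\Big).$$ **Theorem.** For all $s\in(0,1)$ and $x>0$ the limit $$q_s(x)=(2\pi)^{-1/2}\lim_{A\to\infty}\int_{-A+ib}^{A+ib}e^{-ixw}Q_s(w)\,dw$$ exists for every $b>0$ and does not depend on $b$. Put $q(s,x)=\frac{i}{\pi}(2s)^{-1/2}q_s(x)$. Then: 1. There is a (unique) bounded linear operator $K$ on $L^2(\mathbb{R}_+)$ with $$(Kg)(x)=\int_0^\infty\tfrac1\pi\operatorname{sinc}(x-y)\,g(y)\,dy\quad\text{for a.e. }x>0,\qquad g\in L^2(\mathbb{R}_+),$$ where the integral exists for every $x\in\mathbb{R}$; and $K$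 is self-adjoint. 2. There is a (unique) Hilbert space isomorphism $V:L^2(0,1)\to L^2(\mathbb{R}_+)$ such that, for every $h\in L^2(0,1)$, $$Vh=\lim_{\alpha,\alpha'\downarrow 0}\int_\alpha^{1-\alpha'}q(s,\cdot)\,h(s)\,ds\quad\text{in }L^2(\mathbb{R}_+),$$ where for $\alpha,\alpha'>0$ with $\alpha+\alpha'<1$ the truncated integrals exist at every $x>0$ and belong to $L^2(\mathbb{R}_+)$. 3. For every $h\in L^2(0,1)$, $(V^{-1}KVh)(s)=s\,h(s)$ for a.e. $s\in(0,1)$. Equivalently, $K=VMV^{-1}$, where $M$ is multiplication by the identity function $s\mapsto s$ on $L^2(0,1)$. 4. The spectrum of $K$ is $[0,1]$. It is simple, i.e. there is $g\in L^2(\mathbb{R}_+)$ such that the linear span of $\{K^ng:n\ge 0\}$ is dense. Moreover $K$ is absolutely continuous: if $E$ denotes the spectral measure of $K$ (the projection-valued Borel measure on $\mathbb{R}$ with $K=\int\lambda\,dE(\lambda)$), then for every $g\in L^2(\mathbb{R}_+)$ the measure $\Delta\mapsto\langle g,E(\Delta)g\rangle$ is absolutely continuous with respect to Lebesgue measure.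 -/

import Mathlib

open MeasureTheory Filter Topology Set
open scoped ENNReal InnerProductSpace

noncomputable section

namespace SincWienerHopf

/-- The complex Hilbert space `L²(S)` of a set `S ⊆ ℝ`, with Lebesgue measure. -/
abbrev L2On (S : Set ℝ) : Type := Lp ℂ 2 (volume.restrict S)

/-! ### The integral operator -/

/-- `K` is the integral operator on `L²(ℝ₊)` with kernel `(1/π) sinc (x - y)`: the integral exists
for all `g` and `x`, and gives `K g` almost everywhere. This determines `K`. -/
def IsSincOperator (K : L2On (Ioi 0) →L[ℂ] L2On (Ioi 0)) : Prop :=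
  ∀ g : L2On (Ioi 0),
    (∀ x : ℝ, IntegrableOn (fun y : ℝ => ((1 / Real.pi * Real.sinc (x - y) : ℝ) : ℂ) * g y)
      (Ioi 0)) ∧
    ∀ᵐ x ∂(volume.restrict (Ioi (0 : ℝ))),
      K g x = ∫ y in Ioi (0 : ℝ), ((1 / Real.pi * Real.sinc (x - y) : ℝ) : ℂ) * g y

/-! ### The kernel built from the generalized eigenfunctions -/

/-- `Q_s(w)`, holomorphic in `w` off `[-1, 1]`; all logarithms are principal. -/
def Q (s : ℝ) (w : ℂ) : ℂ :=
  w / (w ^ 2 - 1) * Complex.exp (-(1 / 2) * Complex.log (w ^ 2 / (w ^ 2 - 1))) *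
    Complex.exp (Complex.I / (2 * Real.pi) * (Real.log (1 / s - 1) : ℝ) *
      Complex.log ((w - 1) / (w + 1)))

/-- `(2π)^{-1/2} ∫ e^{-ixw} Q_s(w) dw` along the segment from `-A + ib` to `A + ib`. -/
def cauchyTrunc (s b x A : ℝ) : ℂ :=
  ((Real.sqrt (2 * Real.pi))⁻¹ : ℝ) *
    ∫ u in (-A)..A, Complex.exp (-Complex.I * x * (u + Complex.I * b)) *
      Q s (u + Complex.I * b)

/-- The generalized eigenfunction `q_s(x)`: the Cauchy integral
`(2π)^{-1/2} ∫_{-∞+ib}^{∞+ib} e^{-ixw} Q_s(w) dw`, taken here at `b = 1`. That it exists for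
`s ∈ (0, 1)`, `x > 0` and is the same for every `b > 0` is the predicate
`SpectralFunctionExists`. -/
def spectralFunction (s x : ℝ) : ℂ :=
  limUnder atTop (fun A : ℝ => cauchyTrunc s 1 x A)

/-- The Cauchy integrals converge, to a value independent of the height `b > 0` of the line. -/
def SpectralFunctionExists : Prop :=
  ∀ s ∈ Ioo (0 : ℝ) 1, ∀ x > 0, ∀ b > 0,
    Tendsto (fun A : ℝ => cauchyTrunc s b x A) atTop (𝓝 (spectralFunction s x))

/-- The kernel `q(s, x) = n(s) q_s(x)` with `n(s) = (i/π) (2s)^{-1/2}`. -/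
def kernelQ (s x : ℝ) : ℂ :=
  Complex.I / Real.pi * ((Real.sqrt (2 * s))⁻¹ : ℝ) * spectralFunction s x

/-- `V h = l.i.m. ∫_α^{1-α'} q(s, ·) h(s) ds` as `α, α' ↓ 0` independently, for all `h ∈ L²(0,1)`:
the truncated integrals exist at every `x > 0`, belong to `L²(ℝ₊)`, and converge to `V h` in
`L²(ℝ₊)`. This determines `V`. -/
def IsSpectralTransform (V : L2On (Ioo 0 1) → L2On (Ioi 0)) : Prop :=
  ∀ h : L2On (Ioo 0 1),
    (∀ a > 0, ∀ a' > 0, a + a' < 1 →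
      (∀ x > 0, IntegrableOn (fun s : ℝ => kernelQ s x * h s) (Icc a (1 - a'))) ∧
      MemLp (fun x : ℝ => ∫ s in a..(1 - a'), kernelQ s x * h s) 2
        (volume.restrict (Ioi (0 : ℝ)))) ∧
    Tendsto (fun p : ℝ × ℝ =>
        eLpNorm (fun x : ℝ => (∫ s in p.1..(1 - p.2), kernelQ s x * h s) - V h x) 2
          (volume.restrict (Ioi (0 : ℝ))))
      (𝓝[>] (0 : ℝ) ×ˢ 𝓝[>] (0 : ℝ)) (𝓝 0)

/-! ### Multiplication operators -/

/-- The multiplication operator `M(κ)` on `L²(μ)` by an essentially bounded function `κ`. -/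
def mulOp {α : Type*} [MeasurableSpace α] {μ : Measure α} (κ : α → ℂ) (hκ : MemLp κ ∞ μ) :
    Lp ℂ 2 μ →L[ℂ] Lp ℂ 2 μ :=
  (ContinuousLinearMap.mul ℂ ℂ).holderL μ ∞ 2 2 hκ.toLp

theorem mulOp_coeFn {α : Type*} [MeasurableSpace α] {μ : Measure α} (κ : α → ℂ)
    (hκ : MemLp κ ∞ μ) (h : Lp ℂ 2 μ) : mulOp κ hκ h =ᵐ[μ] fun x => κ x * h x := by
  have h1 := (ContinuousLinearMap.mul ℂ ℂ).coeFn_holder (r := 2) hκ.toLp h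
  filter_upwards [h1, hκ.coeFn_toLp] with x hx hx'
  change ((ContinuousLinearMap.mul ℂ ℂ).holder 2 hκ.toLp h) x = _
  rw [hx, hx']
  rfl

theorem memLp_id_unit :
    MemLp (fun s : ℝ => (s : ℂ)) ∞ (volume.restrict (Ioo (0 : ℝ) 1)) := by
  refine memLp_top_of_bound (Complex.continuous_ofReal.aestronglyMeasurable) 1 ?_
  filter_upwards [ae_restrict_mem measurableSet_Ioo] with s hs
  rw [Complex.norm_real, Real.norm_eq_abs, abs_of_pos hs.1]
  exact hs.2.le

/-- Multiplication by the identity function on `L²(0,1)`. -/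
def mulId : L2On (Ioo 0 1) →L[ℂ] L2On (Ioo 0 1) :=
  mulOp (fun s : ℝ => (s : ℂ)) memLp_id_unit

/-! ### Spectral measures, simple spectrum, absolute continuity -/

section Spectral

variable {H : Type*} [NormedAddCommGroup H] [InnerProductSpace ℂ H] [CompleteSpace H]

/-- A projection-valued measure on the Borel sets of `ℝ` (values on other sets are irrelevant). -/
structure ProjectionValuedMeasure (H : Type*) [NormedAddCommGroup H] [InnerProductSpace ℂ H]
    [CompleteSpace H] where
  toFun : Set ℝ → H →L[ℂ] H
  isStarProjection : ∀ s, MeasurableSet s → IsStarProjection (toFun s)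
  map_empty : toFun ∅ = 0
  map_univ : toFun univ = 1
  map_inter : ∀ s t, MeasurableSet s → MeasurableSet t → toFun (s ∩ t) = toFun s * toFun t
  hasSum_iUnion : ∀ s : ℕ → Set ℝ, (∀ n, MeasurableSet (s n)) →
    Pairwise (Function.onFun Disjoint s) →
    ∀ g : H, HasSum (fun n => toFun (s n) g) (toFun (⋃ n, s n) g)

theorem inner_starProjection {P : H →L[ℂ] H} (hP : IsStarProjection P) (g : H) :
    ⟪g, P g⟫_ℂ = ((‖P g‖ ^ 2 : ℝ) : ℂ) := by
  have h1 : P (P g) = P g := congrArg (fun T : H →L[ℂ] H => T g) hP.isIdempotentElem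
  have h2 : ⟪P g, P g⟫_ℂ = ⟪g, P (P g)⟫_ℂ := by
    have := ContinuousLinearMap.adjoint_inner_left P (P g) g
    rwa [hP.isSelfAdjoint.adjoint_eq] at this
  rw [← h1, ← h2, inner_self_eq_norm_sq_to_K, h1]
  push_cast
  rfl

/-- The positive measure `Δ ↦ ⟨g, E(Δ) g⟩ = ‖E(Δ) g‖²`. -/
def ProjectionValuedMeasure.diag (E : ProjectionValuedMeasure H) (g : H) : Measure ℝ :=
  Measure.ofMeasurable (fun s _ => ENNReal.ofReal (‖E.toFun s g‖ ^ 2))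
    (by simp [E.map_empty])
    (by
      intro s hs hd
      have h1 : HasSum (fun n => ⟪g, E.toFun (s n) g⟫_ℂ) ⟪g, E.toFun (⋃ n, s n) g⟫_ℂ :=
        (E.hasSum_iUnion s hs hd g).mapL (innerSL ℂ g)
      simp_rw [inner_starProjection (E.isStarProjection _ (hs _)),
        inner_starProjection (E.isStarProjection _ (MeasurableSet.iUnion hs))] at h1
      have h2 := Complex.hasSum_ofReal.mp h1
      rw [← h2.tsum_eq, ENNReal.ofReal_tsum_of_nonneg (fun n => sq_nonneg _) h2.summable])

theorem ProjectionValuedMeasure.diag_apply (E : ProjectionValuedMeasure H) (g : H) {s : Set ℝ}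
    (hs : MeasurableSet s) : E.diag g s = ENNReal.ofReal (‖E.toFun s g‖ ^ 2) :=
  Measure.ofMeasurable_apply s hs

/-- `E` is the spectral measure of `A`, i.e. `A = ∫ λ dE(λ)`: `⟨g, A g⟩ = ∫ λ d⟨g, E(λ) g⟩` for all
`g`, which by polarization determines `A`. -/
def IsSpectralMeasureOf (E : ProjectionValuedMeasure H) (A : H →L[ℂ] H) : Prop :=
  ∀ g : H, Integrable (fun t : ℝ => t) (E.diag g) ∧
    ((∫ t, t ∂(E.diag g) : ℝ) : ℂ) = ⟪g, A g⟫_ℂ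

/-- `A` is absolutely continuous: its (unique) spectral measure `E` exists, and all the measures
`⟨g, E(·) g⟩` are absolutely continuous with respect to Lebesgue measure. -/
def IsAbsolutelyContinuousOp (A : H →L[ℂ] H) : Prop :=
  ∃ E : ProjectionValuedMeasure H, IsSpectralMeasureOf E A ∧ ∀ g : H, E.diag g ≪ volume

/-- A bounded self-adjoint operator `A` has simple spectrum: it has a cyclic vector. -/
def HasSimpleSpectrum (A : H →L[ℂ] H) : Prop :=
  ∃ g : H, (Submodule.span ℂ (range fun n : ℕ => (A ^ n) g)).topologicalClosure = ⊤

end Spectral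

end SincWienerHopf

end

/-!
The operator `K` with kernel `π⁻¹ sinc (x - y)` on the half line is diagonalized by an explicit
unitary transform `V`, built from the functions `q(s, ·)`.

*The eigenfunctions.* With `τ = (2π)⁻¹ ln (1/s - 1)` as spectral parameter, `Q_s` is `cosh πτ`
times the Fourier transform at `τ` of `v ↦ 1 / (cosh πv (w - tanh πv))`, because `1 / cosh` is its
own Fourier transform (`Q_eq_fourier_cauchyDensity`); in the coordinate `t = tanh πv` this
represents `Q_s` as a Cauchy integral over the cut `[-1, 1]`. For `x > 0` a horizontal line of
integration can be closed by a large arc in the lower half plane, and Cauchy's formula gives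
(`kernelQ_eq`) `q(s, x) = (2 √π s √(1 - s))⁻¹ 𝓕(w_x)(τ)`, where
`w_x(v) = e^{-ix tanh πv} / cosh πv` (`realWave`) and `𝓕` is the Fourier transform in `v`. As
`s ↦ τ` maps `(0, 1)` onto `ℝ`, integrals of `q(s, x)` against functions of `s` become integrals of
Fourier transforms.

*Isometry.* Moving the contour in `𝓕(w_x)` to `Im v = -1/4` replaces `w_x` by a wave which decays
in `x` (`fourier_realWave_eq`). For `h` vanishing near the endpoints the square of the norm of
`x ↦ ∫ q(s, x) h(s) ds` is then an absolutely convergent triple integral, in which the `x`-integral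
is `1 / cosh π(v - v')` by the addition theorem for `tanh` (`integral_shiftWave_mul_conj`). The
remaining double integral is a convolution form, which `𝓕` diagonalizes
(`integral_norm_sq_shiftWave`). Hence `V` is isometric on such `h` and extends to all of `L²(0, 1)`
by continuity (`spectralIsometry`).

*Intertwining.* By Parseval's identity in `τ`, the transforms of all bounded functions `φ` on
`(-1, 1)` lie in the range of `V`: `π⁻¹ ∫_{-1}^1 e^{-ixt} φ(t) dt` is `V` of the function
`bandPreimage φ`. For `φ(t) = e^{iyt}` this is `(2/π) sinc (x - y)`, while `bandPreimage φ` is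
`2 s` times the complex conjugate of `q(s, y)`. So `(V M h)(x) = ∫ q(s, x) s h(s) ds` is an inner
product of `h` with a preimage of the sinc kernel, and as `V` preserves inner products it equals
`(K V h)(x)` (`coeFn_spectralIsometry_mulId`).

*Surjectivity.* For `g` orthogonal to the range take `φ` the indicator functions of the intervals
`(t, t + 1/2]`. The result is a function `G`, namely `g` multiplied by a function without zeros off
a countable set, whose Fourier transform vanishes on an interval. As `G` lives on a half line, its
Fourier transform is the boundary value of a bounded holomorphic function on the upper half plane,
which must vanish identically (`eq_zero_of_vanishing_on_interval`); hence `g = 0`.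

The remaining statements hold for multiplication by `s` on `L²(0, 1)` and are transported by `V`.
-/

noncomputable section

namespace SincWienerHopf

open scoped FourierTransform ComplexConjugate

/-! ### The spectral parameter and the logistic change of variables -/

/-- The exponent `τ = (1/2π) ln (1/s - 1)` belonging to the spectral value `s ∈ (0, 1)`. -/
def expParam (s : ℝ) : ℝ := Real.log (1 / s - 1) / (2 * Real.pi)

/-- The spectral value `s = 1 / (1 + e^{2πτ})` belonging to the exponent `τ`; it inverts
`expParam`. -/
def specValue (τ : ℝ) : ℝ := (1 + Real.exp (2 * Real.pi * τ))⁻¹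

theorem specValue_pos (τ : ℝ) : 0 < specValue τ := by unfold specValue; positivity

theorem one_sub_specValue (τ : ℝ) :
    1 - specValue τ = Real.exp (2 * Real.pi * τ) * specValue τ := by
  have := Real.exp_pos (2 * Real.pi * τ)
  unfold specValue
  field_simp
  ring

theorem specValue_mem (τ : ℝ) : specValue τ ∈ Ioo (0 : ℝ) 1 := by
  refine ⟨specValue_pos τ, ?_⟩
  have h := one_sub_specValue τ
  have : 0 < Real.exp (2 * Real.pi * τ) * specValue τ :=
    mul_pos (Real.exp_pos _) (specValue_pos τ)
  linarith

theorem expParam_specValue (τ : ℝ) : expParam (specValue τ) = τ := by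
  have : 1 / specValue τ - 1 = Real.exp (2 * Real.pi * τ) := by
    simp [specValue]
  rw [expParam, this, Real.log_exp]
  field_simp

theorem exp_expParam {s : ℝ} (hs : s ∈ Ioo (0 : ℝ) 1) :
    Real.exp (2 * Real.pi * expParam s) = 1 / s - 1 := by
  have h : 0 < 1 / s - 1 := by
    have := (one_lt_div hs.1).2 hs.2
    linarith
  rw [expParam, mul_div_cancel₀ _ (by positivity), Real.exp_log h]

theorem specValue_expParam {s : ℝ} (hs : s ∈ Ioo (0 : ℝ) 1) : specValue (expParam s) = s := by
  rw [specValue, exp_expParam hs]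
  simp

theorem hasDerivAt_specValue (τ : ℝ) :
    HasDerivAt specValue (-(2 * Real.pi * (specValue τ * (1 - specValue τ)))) τ := by
  have h1 : HasDerivAt (fun τ : ℝ => 1 + Real.exp (2 * Real.pi * τ))
      (Real.exp (2 * Real.pi * τ) * (2 * Real.pi)) τ := by
    simpa using (((hasDerivAt_id τ).const_mul (2 * Real.pi)).exp).const_add 1
  have h2 := h1.inv (by positivity)
  convert! h2 using 1
  rw [one_sub_specValue]
  unfold specValue
  field_simp

theorem specValue_injective : Function.Injective specValue :=
  fun a b h => by rw [← expParam_specValue a, h, expParam_specValue]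

theorem image_specValue : specValue '' univ = Ioo 0 1 := by
  ext s
  constructor
  · rintro ⟨τ, -, rfl⟩
    exact specValue_mem τ
  · exact fun hs => ⟨expParam s, trivial, specValue_expParam hs⟩

/-- The density `2π s (1 - s)` of `ds` with respect to `dτ`. -/
def specDensity (τ : ℝ) : ℝ := 2 * Real.pi * (specValue τ * (1 - specValue τ))

theorem specDensity_pos (τ : ℝ) : 0 < specDensity τ :=
  mul_pos (by positivity) (mul_pos (specValue_mem τ).1 (sub_pos.2 (specValue_mem τ).2))

theorem abs_neg_specDensity (τ : ℝ) :
    |-(2 * Real.pi * (specValue τ * (1 - specValue τ)))| = specDensity τ := by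
  rw [abs_neg]
  exact abs_of_pos (specDensity_pos τ)

theorem continuous_specValue : Continuous specValue :=
  continuous_iff_continuousAt.2 fun τ => (hasDerivAt_specValue τ).continuousAt

theorem continuous_specDensity : Continuous specDensity := by
  have := continuous_specValue
  unfold specDensity
  fun_prop

section ChangeOfVariables

variable {F : Type*} [NormedAddCommGroup F] [NormedSpace ℝ F]

theorem integral_unit_eq_integral_specValue (f : ℝ → F) :
    ∫ s in Ioo (0 : ℝ) 1, f s = ∫ τ, specDensity τ • f (specValue τ) := by
  have := integral_image_eq_integral_abs_deriv_smul MeasurableSet.univ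
    (fun τ _ => (hasDerivAt_specValue τ).hasDerivWithinAt) specValue_injective.injOn f
  rw [image_specValue] at this
  simpa only [abs_neg_specDensity, Measure.restrict_univ] using this

theorem integrableOn_unit_iff_integrable_specValue (f : ℝ → F) :
    IntegrableOn f (Ioo (0 : ℝ) 1) ↔ Integrable (fun τ => specDensity τ • f (specValue τ)) := by
  have := integrableOn_image_iff_integrableOn_abs_deriv_smul MeasurableSet.univ
    (fun τ _ => (hasDerivAt_specValue τ).hasDerivWithinAt) specValue_injective.injOn f
  rw [image_specValue] at this
  simpa only [abs_neg_specDensity, integrableOn_univ] using this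

theorem lintegral_unit_eq_lintegral_specValue (f : ℝ → ℝ≥0∞) :
    ∫⁻ s in Ioo (0 : ℝ) 1, f s = ∫⁻ τ, ENNReal.ofReal (specDensity τ) * f (specValue τ) := by
  have := lintegral_image_eq_lintegral_abs_deriv_mul MeasurableSet.univ
    (fun τ _ => (hasDerivAt_specValue τ).hasDerivWithinAt) specValue_injective.injOn f
  rw [image_specValue] at this
  simpa only [abs_neg_specDensity, Measure.restrict_univ] using this

end ChangeOfVariables

/-- A property holding almost everywhere on `(0, 1)` holds almost everywhere in the parameter. -/
theorem quasiMeasurePreserving_specValue :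
    Measure.QuasiMeasurePreserving specValue volume (volume.restrict (Ioo (0 : ℝ) 1)) := by
  refine ⟨continuous_specValue.measurable, Measure.AbsolutelyContinuous.mk fun t ht h0 => ?_⟩
  have hm : Measurable (t.indicator (1 : ℝ → ℝ≥0∞)) := measurable_one.indicator ht
  have h1 := lintegral_unit_eq_lintegral_specValue (t.indicator 1)
  rw [lintegral_indicator_one ht, h0] at h1
  have h2 := (lintegral_eq_zero_iff (continuous_specDensity.measurable.ennreal_ofReal.mul
    (hm.comp continuous_specValue.measurable))).1 h1.symm
  rw [Measure.map_apply continuous_specValue.measurable ht, measure_eq_zero_iff_ae_notMem]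
  filter_upwards [h2] with τ hτ hmem
  simp [not_le.2 (specDensity_pos τ), indicator_of_mem (mem_preimage.1 hmem)] at hτ

theorem cosh_expParam {s : ℝ} (hs : s ∈ Ioo (0 : ℝ) 1) :
    Real.cosh (Real.pi * expParam s) = (2 * (√s * √(1 - s)))⁻¹ := by
  have h1 : 0 < 1 - s := sub_pos.2 hs.2
  have h0 := hs.1
  have e1 : Real.exp (Real.pi * expParam s) = √(1 - s) / √s := by
    rw [← Real.sqrt_div h1.le, ← Real.sqrt_sq (Real.exp_pos (Real.pi * expParam s)).le]
    congr 1
    rw [sq, ← Real.exp_add, ← two_mul, ← mul_assoc, exp_expParam hs]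
    field_simp
  have p1 := Real.sqrt_pos.2 h1
  have p0 := Real.sqrt_pos.2 h0
  rw [Real.cosh_eq, Real.exp_neg, e1]
  field_simp
  rw [Real.sq_sqrt h1.le, Real.sq_sqrt h0.le]
  ring

/-! ### The hyperbolic secant is its own Fourier transform -/

theorem integrable_inv_cosh : Integrable fun v : ℝ => (Real.cosh (Real.pi * v))⁻¹ := by
  refine integrable_inv_one_add_sq.mono' (by fun_prop (disch := intro; positivity))
    (ae_of_all _ fun v => ?_)
  have hc := Real.cosh_pos (Real.pi * v)
  rw [norm_inv, Real.norm_eq_abs, abs_of_pos hc]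
  gcongr
  have h1 := Real.quadratic_le_exp_of_nonneg (abs_nonneg (Real.pi * v))
  have h2 := Real.add_one_le_exp (-|Real.pi * v|)
  have h3 : 4 * v ^ 2 ≤ |Real.pi * v| ^ 2 := by
    rw [sq_abs, mul_pow]
    gcongr
    nlinarith [Real.two_le_pi]
  rw [← Real.cosh_abs, Real.cosh_eq]
  linarith

/-- `1 / cosh π v` is its own Fourier transform: the logistic substitution turns the integral into
the Beta integral `Β(1/2 + iτ, 1/2 - iτ)`, to which the reflection formula applies. -/
theorem fourier_inv_cosh (τ : ℝ) :
    𝓕 (fun v : ℝ => (((Real.cosh (Real.pi * v))⁻¹ : ℝ) : ℂ)) τ =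
      ((Real.cosh (Real.pi * τ))⁻¹ : ℝ) := by
  have hB := Complex.Gamma_mul_Gamma_eq_betaIntegral (s := 1 / 2 + Complex.I * τ)
    (t := 1 / 2 - Complex.I * τ) (by simp) (by simp)
  have e1 : (1 / 2 - Complex.I * τ : ℂ) = 1 - (1 / 2 + Complex.I * τ) := by ring
  rw [show (1 / 2 + Complex.I * τ + (1 / 2 - Complex.I * τ) : ℂ) = 1 by ring, Complex.Gamma_one,
    one_mul, e1, Complex.Gamma_mul_Gamma_one_sub, ← e1,
    show (Real.pi * (1 / 2 + Complex.I * τ) : ℂ) = (Real.pi * τ : ℝ) * Complex.I + Real.pi / 2 by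
      push_cast; ring, Complex.sin_add_pi_div_two, Complex.cos_mul_I, Complex.betaIntegral,
    intervalIntegral.integral_of_le zero_le_one, integral_Ioc_eq_integral_Ioo,
    integral_unit_eq_integral_specValue] at hB
  have e2 : ∀ v : ℝ, specDensity v • ((specValue v : ℂ) ^ (1 / 2 + Complex.I * τ - 1 : ℂ) *
      (1 - (specValue v : ℂ)) ^ (1 / 2 - Complex.I * τ - 1 : ℂ)) =
      Real.pi * (Real.fourierChar (-(v * τ)) • (((Real.cosh (Real.pi * v))⁻¹ : ℝ) : ℂ)) := by
    intro v
    have hs := specValue_mem v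
    have hs1 : 0 < 1 - specValue v := sub_pos.2 hs.2
    have hE := Real.exp_pos (2 * Real.pi * v)
    have l1 : Real.log (1 - specValue v) = 2 * Real.pi * v + Real.log (specValue v) := by
      rw [one_sub_specValue, Real.log_mul hE.ne' hs.1.ne', Real.log_exp]
    have c1 : specDensity v = Real.exp (Real.log (2 * Real.pi)
        + (Real.log (specValue v) + Real.log (1 - specValue v))) := by
      rw [Real.exp_add, Real.exp_add, Real.exp_log hs.1, Real.exp_log hs1,
        Real.exp_log (by positivity)]
      rfl
    have c2 : (Real.cosh (Real.pi * v))⁻¹ = 2 * Real.exp (Real.pi * v +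
        Real.log (specValue v)) := by
      rw [Real.exp_add, Real.exp_log hs.1, Real.cosh_eq, specValue, Real.exp_neg, mul_assoc 2,
        two_mul (Real.pi * v), Real.exp_add]
      have := Real.exp_pos (Real.pi * v)
      field_simp
      ring
    rw [Complex.cpow_def_of_ne_zero (by exact_mod_cast hs.1.ne'),
      Complex.cpow_def_of_ne_zero (by exact_mod_cast hs1.ne'), ← Complex.ofReal_log hs.1.le,
      show (1 - (specValue v : ℂ)) = ((1 - specValue v : ℝ) : ℂ) by push_cast; ring,
      ← Complex.ofReal_log hs1.le, c1, c2, Circle.smul_def, Real.fourierChar_apply,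
      Complex.real_smul, Real.exp_add, Real.exp_log (by positivity), l1]
    push_cast
    simp only [smul_eq_mul]
    rw [show ∀ a b c d : ℂ, 2 * a * b * (c * d) = 2 * a * (b * c * d) by intros; ring,
      show ∀ a b c : ℂ, a * (b * (2 * c)) = 2 * a * (b * c) by intros; ring]
    simp only [← Complex.exp_add]
    congr 2
    ring
  simp_rw [e2] at hB
  rw [integral_const_mul] at hB
  have hpi : (Real.pi : ℂ) ≠ 0 := by exact_mod_cast Real.pi_ne_zero
  rw [Real.fourier_real_eq]
  have hB' := mul_left_cancel₀ hpi (hB.symm.trans (div_eq_mul_inv _ _))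
  rw [hB']
  push_cast
  rfl

/-! ### The Cauchy integral representation of `Q` -/

theorem Q_differentiableAt (s : ℝ) {w : ℂ} (hw : w ∉ Complex.ofReal '' Icc (-1) 1) :
    DifferentiableAt ℂ (Q s) w := by
  have hp : w + 1 ≠ 0 := fun h => hw ⟨-1, by norm_num, by
    push_cast; linear_combination -h⟩
  have hm : w - 1 ≠ 0 := fun h => hw ⟨1, by norm_num, by push_cast; linear_combination -h⟩
  have h2 : w ^ 2 - 1 ≠ 0 := by
    rw [show w ^ 2 - 1 = (w - 1) * (w + 1) by ring]
    exact mul_ne_zero hm hp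
  -- a real square forces `w` onto one of the axes
  have hax : ∀ r : ℝ, 0 ≤ r → r < 1 → w ^ 2 = r → False := by
    intro r hr0 hr1 h
    have e : (w - (√r : ℝ)) * (w + (√r : ℝ)) = 0 := by
      have : ((√r : ℝ) : ℂ) ^ 2 = r := by exact_mod_cast Real.sq_sqrt hr0
      linear_combination h - this
    have hs0 := Real.sqrt_nonneg r
    have hs1 : √r ≤ 1 := Real.sqrt_le_one.2 hr1.le
    rcases mul_eq_zero.1 e with h | h
    · exact hw ⟨√r, ⟨by linarith, hs1⟩, by linear_combination -h⟩
    · exact hw ⟨-√r, ⟨by linarith, by linarith⟩, by push_cast; linear_combination -h⟩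
  have s1 : w ^ 2 / (w ^ 2 - 1) ∈ Complex.slitPlane := by
    rw [Complex.mem_slitPlane_iff_not_le_zero]
    intro h
    obtain ⟨r, hr, e⟩ : ∃ r : ℝ, r ≤ 0 ∧ w ^ 2 / (w ^ 2 - 1) = r :=
      ⟨_, (Complex.le_def.1 h).1, Complex.ext rfl (by simpa using (Complex.le_def.1 h).2)⟩
    rw [div_eq_iff h2] at e
    have hr1 : (1 - r : ℂ) ≠ 0 := by
      exact_mod_cast (by linarith : (1 - r : ℝ) ≠ 0)
    refine hax (-r / (1 - r)) (div_nonneg (by linarith) (by linarith)) ?_ ?_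
    · rw [div_lt_one (by linarith)]; linarith
    · push_cast
      rw [eq_div_iff hr1]
      linear_combination e
  have s2 : (w - 1) / (w + 1) ∈ Complex.slitPlane := by
    rw [Complex.mem_slitPlane_iff_not_le_zero]
    intro h
    obtain ⟨r, hr, e⟩ : ∃ r : ℝ, r ≤ 0 ∧ (w - 1) / (w + 1) = r :=
      ⟨_, (Complex.le_def.1 h).1, Complex.ext rfl (by simpa using (Complex.le_def.1 h).2)⟩
    rw [div_eq_iff hp] at e
    have hr1 : (1 - r : ℂ) ≠ 0 := by
      exact_mod_cast (by linarith : (1 - r : ℝ) ≠ 0)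
    refine hw ⟨(1 + r) / (1 - r), ⟨?_, ?_⟩, ?_⟩
    · rw [le_div_iff₀ (by linarith)]; linarith
    · rw [div_le_one (by linarith)]; linarith
    · push_cast
      rw [div_eq_iff hr1]
      linear_combination -e
  have d0 : DifferentiableAt ℂ (fun w : ℂ => w / (w ^ 2 - 1)) w := by fun_prop (disch := exact h2)
  have d1 : DifferentiableAt ℂ (fun w : ℂ => w ^ 2 / (w ^ 2 - 1)) w := by
    fun_prop (disch := exact h2)
  have d2 : DifferentiableAt ℂ (fun w : ℂ => (w - 1) / (w + 1)) w := by
    fun_prop (disch := exact hp)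
  exact (d0.mul ((d1.clog s1).const_mul _).cexp).mul ((d2.clog s2).const_mul _).cexp

/-- The density `1 / (cosh πv (w - tanh πv))` of the Cauchy integral representing `Q`, in the
coordinate `v` in which the cut `(-1, 1)` is `tanh πv`. -/
def cauchyDensity (w : ℂ) (v : ℝ) : ℂ :=
  ((Real.cosh (Real.pi * v) : ℂ) * (w - Real.tanh (Real.pi * v)))⁻¹

theorem norm_ofReal_tanh_lt_one (y : ℝ) : ‖((Real.tanh y : ℝ) : ℂ)‖ < 1 := by
  rw [Complex.norm_real]
  exact abs_lt.2 ⟨Real.neg_one_lt_tanh y, Real.tanh_lt_one y⟩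

theorem norm_sub_tanh_ge (w : ℂ) (y : ℝ) : ‖w‖ - 1 ≤ ‖w - (Real.tanh y : ℝ)‖ := by
  have := norm_sub_norm_le w (Real.tanh y : ℝ)
  linarith [norm_ofReal_tanh_lt_one y]

theorem sub_tanh_ne_zero {w : ℂ} (hw : 1 < ‖w‖) (y : ℝ) : w - (Real.tanh y : ℝ) ≠ 0 :=
  norm_pos_iff.1 (by linarith [norm_sub_tanh_ge w y])

theorem continuous_tanh : Continuous Real.tanh := by
  simp_rw [funext Real.tanh_eq_sinh_div_cosh]
  fun_prop (disch := exact fun x => (Real.cosh_pos x).ne')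

theorem continuous_cauchyDensity {w : ℂ} (hw : 1 < ‖w‖) : Continuous (cauchyDensity w) := by
  have := continuous_tanh
  unfold cauchyDensity
  refine Continuous.inv₀ (by fun_prop) fun v => mul_ne_zero ?_ (sub_tanh_ne_zero hw _)
  exact_mod_cast (Real.cosh_pos _).ne'

theorem norm_cauchyDensity_le {w : ℂ} (hw : 1 < ‖w‖) (v : ℝ) :
    ‖cauchyDensity w v‖ ≤ (Real.cosh (Real.pi * v))⁻¹ * (‖w‖ - 1)⁻¹ := by
  have hc := Real.cosh_pos (Real.pi * v)
  rw [cauchyDensity, norm_inv, norm_mul, Complex.norm_real, Real.norm_eq_abs, abs_of_pos hc,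
    mul_inv]
  have : 0 < ‖w‖ - 1 := by linarith
  gcongr
  exact norm_sub_tanh_ge w _

theorem integrable_cauchyDensity {w : ℂ} (hw : 1 < ‖w‖) : Integrable (cauchyDensity w) :=
  (integrable_inv_cosh.mul_const _).mono' (continuous_cauchyDensity hw).aestronglyMeasurable
    (ae_of_all _ (norm_cauchyDensity_le hw))

theorem differentiableAt_fourier_cauchyDensity (τ : ℝ) {w₀ : ℂ} (hw : 1 < ‖w₀‖) :
    DifferentiableAt ℂ (fun w => 𝓕 (cauchyDensity w) τ) w₀ := by
  simp_rw [Real.fourier_real_eq]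
  obtain ⟨ε, hε, hball⟩ : ∃ ε > 0, ∀ w ∈ Metric.ball w₀ ε, 1 + ε < ‖w‖ := by
    refine ⟨(‖w₀‖ - 1) / 2, by linarith, fun w hwb => ?_⟩
    have h1 := norm_sub_norm_le w₀ w
    rw [Metric.mem_ball, dist_comm, dist_eq_norm] at hwb
    linarith
  have hch : Continuous fun v : ℝ => Real.fourierChar (-(v * τ)) := by fun_prop
  refine (hasDerivAt_integral_of_dominated_loc_of_deriv_le (Metric.ball_mem_nhds w₀ hε)
    (F' := fun w v => Real.fourierChar (-(v * τ)) •
      (-((Real.cosh (Real.pi * v) : ℂ)) * (cauchyDensity w v) ^ 2))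
    (bound := fun v => (Real.cosh (Real.pi * v))⁻¹ * (ε⁻¹) ^ 2) ?_ ?_ ?_ ?_ ?_ ?_).2.differentiableAt
  · filter_upwards [Metric.ball_mem_nhds w₀ hε] with w hwb
    exact (hch.smul (continuous_cauchyDensity (by linarith [hball w hwb]))).aestronglyMeasurable
  · exact (integrable_cauchyDensity hw).mono
      (hch.smul (continuous_cauchyDensity hw)).aestronglyMeasurable
      (ae_of_all _ fun v => by simp)
  · refine (hch.smul (Continuous.mul (by fun_prop) ?_)).aestronglyMeasurable
    exact (continuous_cauchyDensity hw).pow 2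
  · refine ae_of_all _ fun v w hwb => ?_
    have hc := Real.cosh_pos (Real.pi * v)
    have h1 := hball w hwb
    have h2 := norm_cauchyDensity_le (w := w) (by linarith) v
    have h3 : (‖w‖ - 1)⁻¹ ≤ ε⁻¹ := inv_anti₀ hε (by linarith)
    rw [Circle.norm_smul, norm_mul, norm_neg, norm_pow, Complex.norm_real, Real.norm_eq_abs,
      abs_of_pos hc]
    calc _ ≤ Real.cosh (Real.pi * v) * ((Real.cosh (Real.pi * v))⁻¹ * ε⁻¹) ^ 2 := by
          gcongr
          exact h2.trans (by gcongr)
      _ = _ := by field_simp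
  · exact integrable_inv_cosh.mul_const _
  · refine ae_of_all _ fun v w hwb => ?_
    have hc : (Real.cosh (Real.pi * v) : ℂ) ≠ 0 := by exact_mod_cast (Real.cosh_pos _).ne'
    have h1 := hball w hwb
    have h2 := sub_tanh_ne_zero (w := w) (by linarith) (Real.pi * v)
    have h3 := ((((hasDerivAt_id w).sub_const ((Real.tanh (Real.pi * v) : ℝ) : ℂ)).const_mul
      (Real.cosh (Real.pi * v) : ℂ)).inv (mul_ne_zero hc h2)).const_smul
        (Real.fourierChar (-(v * τ)))
    convert! h3 using 2
    simp only [cauchyDensity, id, mul_one]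
    field_simp

theorem fourier_comp_sub_right (f : ℝ → ℂ) (a τ : ℝ) :
    𝓕 (fun v => f (v - a)) τ = Real.fourierChar (-(a * τ)) • 𝓕 f τ := by
  simp_rw [Real.fourier_real_eq]
  rw [← integral_add_right_eq_self _ a]
  simp only [add_sub_cancel_right, Circle.smul_def, smul_eq_mul]
  rw [← integral_const_mul]
  congr 1
  ext v
  rw [← mul_assoc, ← Circle.coe_mul, ← AddChar.map_add_eq_mul]
  congr 3
  ring

/-- On the real half line `w > 1`, the density is a translate of a multiple of the hyperbolic
secant: with `w = coth πa` one has `w cosh πv - sinh πv = cosh π(v - a) / sinh πa`. -/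
theorem Q_eq_of_one_lt (s : ℝ) {w : ℝ} (hw : 1 < w) :
    Q s w = Real.cosh (Real.pi * expParam s) * 𝓕 (cauchyDensity w) (expParam s) := by
  have hm : 0 < w - 1 := by linarith
  have hp : 0 < w + 1 := by linarith
  have hw2 : 0 < w ^ 2 - 1 := by nlinarith
  set l := Real.log ((w - 1) / (w + 1)) with hl
  set a := -(l / (2 * Real.pi)) with ha
  have hpi := Real.pi_pos
  have hla : l = -(2 * (Real.pi * a)) := by rw [ha]; field_simp
  have hexp : Real.exp (Real.pi * a) ^ 2 = (w + 1) / (w - 1) := by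
    rw [sq, ← Real.exp_add, ← two_mul, ← neg_neg (2 * (Real.pi * a)), ← hla, Real.exp_neg,
      hl, Real.exp_log (by positivity), inv_div]
  have hE := Real.exp_pos (Real.pi * a)
  have hE2 : Real.exp (Real.pi * a) = √(w + 1) / √(w - 1) := by
    rw [← Real.sqrt_div hp.le, ← hexp, Real.sqrt_sq hE.le]
  have q1 := Real.sqrt_pos.2 hm
  have q2 := Real.sqrt_pos.2 hp
  have hsinh : Real.sinh (Real.pi * a) = (√(w ^ 2 - 1))⁻¹ := by
    rw [show w ^ 2 - 1 = (w + 1) * (w - 1) by ring, Real.sqrt_mul hp.le, Real.sinh_eq,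
      Real.exp_neg, hE2]
    field_simp
    rw [Real.sq_sqrt hm.le, Real.sq_sqrt hp.le]
    ring
  have hcosh : Real.cosh (Real.pi * a) = w * (√(w ^ 2 - 1))⁻¹ := by
    rw [show w ^ 2 - 1 = (w + 1) * (w - 1) by ring, Real.sqrt_mul hp.le, Real.cosh_eq,
      Real.exp_neg, hE2]
    field_simp
    rw [Real.sq_sqrt hm.le, Real.sq_sqrt hp.le]
    ring
  have q3 := Real.sqrt_pos.2 hw2
  have hdens : cauchyDensity w = fun v => (((√(w ^ 2 - 1))⁻¹ : ℝ) : ℂ) *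
      (fun v : ℝ => (((Real.cosh (Real.pi * v))⁻¹ : ℝ) : ℂ)) (v - a) := by
    ext v
    have hc := Real.cosh_pos (Real.pi * v)
    have hc' := Real.cosh_pos (Real.pi * (v - a))
    have : (Real.cosh (Real.pi * v) * (w - Real.tanh (Real.pi * v)))⁻¹ =
        (√(w ^ 2 - 1))⁻¹ * (Real.cosh (Real.pi * (v - a)))⁻¹ := by
      rw [← mul_inv, mul_sub, Real.tanh_eq_sinh_div_cosh, mul_div_cancel₀ _ hc.ne',
        mul_sub Real.pi v a, Real.cosh_sub, hcosh, hsinh]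
      congr 1
      field_simp
    rw [cauchyDensity]
    have h := congrArg Complex.ofReal this
    push_cast at h ⊢
    exact h
  have hF : 𝓕 (cauchyDensity w) (expParam s) = (((√(w ^ 2 - 1))⁻¹ : ℝ) : ℂ) *
      (Real.fourierChar (-(a * expParam s)) •
        (((Real.cosh (Real.pi * expParam s))⁻¹ : ℝ) : ℂ)) := by
    rw [hdens, ← fourier_inv_cosh, ← fourier_comp_sub_right]
    simp_rw [Real.fourier_real_eq, ← integral_const_mul, mul_smul_comm]
  have hch : (Real.cosh (Real.pi * expParam s) : ℂ) ≠ 0 := by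
    exact_mod_cast (Real.cosh_pos _).ne'
  rw [hF, Circle.smul_def, Real.fourierChar_apply, Q]
  have e1 : ((w : ℂ) - 1) / (w + 1) = (((w - 1) / (w + 1) : ℝ) : ℂ) := by push_cast; rfl
  have e2 : (w : ℂ) ^ 2 / (w ^ 2 - 1) = ((w ^ 2 / (w ^ 2 - 1) : ℝ) : ℂ) := by push_cast; rfl
  have e3 : (w : ℂ) / (w ^ 2 - 1) * Complex.exp (-(1 / 2) * Complex.log (w ^ 2 / (w ^ 2 - 1))) =
      (((√(w ^ 2 - 1))⁻¹ : ℝ) : ℂ) := by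
    have : w / (w ^ 2 - 1) * Real.exp (-(1 / 2) * Real.log (w ^ 2 / (w ^ 2 - 1))) =
        (√(w ^ 2 - 1))⁻¹ := by
      have h1 : 0 < w ^ 2 / (w ^ 2 - 1) := by positivity
      rw [neg_mul, Real.exp_neg, one_div_mul_eq_div, ← Real.log_sqrt h1.le,
        Real.exp_log (Real.sqrt_pos.2 h1), Real.sqrt_div (by positivity),
        Real.sqrt_sq (by linarith)]
      have := Real.sq_sqrt hw2.le
      field_simp
      exact this
    rw [e2, ← Complex.ofReal_log (by positivity), ← this]
    push_cast
    rfl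
  rw [e3, e1, ← Complex.ofReal_log (by positivity), ← hl, hla]
  have e4 : Complex.I / (2 * Real.pi) * (Real.log (1 / s - 1) : ℝ) *
      ((-(2 * (Real.pi * a)) : ℝ) : ℂ) =
      ((2 * Real.pi * -(a * expParam s) : ℝ) : ℂ) * Complex.I := by
    have hpc : (Real.pi : ℂ) ≠ 0 := by exact_mod_cast hpi.ne'
    rw [expParam]
    push_cast
    field_simp
  rw [e4]
  simp only [smul_eq_mul, Complex.ofReal_inv]
  field_simp

theorem isPreconnected_one_lt_norm : IsPreconnected {w : ℂ | 1 < ‖w‖} := by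
  have h : {w : ℂ | 1 < ‖w‖} = Complex.exp '' {z : ℂ | 0 < z.re} := by
    ext w
    constructor
    · intro hw
      have hw' : 1 < ‖w‖ := hw
      refine ⟨Complex.log w, ?_, Complex.exp_log (norm_pos_iff.1 (by linarith))⟩
      rw [mem_ofPred_eq, Complex.log_re]
      exact Real.log_pos hw'
    · rintro ⟨z, hz, rfl⟩
      rw [mem_ofPred_eq, Complex.norm_exp]
      exact Real.one_lt_exp_iff.2 hz
  rw [h]
  exact (convex_halfSpace_re_gt 0).isPreconnected.image _ Complex.continuous_exp.continuousOn

theorem notMem_cut_of_one_lt_norm {w : ℂ} (hw : 1 < ‖w‖) : w ∉ Complex.ofReal '' Icc (-1) 1 := by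
  rintro ⟨t, ht, rfl⟩
  rw [Complex.norm_real] at hw
  exact absurd (abs_le.2 ht) (not_le.2 hw)

/-- `Q` is the Cauchy integral of its jump across the cut `(-1, 1)`. -/
theorem Q_eq_fourier_cauchyDensity (s : ℝ) {w : ℂ} (hw : 1 < ‖w‖) :
    Q s w = Real.cosh (Real.pi * expParam s) * 𝓕 (cauchyDensity w) (expParam s) := by
  have hopen : IsOpen {w : ℂ | 1 < ‖w‖} := isOpen_lt continuous_const continuous_norm
  have h1 : AnalyticOnNhd ℂ (Q s) {w | 1 < ‖w‖} := DifferentiableOn.analyticOnNhd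
    (fun w hw => (Q_differentiableAt s (notMem_cut_of_one_lt_norm hw)).differentiableWithinAt) hopen
  have h2 : AnalyticOnNhd ℂ (fun w => (Real.cosh (Real.pi * expParam s) : ℂ) *
      𝓕 (cauchyDensity w) (expParam s)) {w | 1 < ‖w‖} := DifferentiableOn.analyticOnNhd
    (fun w hw => ((differentiableAt_fourier_cauchyDensity _ hw).const_mul _).differentiableWithinAt)
    hopen
  refine h1.eqOn_of_preconnected_of_frequently_eq h2 isPreconnected_one_lt_norm
    (z₀ := ((2 : ℝ) : ℂ)) (by simp) ?_ hw
  have ht : Tendsto (fun t : ℝ => (t : ℂ)) (𝓝[>] 2) (𝓝[≠] ((2 : ℝ) : ℂ)) := by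
    refine tendsto_nhdsWithin_iff.2 ⟨Complex.continuous_ofReal.continuousAt.mono_left
      nhdsWithin_le_nhds, ?_⟩
    filter_upwards [self_mem_nhdsWithin] with t ht
    exact fun h => (ne_of_gt ht) (Complex.ofReal_injective h)
  refine ht.frequently (Eventually.frequently ?_)
  filter_upwards [self_mem_nhdsWithin] with t ht
  exact Q_eq_of_one_lt s (lt_trans one_lt_two ht)

/-! ### Evaluation of the generalized eigenfunctions -/

/-- The wave `e^{-ix tanh πz} / cosh πz`: the plane wave `e^{-ixt}`, `t ∈ (-1, 1)`, written in the
coordinate `t = tanh πz` and weighted by the square root of `π⁻¹ dt/dz`. -/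
def wave (x : ℝ) (z : ℂ) : ℂ :=
  Complex.exp (-(Complex.I * x * Complex.tanh (Real.pi * z))) / Complex.cosh (Real.pi * z)

/-- The wave on the real line. -/
def realWave (x : ℝ) (v : ℝ) : ℂ := wave x v

theorem realWave_eq (x v : ℝ) : realWave x v =
    Complex.exp (-(Complex.I * x * (Real.tanh (Real.pi * v) : ℝ))) *
      ((Real.cosh (Real.pi * v))⁻¹ : ℝ) := by
  rw [realWave, wave, div_eq_mul_inv]
  push_cast
  rfl

theorem norm_realWave (x v : ℝ) : ‖realWave x v‖ = (Real.cosh (Real.pi * v))⁻¹ := by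
  have h : -(Complex.I * x * (Real.tanh (Real.pi * v) : ℝ)) =
      ((-(x * Real.tanh (Real.pi * v)) : ℝ) : ℂ) * Complex.I := by
    push_cast; ring
  rw [realWave_eq, norm_mul, h, Complex.norm_exp_ofReal_mul_I, one_mul, Complex.norm_real,
    Real.norm_eq_abs, abs_of_pos (inv_pos.2 (Real.cosh_pos _))]

theorem continuous_realWave_uncurry : Continuous fun p : ℝ × ℝ => realWave p.1 p.2 := by
  have := continuous_tanh
  simp_rw [realWave_eq]
  fun_prop (disch := exact fun x => (Real.cosh_pos _).ne')

theorem continuous_realWave (x : ℝ) : Continuous (realWave x) := by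
  have h : Continuous fun v : ℝ => ((x, v) : ℝ × ℝ) := by fun_prop
  simpa only [Function.comp_def] using continuous_realWave_uncurry.comp h

theorem integrable_realWave (x : ℝ) : Integrable (realWave x) :=
  integrable_inv_cosh.mono' (continuous_realWave x).aestronglyMeasurable
    (ae_of_all _ fun v => (norm_realWave x v).le)

/-- The integral of `e^{-ixw} Q_s(w)` around the cut. -/
theorem circleIntegral_exp_mul_Q (s x : ℝ) {R : ℝ} (hR : 1 < R) :
    ∮ w in C(0, R), Complex.exp (-(Complex.I * x * w)) * Q s w =
      2 * Real.pi * Complex.I * Real.cosh (Real.pi * expParam s) *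
        𝓕 (realWave x) (expParam s) := by
  have hR0 : 0 < R := by linarith
  have hnorm : ∀ θ, ‖circleMap 0 R θ‖ = R := fun θ => by
    rw [norm_circleMap_zero, abs_of_pos hR0]
  set τ := expParam s
  have hne : ∀ (θ v : ℝ), (Real.cosh (Real.pi * v) : ℂ) *
      (circleMap 0 R θ - (Real.tanh (Real.pi * v) : ℝ)) ≠ 0 := fun θ v =>
    mul_ne_zero (by exact_mod_cast (Real.cosh_pos _).ne')
      (sub_tanh_ne_zero (by rw [hnorm]; exact hR) _)
  have hcont : Continuous fun p : ℝ × ℝ => deriv (circleMap 0 R) p.1 •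
      (Complex.exp (-(Complex.I * x * circleMap 0 R p.1)) *
        (Real.cosh (Real.pi * τ) * (Real.fourierChar (-(p.2 * τ)) •
          cauchyDensity (circleMap 0 R p.1) p.2))) := by
    have h1 := continuous_tanh
    have h2 : Continuous fun p : ℝ × ℝ => cauchyDensity (circleMap 0 R p.1) p.2 :=
      Continuous.inv₀ (by fun_prop) fun p => hne p.1 p.2
    simp only [deriv_circleMap, smul_eq_mul]
    fun_prop
  have hint : Integrable (Function.uncurry fun θ v : ℝ => deriv (circleMap 0 R) θ •
      (Complex.exp (-(Complex.I * x * circleMap 0 R θ)) *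
        (Real.cosh (Real.pi * τ) * (Real.fourierChar (-(v * τ)) •
          cauchyDensity (circleMap 0 R θ) v))))
      ((volume.restrict (uIoc 0 (2 * Real.pi))).prod volume) := by
    have : IsFiniteMeasure (volume.restrict (uIoc 0 (2 * Real.pi))) := ⟨by
      rw [Measure.restrict_apply_univ]
      exact measure_Ioc_lt_top⟩
    have hb : Integrable (fun p : ℝ × ℝ => (R * (Real.exp (|x| * R) * Real.cosh (Real.pi * τ))) *
        ((Real.cosh (Real.pi * p.2))⁻¹ * (R - 1)⁻¹))
        ((volume.restrict (uIoc 0 (2 * Real.pi))).prod volume) :=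
      ((integrable_inv_cosh.mul_const _).comp_snd _).const_mul _
    refine hb.mono' hcont.aestronglyMeasurable (ae_of_all _ fun p => ?_)
    have h1 := norm_cauchyDensity_le (w := circleMap 0 R p.1) (by rw [hnorm]; exact hR) p.2
    rw [hnorm] at h1
    have h2 : ‖Complex.exp (-(Complex.I * x * circleMap 0 R p.1))‖ ≤ Real.exp (|x| * R) := by
      refine (Complex.norm_exp_le_exp_norm _).trans (Real.exp_le_exp.2 ?_)
      rw [norm_neg, norm_mul, norm_mul, Complex.norm_I, one_mul, Complex.norm_real, hnorm,
        Real.norm_eq_abs]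
    simp only [Function.uncurry, norm_smul, norm_mul, Circle.norm_smul, deriv_circleMap, hnorm,
      Complex.norm_I, mul_one, Complex.norm_real, Real.norm_eq_abs,
      abs_of_pos (Real.cosh_pos (Real.pi * τ))]
    rw [mul_assoc R, mul_assoc (Real.exp _)]
    have := Real.cosh_pos (Real.pi * τ)
    gcongr
  have hinner : ∀ v : ℝ, ∮ w in C(0, R), Complex.exp (-(Complex.I * x * w)) *
      (Real.cosh (Real.pi * τ) * (Real.fourierChar (-(v * τ)) • cauchyDensity w v)) =
      2 * Real.pi * Complex.I * Real.cosh (Real.pi * τ) *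
        (Real.fourierChar (-(v * τ)) • realWave x v) := by
    intro v
    have hd : DifferentiableOn ℂ (fun w : ℂ => Complex.exp (-(Complex.I * x * w)))
        (Metric.closedBall 0 R) := by fun_prop
    have h := hd.circleIntegral_sub_inv_smul (w := ((Real.tanh (Real.pi * v) : ℝ) : ℂ)) (by
      rw [Metric.mem_ball, dist_zero_right]
      exact (norm_ofReal_tanh_lt_one _).trans hR)
    simp only [smul_eq_mul] at h
    rw [realWave_eq]
    have e : ∀ w : ℂ, Complex.exp (-(Complex.I * x * w)) *
        (Real.cosh (Real.pi * τ) * (Real.fourierChar (-(v * τ)) • cauchyDensity w v)) =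
        (Real.cosh (Real.pi * τ) * (Real.fourierChar (-(v * τ)) : ℂ) *
          ((Real.cosh (Real.pi * v))⁻¹ : ℝ)) * ((w - (Real.tanh (Real.pi * v) : ℝ))⁻¹ *
            Complex.exp (-(Complex.I * x * w))) := by
      intro w
      rw [cauchyDensity, Circle.smul_def, mul_inv, smul_eq_mul, Complex.ofReal_inv]
      ring
    simp_rw [e]
    rw [circleIntegral.integral_const_mul, h, Circle.smul_def, smul_eq_mul]
    ring
  calc _ = ∫ θ in (0 : ℝ)..2 * Real.pi, ∫ v : ℝ, deriv (circleMap 0 R) θ •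
      (Complex.exp (-(Complex.I * x * circleMap 0 R θ)) *
        (Real.cosh (Real.pi * τ) * (Real.fourierChar (-(v * τ)) •
          cauchyDensity (circleMap 0 R θ) v))) := by
        rw [circleIntegral]
        congr 1
        ext θ
        rw [Q_eq_fourier_cauchyDensity s (by rw [hnorm]; exact hR), Real.fourier_real_eq,
          integral_smul, integral_const_mul, integral_const_mul]
    _ = ∫ v : ℝ, ∮ w in C(0, R), Complex.exp (-(Complex.I * x * w)) *
      (Real.cosh (Real.pi * τ) * (Real.fourierChar (-(v * τ)) • cauchyDensity w v)) :=
        intervalIntegral_integral_swap hint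
    _ = _ := by
        simp_rw [hinner]
        rw [integral_const_mul, Real.fourier_real_eq]

theorem continuousOn_Q (s : ℝ) : ContinuousOn (Q s) (Complex.ofReal '' Icc (-1) 1)ᶜ :=
  fun _ hw => (Q_differentiableAt s hw).continuousAt.continuousWithinAt

theorem notMem_cut_of_im_pos {w : ℂ} (hw : 0 < w.im) : w ∉ Complex.ofReal '' Icc (-1) 1 := by
  rintro ⟨t, -, rfl⟩
  simp at hw

theorem exists_norm_Q_le (s : ℝ) : ∃ C, ∀ w : ℂ, 2 ≤ ‖w‖ → ‖w‖ * ‖Q s w‖ ≤ C := by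
  set J := ∫ v : ℝ, (Real.cosh (Real.pi * v))⁻¹
  have hJ : 0 ≤ J := integral_nonneg fun v => (inv_pos.2 (Real.cosh_pos _)).le
  refine ⟨Real.cosh (Real.pi * expParam s) * (J * 2), fun w hw => ?_⟩
  have hw1 : 1 < ‖w‖ := by linarith
  have h1 : ‖𝓕 (cauchyDensity w) (expParam s)‖ ≤ J * (‖w‖ - 1)⁻¹ := by
    rw [Real.fourier_real_eq, ← integral_mul_const]
    refine norm_integral_le_of_norm_le (integrable_inv_cosh.mul_const _) (ae_of_all _ fun v => ?_)
    rw [Circle.norm_smul]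
    exact norm_cauchyDensity_le hw1 v
  have hc := Real.cosh_pos (Real.pi * expParam s)
  rw [Q_eq_fourier_cauchyDensity s hw1, norm_mul, Complex.norm_real, Real.norm_eq_abs,
    abs_of_pos hc]
  have h2 : ‖w‖ * (‖w‖ - 1)⁻¹ ≤ 2 := by
    rw [← div_eq_mul_inv, div_le_iff₀ (by linarith)]
    linarith
  calc _ ≤ ‖w‖ * (Real.cosh (Real.pi * expParam s) * (J * (‖w‖ - 1)⁻¹)) := by gcongr
    _ = Real.cosh (Real.pi * expParam s) * (J * (‖w‖ * (‖w‖ - 1)⁻¹)) := by ring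
    _ ≤ _ := by gcongr

/-- The integrand of `q_s(x)` pulled back to the circle of radius `R`. -/
def arcIntegrand (s x R θ : ℝ) : ℂ :=
  deriv (circleMap 0 R) θ • (Complex.exp (-(Complex.I * x * circleMap 0 R θ)) *
    Q s (circleMap 0 R θ))

theorem continuous_arcIntegrand (s x : ℝ) {R : ℝ} (hR : 1 < R) :
    Continuous (arcIntegrand s x R) := by
  have h : Continuous fun θ => Q s (circleMap 0 R θ) :=
    (continuousOn_Q s).comp_continuous (by fun_prop) fun θ => notMem_cut_of_one_lt_norm (by
      rw [norm_circleMap_zero, abs_of_pos (by linarith)]; exact hR)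
  unfold arcIntegrand
  simp only [deriv_circleMap]
  fun_prop

theorem norm_arcIntegrand (s x R θ : ℝ) : ‖arcIntegrand s x R θ‖ =
    Real.exp (x * (R * Real.sin θ)) * (‖circleMap 0 R θ‖ * ‖Q s (circleMap 0 R θ)‖) := by
  have e : (-(Complex.I * x * circleMap 0 R θ)).re = x * (R * Real.sin θ) := by
    simp [circleMap, Complex.exp_ofReal_mul_I_re, Complex.exp_ofReal_mul_I_im]
  rw [arcIntegrand, norm_smul, norm_mul, Complex.norm_exp, e, deriv_circleMap, norm_mul,
    Complex.norm_I]
  ring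

/-- A chord of a circle in the upper half plane and the arc above it carry the same integral,
because they lie in a disc on which the integrand is holomorphic. -/
theorem integral_chord_eq_arc (s x : ℝ) {A b R : ℝ} (hA : 0 < A) (hb : 0 < b) (hR : 0 < R)
    (hR2 : R ^ 2 = A ^ 2 + b ^ 2) {θ₀ : ℝ} (hθ : θ₀ = Real.arcsin (b / R)) :
    ∫ u in (-A)..A, Complex.exp (-Complex.I * x * (u + Complex.I * b)) *
      Q s (u + Complex.I * b) =
      -∫ θ in θ₀..(Real.pi - θ₀), arcIntegrand s x R θ := by
  set M : ℝ := R ^ 2 / b with hM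
  have hMpos : 0 < M := by positivity
  -- membership in the disc of centre `iM` and radius `M`
  have hmem : ∀ z : ℂ, z.re ^ 2 + z.im ^ 2 ≤ R ^ 2 → b ≤ z.im →
      z ∈ Metric.ball (Complex.I * M) M := by
    intro z h1 h2
    rw [Metric.mem_ball, dist_eq_norm, ← abs_of_pos hMpos, ← abs_norm, ← sq_lt_sq,
      Complex.sq_norm, Complex.normSq_apply]
    simp only [Complex.sub_re, Complex.sub_im, Complex.mul_re, Complex.mul_im, Complex.I_re,
      Complex.I_im, Complex.ofReal_re, Complex.ofReal_im, abs_of_pos hMpos]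
    have h3 : M * b = R ^ 2 := by rw [hM]; field_simp
    nlinarith [mul_le_mul_of_nonneg_left h2 hMpos.le, sq_pos_of_pos hR]
  have himpos : ∀ z ∈ Metric.ball (Complex.I * M) M, 0 < z.im := by
    intro z hz
    rw [Metric.mem_ball, dist_eq_norm] at hz
    have := (Complex.abs_im_le_norm (z - Complex.I * M)).trans_lt hz
    simp only [Complex.sub_im, Complex.mul_im, Complex.I_re, Complex.I_im, Complex.ofReal_re,
      Complex.ofReal_im, mul_zero, one_mul, zero_add] at this
    linarith [(abs_lt.1 this).1]
  have hd : DifferentiableOn ℂ (fun w : ℂ => Complex.exp (-(Complex.I * x * w)) * Q s w)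
      (Metric.ball (Complex.I * M) M) := fun z hz => by
    have h1 := Q_differentiableAt s (notMem_cut_of_im_pos (himpos z hz))
    have h2 : DifferentiableAt ℂ (fun w : ℂ => Complex.exp (-(Complex.I * x * w))) z := by fun_prop
    exact (h2.mul h1).differentiableWithinAt
  obtain ⟨g, hg⟩ := hd.isExactOn_ball
  have hbR : b < R := by nlinarith [sq_pos_of_pos hA]
  have hb1 : b / R ≤ 1 := (div_le_one hR).2 hbR.le
  have hb0 : 0 < b / R := by positivity
  have hs : Real.sin θ₀ = b / R := by
    rw [hθ, Real.sin_arcsin (by linarith) hb1]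
  have hc : Real.cos θ₀ = A / R := by
    rw [hθ, Real.cos_arcsin, ← abs_of_pos (div_pos hA hR), ← Real.sqrt_sq_eq_abs]
    congr 1
    field_simp
    linarith
  have hθ0 : 0 ≤ θ₀ := by rw [hθ]; exact Real.arcsin_nonneg.2 hb0.le
  have hθ1 : θ₀ ≤ Real.pi / 2 := by rw [hθ]; exact Real.arcsin_le_pi_div_two _
  have hcm : ∀ θ, circleMap 0 R θ = ((R * Real.cos θ : ℝ) : ℂ) + ((R * Real.sin θ : ℝ)) * Complex.I := by
    intro θ
    rw [circleMap, zero_add, Complex.exp_mul_I]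
    push_cast
    ring
  have chordmem : ∀ u ∈ uIcc (-A) A, (u + Complex.I * b : ℂ) ∈ Metric.ball (Complex.I * M) M := by
    intro u hu
    rw [uIcc_of_le (by linarith)] at hu
    apply hmem <;> simp
    nlinarith [hu.1, hu.2]
  have arcmem : ∀ θ ∈ uIcc θ₀ (Real.pi - θ₀), circleMap 0 R θ ∈ Metric.ball (Complex.I * M) M := by
    intro θ hθm
    rw [uIcc_of_le (by linarith)] at hθm
    have hsin : b / R ≤ Real.sin θ := by
      rw [← hs, ← Real.cos_pi_div_two_sub θ₀, ← Real.cos_pi_div_two_sub θ,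
        ← Real.cos_abs (Real.pi / 2 - θ)]
      refine Real.cos_le_cos_of_nonneg_of_le_pi (abs_nonneg _) (by linarith [Real.pi_pos]) ?_
      rw [abs_le]
      constructor <;> linarith [hθm.1, hθm.2]
    rw [hcm]
    apply hmem
    · simp only [Complex.add_re, Complex.add_im, Complex.ofReal_re, Complex.ofReal_im,
        Complex.re_ofReal_mul, Complex.im_ofReal_mul, Complex.I_re, Complex.I_im, mul_zero,
        mul_one, add_zero, zero_add]
      nlinarith [Real.sin_sq_add_cos_sq θ]
    · simp only [Complex.add_im, Complex.ofReal_im, Complex.im_ofReal_mul, Complex.I_im,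
        mul_one, zero_add]
      rw [div_le_iff₀ hR] at hsin
      linarith
  have hchord : ∫ u in (-A)..A, Complex.exp (-Complex.I * x * (u + Complex.I * b)) *
      Q s (u + Complex.I * b) = g (A + Complex.I * b) - g ((-A : ℝ) + Complex.I * b) := by
    refine intervalIntegral.integral_eq_sub_of_hasDerivAt (f := fun u : ℝ => g (u + Complex.I * b))
      (fun u hu => ?_) ?_
    · have h1 := hg _ (chordmem u hu)
      have h2 : HasDerivAt (fun u : ℝ => (u + Complex.I * b : ℂ)) 1 u :=
        (Complex.ofRealCLM.hasDerivAt (x := u)).add_const _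
      have h3 := h1.comp u h2
      rw [mul_one] at h3
      rw [neg_mul, neg_mul]
      exact h3
    · refine ContinuousOn.intervalIntegrable fun u hu => ?_
      have h1 : ContinuousAt (Q s) (u + Complex.I * b : ℂ) :=
        (Q_differentiableAt s (notMem_cut_of_im_pos (himpos _ (chordmem u hu)))).continuousAt
      have h2 : ContinuousAt (fun u : ℝ => Q s (u + Complex.I * b)) u :=
        ContinuousAt.comp (f := fun u : ℝ => (u + Complex.I * b : ℂ)) h1 (by fun_prop)
      exact (ContinuousAt.mul (by fun_prop) h2).continuousWithinAt
  have harc : ∫ θ in θ₀..(Real.pi - θ₀), arcIntegrand s x R θ =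
      g (circleMap 0 R (Real.pi - θ₀)) - g (circleMap 0 R θ₀) := by
    refine intervalIntegral.integral_eq_sub_of_hasDerivAt (f := fun θ => g (circleMap 0 R θ))
      (fun θ hθm => ?_) ?_
    · have h3 := (hg _ (arcmem θ hθm)).comp θ (hasDerivAt_circleMap 0 R θ)
      rw [mul_comm] at h3
      rw [arcIntegrand, deriv_circleMap, smul_eq_mul]
      exact h3
    · refine ContinuousOn.intervalIntegrable fun θ hθm => ?_
      have h1 : ContinuousAt (Q s) (circleMap 0 R θ) :=
        (Q_differentiableAt s (notMem_cut_of_im_pos (himpos _ (arcmem θ hθm)))).continuousAt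
      have h2 : ContinuousAt (fun θ : ℝ => Q s (circleMap 0 R θ)) θ :=
        ContinuousAt.comp (f := circleMap 0 R) h1 (by fun_prop)
      have h3 : Continuous fun θ : ℝ => circleMap 0 R θ * Complex.I := by fun_prop
      have h4 : Continuous fun θ : ℝ => Complex.exp (-(Complex.I * x * circleMap 0 R θ)) := by
        fun_prop
      unfold arcIntegrand
      simp only [deriv_circleMap]
      exact (h3.continuousAt.smul (h4.continuousAt.mul h2)).continuousWithinAt
  rw [hchord, harc, hcm, hcm, Real.cos_pi_sub, Real.sin_pi_sub, hs, hc]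
  have e1 : R * (A / R) = A := by field_simp
  have e2 : R * (b / R) = b := by field_simp
  have e3 : R * -(A / R) = -A := by field_simp
  rw [e1, e2, e3, mul_comm (b : ℂ)]
  ring

/-- The arc below the line `Im w = b` contributes nothing in the limit: there
`|e^{-ixw}| = e^{x Im w}` is bounded by `e^{xb}` and tends to `0` pointwise. -/
theorem tendsto_lower_arc (s : ℝ) {x b : ℝ} (hx : 0 < x) (hb : 0 < b) :
    Tendsto (fun R : ℝ => ∫ θ in (Real.pi - Real.arcsin (b / R))..(2 * Real.pi +
      Real.arcsin (b / R)), arcIntegrand s x R θ) atTop (𝓝 0) := by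
  obtain ⟨C, hC⟩ := exists_norm_Q_le s
  have hpi := Real.pi_pos
  have htheta : Tendsto (fun R : ℝ => Real.arcsin (b / R)) atTop (𝓝 0) := by
    have h1 : Tendsto (fun R : ℝ => b / R) atTop (𝓝 0) := tendsto_const_nhds.div_atTop tendsto_id
    have h2 := (Real.continuous_arcsin.tendsto 0).comp h1
    rw [Real.arcsin_zero] at h2
    exact h2
  have hbig : ∀ᶠ R : ℝ in atTop, 2 ≤ R ∧ b ≤ R := (eventually_ge_atTop 2).and (eventually_ge_atTop b)
  have hpt : ∀ R : ℝ, 2 ≤ R → ∀ θ, ‖arcIntegrand s x R θ‖ ≤ Real.exp (x * (R * Real.sin θ)) * |C| := by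
    intro R hR θ
    rw [norm_arcIntegrand]
    gcongr
    refine (hC _ ?_).trans (le_abs_self C)
    rw [norm_circleMap_zero, abs_of_pos (by linarith)]
    exact hR
  have hmain : Tendsto (fun R : ℝ => ∫ θ in Ioc (0 : ℝ) (3 * Real.pi),
      (Ioc (Real.pi - Real.arcsin (b / R)) (2 * Real.pi + Real.arcsin (b / R))).indicator
        (arcIntegrand s x R) θ) atTop (𝓝 (∫ θ in Ioc (0 : ℝ) (3 * Real.pi), (0 : ℂ))) := by
    refine tendsto_integral_filter_of_dominated_convergence (fun _ => Real.exp (x * b) * |C|)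
      ?_ ?_ (integrable_const _) ?_
    · filter_upwards [hbig] with R hR
      exact ((continuous_arcIntegrand s x (by linarith)).stronglyMeasurable.indicator
        measurableSet_Ioc).aestronglyMeasurable
    · filter_upwards [hbig] with R hR
      refine ae_of_all _ fun θ => ?_
      by_cases hθ : θ ∈ Ioc (Real.pi - Real.arcsin (b / R)) (2 * Real.pi + Real.arcsin (b / R))
      · rw [indicator_of_mem hθ]
        refine (hpt R hR.1 θ).trans ?_
        have hR0 : 0 < R := by linarith
        have h1 : b / R ≤ 1 := (div_le_one hR0).2 hR.2
        have h0 : 0 ≤ b / R := by positivity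
        have h2 : Real.sin θ ≤ b / R := by
          have hs : Real.sin (Real.arcsin (b / R)) = b / R := Real.sin_arcsin (by linarith) h1
          have e1 : Real.sin θ = -Real.cos |θ - 3 * Real.pi / 2| := by
            rw [Real.cos_abs, show θ - 3 * Real.pi / 2 = (θ - Real.pi) - Real.pi / 2 by ring,
              Real.cos_sub_pi_div_two, Real.sin_sub_pi, neg_neg]
          have e2 : b / R = -Real.cos (Real.pi / 2 + Real.arcsin (b / R)) := by
            rw [add_comm, Real.cos_add_pi_div_two, hs, neg_neg]
          rw [e1, e2, neg_le_neg_iff]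
          refine Real.cos_le_cos_of_nonneg_of_le_pi (abs_nonneg _)
            (by linarith [Real.arcsin_le_pi_div_two (b / R)]) ?_
          rw [abs_le]
          constructor <;> linarith [hθ.1, hθ.2]
        have h3 : R * Real.sin θ ≤ b := by
          rw [le_div_iff₀ hR0] at h2
          linarith
        gcongr
      · rw [indicator_of_notMem hθ, norm_zero]
        positivity
    · have hne : ∀ᵐ θ : ℝ, θ ∉ ({Real.pi, 2 * Real.pi} : Set ℝ) :=
        measure_eq_zero_iff_ae_notMem.1 ((Set.toFinite _).measure_zero _)
      filter_upwards [ae_restrict_of_ae hne] with θ hθ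
      simp only [mem_insert_iff, mem_singleton_iff, not_or] at hθ
      rcases lt_or_gt_of_ne hθ.1 with h | h
      · have hev : ∀ᶠ R : ℝ in atTop, Real.arcsin (b / R) < Real.pi - θ :=
          htheta.eventually_lt_const (by linarith)
        refine tendsto_const_nhds.congr' ?_
        filter_upwards [hev] with R hR
        rw [indicator_of_notMem]
        intro hm
        linarith [hm.1]
      rcases lt_or_gt_of_ne hθ.2 with h' | h'
      · have hsin : Real.sin θ < 0 := by
          have := Real.sin_pos_of_pos_of_lt_pi (x := θ - Real.pi) (by linarith) (by linarith)
          rw [Real.sin_sub_pi] at this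
          linarith
        refine squeeze_zero_norm' (a := fun R => Real.exp (x * (R * Real.sin θ)) * |C|) ?_ ?_
        · filter_upwards [hbig] with R hR
          exact (norm_indicator_le_norm_self _ _).trans (hpt R hR.1 θ)
        · rw [← zero_mul |C|]
          refine Tendsto.mul_const _ (Real.tendsto_exp_atBot.comp ?_)
          exact (tendsto_id.atTop_mul_const_of_neg hsin).const_mul_atBot hx
      · have hev : ∀ᶠ R : ℝ in atTop, Real.arcsin (b / R) < θ - 2 * Real.pi :=
          htheta.eventually_lt_const (by linarith)
        refine tendsto_const_nhds.congr' ?_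
        filter_upwards [hev] with R hR
        rw [indicator_of_notMem]
        intro hm
        linarith [hm.2]
  rw [integral_zero] at hmain
  refine hmain.congr' ?_
  filter_upwards [hbig] with R hR
  have h0 : 0 ≤ Real.arcsin (b / R) := Real.arcsin_nonneg.2 (by have := hR.1; positivity)
  have h1 := Real.arcsin_le_pi_div_two (b / R)
  rw [setIntegral_indicator measurableSet_Ioc, intervalIntegral.integral_of_le (by linarith)]
  congr 2
  rw [inter_eq_right]
  exact Ioc_subset_Ioc (by linarith) (by linarith)

/-- The common limit of the Cauchy integrals over all horizontal lines. -/
theorem tendsto_cauchyTrunc (s : ℝ) {x b : ℝ} (hx : 0 < x) (hb : 0 < b) :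
    Tendsto (fun A : ℝ => cauchyTrunc s b x A) atTop
      (𝓝 (((√(2 * Real.pi))⁻¹ : ℝ) * -(2 * Real.pi * Complex.I *
        Real.cosh (Real.pi * expParam s) * 𝓕 (realWave x) (expParam s)))) := by
  have hRlim : Tendsto (fun A : ℝ => √(A ^ 2 + b ^ 2)) atTop atTop := by
    refine tendsto_atTop_mono (fun A => ?_) tendsto_id
    exact Real.le_sqrt_of_sq_le (by simp; positivity)
  have hlow := (tendsto_lower_arc s hx hb).comp hRlim
  have hlim : Tendsto (fun A : ℝ => ((√(2 * Real.pi))⁻¹ : ℝ) * -(2 * Real.pi * Complex.I *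
        Real.cosh (Real.pi * expParam s) * 𝓕 (realWave x) (expParam s) -
        ∫ θ in (Real.pi - Real.arcsin (b / √(A ^ 2 + b ^ 2)))..(2 * Real.pi +
          Real.arcsin (b / √(A ^ 2 + b ^ 2))), arcIntegrand s x √(A ^ 2 + b ^ 2) θ)) atTop
      (𝓝 (((√(2 * Real.pi))⁻¹ : ℝ) * -(2 * Real.pi * Complex.I *
        Real.cosh (Real.pi * expParam s) * 𝓕 (realWave x) (expParam s) - 0))) :=
    ((tendsto_const_nhds.sub hlow).neg).const_mul _
  rw [sub_zero] at hlim
  refine hlim.congr' ?_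
  filter_upwards [eventually_gt_atTop 1] with A hA
  set R := √(A ^ 2 + b ^ 2) with hRdef
  have hR2 : R ^ 2 = A ^ 2 + b ^ 2 := Real.sq_sqrt (by positivity)
  have hR1 : 1 < R := by
    rw [hRdef, Real.lt_sqrt zero_le_one]
    nlinarith [sq_nonneg b]
  set θ₀ := Real.arcsin (b / R) with hθ
  have hcont := continuous_arcIntegrand s x hR1
  have hper : Function.Periodic (arcIntegrand s x R) (2 * Real.pi) := by
    intro θ
    simp only [arcIntegrand, deriv_circleMap, periodic_circleMap 0 R θ]
  have hcirc := circleIntegral_exp_mul_Q s x hR1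
  have h1 : ∮ w in C(0, R), Complex.exp (-(Complex.I * x * w)) * Q s w =
      (∫ θ in θ₀..(Real.pi - θ₀), arcIntegrand s x R θ) +
        ∫ θ in (Real.pi - θ₀)..(2 * Real.pi + θ₀), arcIntegrand s x R θ := by
    rw [intervalIntegral.integral_add_adjacent_intervals (hcont.intervalIntegrable _ _)
      (hcont.intervalIntegrable _ _), circleIntegral, add_comm (2 * Real.pi) θ₀,
      hper.intervalIntegral_add_eq θ₀ 0, zero_add]
    rfl
  rw [← hcirc, h1, cauchyTrunc, integral_chord_eq_arc s x (by linarith) hb (by linarith) hR2 hθ]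
  ring

theorem spectralFunction_eq (s : ℝ) {x : ℝ} (hx : 0 < x) :
    spectralFunction s x = ((√(2 * Real.pi))⁻¹ : ℝ) * -(2 * Real.pi * Complex.I *
        Real.cosh (Real.pi * expParam s) * 𝓕 (realWave x) (expParam s)) :=
  (tendsto_cauchyTrunc s hx one_pos).limUnder_eq

theorem spectralFunctionExists : SpectralFunctionExists := fun s _ x hx b hb => by
  rw [spectralFunction_eq s hx]
  exact tendsto_cauchyTrunc s hx hb

/-- The eigenfunctions are Fourier transforms, in the coordinate `v`, of the waves `realWave x`. -/
theorem kernelQ_eq {s x : ℝ} (hs : s ∈ Ioo (0 : ℝ) 1) (hx : 0 < x) :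
    kernelQ s x = ((2 * √Real.pi * (s * √(1 - s)))⁻¹ : ℝ) * 𝓕 (realWave x) (expParam s) := by
  have h0 := hs.1
  have h1 : 0 < 1 - s := sub_pos.2 hs.2
  rw [kernelQ, spectralFunction_eq s hx, cosh_expParam hs]
  have key : (√(2 * s))⁻¹ * (√(2 * Real.pi))⁻¹ * 2 * (2 * (√s * √(1 - s)))⁻¹ =
      (2 * √Real.pi * (s * √(1 - s)))⁻¹ := by
    have := Real.sqrt_pos.2 h0
    have := Real.sqrt_pos.2 h1
    rw [Real.sqrt_mul zero_le_two, Real.sqrt_mul zero_le_two]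
    nth_rewrite 4 [← Real.sq_sqrt h0.le]
    have h2 : √2 ^ 2 = 2 := Real.sq_sqrt zero_le_two
    field_simp
    rw [h2]
  rw [← key]
  have hpi : (Real.pi : ℂ) ≠ 0 := by exact_mod_cast Real.pi_ne_zero
  push_cast
  field_simp
  rw [Complex.I_sq]
  ring

/-! ### Parseval's identity for integrable square integrable functions -/

theorem integral_fourier_mul_eq_integral_mul_fourier {f g : ℝ → ℂ} (hf : Integrable f)
    (hg : Integrable g) : ∫ ξ, 𝓕 f ξ * g ξ = ∫ v, f v * 𝓕 g v := by
  have h := VectorFourier.integral_fourierIntegral_smul_eq_flip (L := innerₗ ℝ)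
    Real.continuous_fourierChar continuous_inner hf hg
  rw [flip_innerₗ] at h
  exact h

theorem continuous_fourier {f : ℝ → ℂ} (hf : Integrable f) : Continuous (𝓕 f) :=
  VectorFourier.fourierIntegral_continuous Real.continuous_fourierChar
    (by exact continuous_inner) hf

/-- For integrable square integrable functions, the Fourier integral represents the Fourier
transform of `L²`. -/
theorem coeFn_fourier_toLp {f : ℝ → ℂ} (h1 : Integrable f) (h2 : MemLp f 2) :
    (𝓕 (h2.toLp f) : Lp ℂ 2 (volume : Measure ℝ)) =ᵐ[volume] 𝓕 f := by
  refine ae_eq_of_integral_contDiff_smul_eq ?_ ?_ ?_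
  · exact (Lp.memLp _).locallyIntegrable (by norm_num)
  · exact (continuous_fourier h1).locallyIntegrable
  intro g hg hgs
  have hgc : ContDiff ℝ (⊤ : ℕ∞) fun x => (g x : ℂ) := Complex.ofRealCLM.contDiff.comp hg
  have hgs' : HasCompactSupport fun x => (g x : ℂ) := hgs.comp_left Complex.ofReal_zero
  set φ := hgs'.toSchwartzMap hgc
  have h3 := congrArg (fun T => T φ) (Lp.fourier_toTemperedDistribution_eq (h2.toLp f))
  simp only [TemperedDistribution.fourier_apply, Lp.toTemperedDistribution_apply] at h3
  have h4 : ∫ x, (𝓕 φ) x • (h2.toLp f) x = ∫ x, 𝓕 (φ : ℝ → ℂ) x * f x := by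
    refine integral_congr_ae ?_
    filter_upwards [h2.coeFn_toLp] with x hx
    rw [hx, SchwartzMap.fourier_coe, smul_eq_mul]
  rw [h4, integral_fourier_mul_eq_integral_mul_fourier φ.integrable h1] at h3
  simp only [Complex.real_smul]
  exact h3.symm

theorem memLp_fourier {f : ℝ → ℂ} (h1 : Integrable f) (h2 : MemLp f 2) : MemLp (𝓕 f) 2 :=
  (memLp_congr_ae (coeFn_fourier_toLp h1 h2)).1 (Lp.memLp _)

theorem integral_conj_fourier_mul_fourier {f g : ℝ → ℂ} (hf1 : Integrable f) (hf2 : MemLp f 2)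
    (hg1 : Integrable g) (hg2 : MemLp g 2) :
    ∫ ξ, conj (𝓕 f ξ) * 𝓕 g ξ = ∫ v, conj (f v) * g v := by
  have h := Lp.inner_fourier_eq (hf2.toLp f) (hg2.toLp g)
  rw [L2.inner_def, L2.inner_def] at h
  have e1 : ∫ ξ, conj (𝓕 f ξ) * 𝓕 g ξ = ∫ ξ, inner ℂ ((𝓕 (hf2.toLp f) :
      Lp ℂ 2 (volume : Measure ℝ)) ξ) ((𝓕 (hg2.toLp g) : Lp ℂ 2 (volume : Measure ℝ)) ξ) := by
    refine integral_congr_ae ?_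
    filter_upwards [coeFn_fourier_toLp hf1 hf2, coeFn_fourier_toLp hg1 hg2] with ξ h1 h2
    rw [h1, h2, RCLike.inner_apply']
  have e2 : ∫ v, conj (f v) * g v = ∫ v, inner ℂ (hf2.toLp f v) (hg2.toLp g v) := by
    refine integral_congr_ae ?_
    filter_upwards [hf2.coeFn_toLp, hg2.coeFn_toLp] with ξ h1 h2
    rw [h1, h2, RCLike.inner_apply']
  rw [e1, e2, h]

/-! ### Shifting the contour of the generalized eigenfunctions -/

theorem normSq_cosh_strip (a b : ℝ) :
    Complex.normSq (Complex.cosh (a - b * Complex.I)) = (Real.cosh (2 * a) + Real.cos (2 * b)) / 2 := by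
  have h : Complex.cosh (a - b * Complex.I) =
      ((Real.cosh a * Real.cos b : ℝ) : ℂ) + ((-(Real.sinh a * Real.sin b) : ℝ)) * Complex.I := by
    rw [Complex.cosh_sub, Complex.cosh_mul_I, Complex.sinh_mul_I]
    push_cast
    ring
  rw [h, Complex.normSq_add_mul_I, Real.cosh_two_mul, Real.cos_two_mul]
  nlinarith [Real.cosh_sq a, Real.sin_sq b]

theorem im_tanh_strip {a b : ℝ} (h : 0 < Real.cosh (2 * a) + Real.cos (2 * b)) :
    (Complex.tanh (a - b * Complex.I)).im =
      -(Real.sin (2 * b) / (Real.cosh (2 * a) + Real.cos (2 * b))) := by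
  have h1 : Complex.cosh (a - b * Complex.I) =
      ((Real.cosh a * Real.cos b : ℝ) : ℂ) + ((-(Real.sinh a * Real.sin b) : ℝ)) * Complex.I := by
    rw [Complex.cosh_sub, Complex.cosh_mul_I, Complex.sinh_mul_I]
    push_cast
    ring
  have h2 : Complex.sinh (a - b * Complex.I) =
      ((Real.sinh a * Real.cos b : ℝ) : ℂ) + ((-(Real.cosh a * Real.sin b) : ℝ)) * Complex.I := by
    rw [Complex.sinh_sub, Complex.cosh_mul_I, Complex.sinh_mul_I]
    push_cast
    ring
  rw [Complex.tanh_eq_sinh_div_cosh, Complex.div_im, normSq_cosh_strip, h1, h2]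
  simp only [Complex.add_re, Complex.add_im, Complex.ofReal_re, Complex.ofReal_im,
    Complex.re_ofReal_mul, Complex.im_ofReal_mul, Complex.I_re, Complex.I_im, mul_zero, mul_one,
    add_zero, zero_add]
  rw [Real.sin_two_mul]
  field_simp
  rw [Real.cosh_sq a]
  ring

theorem norm_wave_strip (x : ℝ) {a b : ℝ} (h : 0 < Real.cosh (2 * a) + Real.cos (2 * b)) {z : ℂ}
    (hz : Real.pi * z = a - b * Complex.I) :
    ‖wave x z‖ = Real.exp (-(x * (Real.sin (2 * b) / (Real.cosh (2 * a) + Real.cos (2 * b))))) *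
      √(2 / (Real.cosh (2 * a) + Real.cos (2 * b))) := by
  have e : (-(Complex.I * x * Complex.tanh (a - b * Complex.I))).re =
      -(x * (Real.sin (2 * b) / (Real.cosh (2 * a) + Real.cos (2 * b)))) := by
    have := im_tanh_strip h
    simp only [Complex.neg_re, mul_assoc, Complex.I_mul_re, Complex.im_ofReal_mul, this]
    ring
  rw [wave, norm_div, hz, Complex.norm_exp, e, div_eq_mul_inv]
  congr 1
  rw [Complex.norm_def, normSq_cosh_strip, ← Real.sqrt_inv, inv_div]

theorem cosh_strip_ne_zero {a b : ℝ} (h : 0 < Real.cosh (2 * a) + Real.cos (2 * b)) :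
    Complex.cosh (a - b * Complex.I) ≠ 0 := by
  rw [← Complex.normSq_pos, normSq_cosh_strip]
  linarith

/-- The wave on the line `Im z = -1/4`, halfway to the singularities of `tanh πz`. There
`t = tanh πz` runs through the lower unit semicircle, so that the wave decays in `x`. -/
def shiftWave (x v : ℝ) : ℂ := wave x (v - Complex.I / 4)

theorem pi_mul_shift (v : ℝ) : Real.pi * (v - Complex.I / 4 : ℂ) =
    ((Real.pi * v : ℝ) : ℂ) - ((Real.pi / 4 : ℝ) : ℂ) * Complex.I := by
  push_cast
  ring

theorem norm_shiftWave (x v : ℝ) : ‖shiftWave x v‖ =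
    Real.exp (-(x * (1 / Real.cosh (2 * (Real.pi * v))))) *
      √(2 / Real.cosh (2 * (Real.pi * v))) := by
  have e : 2 * (Real.pi / 4) = Real.pi / 2 := by ring
  have h := norm_wave_strip x (a := Real.pi * v) (b := Real.pi / 4)
    (by rw [e, Real.cos_pi_div_two, add_zero]; exact Real.cosh_pos _) (pi_mul_shift v)
  rwa [e, Real.cos_pi_div_two, Real.sin_pi_div_two, add_zero] at h

theorem cosh_shift_ne_zero (v : ℝ) : Complex.cosh (Real.pi * (v - Complex.I / 4 : ℂ)) ≠ 0 := by
  rw [pi_mul_shift]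
  apply cosh_strip_ne_zero
  rw [show 2 * (Real.pi / 4) = Real.pi / 2 by ring, Real.cos_pi_div_two, add_zero]
  exact Real.cosh_pos _

theorem continuous_shiftWave_uncurry : Continuous fun p : ℝ × ℝ => shiftWave p.1 p.2 := by
  have h1 : Continuous fun p : ℝ × ℝ => Complex.cosh (Real.pi * (p.2 - Complex.I / 4 : ℂ)) := by
    fun_prop
  have h2 : Continuous fun p : ℝ × ℝ => Complex.tanh (Real.pi * (p.2 - Complex.I / 4 : ℂ)) := by
    simp_rw [Complex.tanh_eq_sinh_div_cosh]
    exact Continuous.div (by fun_prop) h1 fun p => cosh_shift_ne_zero p.2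
  unfold shiftWave wave
  exact Continuous.div (by fun_prop) h1 fun p => cosh_shift_ne_zero p.2

theorem continuous_shiftWave (x : ℝ) : Continuous (shiftWave x) := by
  have h : Continuous fun v : ℝ => ((x, v) : ℝ × ℝ) := by fun_prop
  simpa only [Function.comp_def] using continuous_shiftWave_uncurry.comp h

theorem sqrt_two_div_cosh_le (y : ℝ) : √(2 / Real.cosh (2 * y)) ≤ √2 * (Real.cosh y)⁻¹ := by
  have h1 := Real.cosh_pos y
  have h2 := Real.one_le_cosh y
  rw [← Real.sqrt_sq (inv_pos.2 h1).le, ← Real.sqrt_mul zero_le_two]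
  apply Real.sqrt_le_sqrt
  rw [div_eq_mul_inv, inv_pow]
  gcongr
  nlinarith [Real.cosh_two_mul y, Real.cosh_sq y]

theorem norm_shiftWave_le {x : ℝ} (hx : 0 ≤ x) (v : ℝ) :
    ‖shiftWave x v‖ ≤ √2 * (Real.cosh (Real.pi * v))⁻¹ := by
  rw [norm_shiftWave]
  have h : Real.exp (-(x * (1 / Real.cosh (2 * (Real.pi * v))))) ≤ 1 := by
    rw [Real.exp_le_one_iff, neg_nonpos]
    have := Real.cosh_pos (2 * (Real.pi * v))
    positivity
  exact (mul_le_of_le_one_left (Real.sqrt_nonneg _) h).trans (sqrt_two_div_cosh_le _)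

theorem integrable_shiftWave {x : ℝ} (hx : 0 ≤ x) : Integrable (shiftWave x) :=
  (integrable_inv_cosh.const_mul _).mono' (continuous_shiftWave x).aestronglyMeasurable
    (ae_of_all _ (norm_shiftWave_le hx))

theorem cosh_add_cos_strip {y : ℝ} (hy : y ∈ Icc (-(1 / 4) : ℝ) 0) (a : ℝ) :
    Real.cosh (2 * a) ≤ Real.cosh (2 * a) + Real.cos (2 * (-(Real.pi * y))) := by
  have := Real.cos_nonneg_of_mem_Icc (x := 2 * (-(Real.pi * y)))
    ⟨by nlinarith [Real.pi_pos, hy.2, hy.1], by nlinarith [Real.pi_pos, hy.1]⟩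
  linarith

theorem norm_wave_strip_le {x : ℝ} (hx : 0 ≤ x) (v : ℝ) {y : ℝ} (hy : y ∈ Icc (-(1 / 4) : ℝ) 0) :
    ‖wave x (v + y * Complex.I)‖ ≤ √2 * (Real.cosh (Real.pi * v))⁻¹ := by
  have hc := Real.cosh_pos (2 * (Real.pi * v))
  have hle := cosh_add_cos_strip hy (Real.pi * v)
  rw [norm_wave_strip x (a := Real.pi * v) (b := -(Real.pi * y)) (by linarith)
    (by push_cast; ring)]
  have hs := Real.sin_nonneg_of_nonneg_of_le_pi (x := 2 * (-(Real.pi * y)))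
    (by nlinarith [Real.pi_pos, hy.2]) (by nlinarith [Real.pi_pos, hy.1])
  have h : Real.exp (-(x * (Real.sin (2 * (-(Real.pi * y))) /
      (Real.cosh (2 * (Real.pi * v)) + Real.cos (2 * (-(Real.pi * y))))))) ≤ 1 := by
    rw [Real.exp_le_one_iff, neg_nonpos]
    have : 0 < Real.cosh (2 * (Real.pi * v)) + Real.cos (2 * (-(Real.pi * y))) := by linarith
    positivity
  refine (mul_le_of_le_one_left (Real.sqrt_nonneg _) h).trans
    (le_trans (Real.sqrt_le_sqrt ?_) (sqrt_two_div_cosh_le _))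
  gcongr

theorem tendsto_inv_cosh_pi : Tendsto (fun T : ℝ => (Real.cosh (Real.pi * T))⁻¹) atTop (𝓝 0) := by
  refine Tendsto.inv_tendsto_atTop (tendsto_atTop_mono (f := fun T => Real.pi * T / 2) (fun T => ?_)
    ((tendsto_id.const_mul_atTop Real.pi_pos).atTop_div_const two_pos))
  have h1 := Real.add_one_le_exp (Real.pi * T)
  have h2 := Real.exp_pos (-(Real.pi * T))
  rw [Real.cosh_eq]
  linarith

/-- Moving the contour from the real line to `Im z = -1/4`. -/
theorem fourier_realWave_eq {x : ℝ} (hx : 0 ≤ x) (τ : ℝ) :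
    𝓕 (realWave x) τ = Real.exp (-(Real.pi * τ / 2)) * 𝓕 (shiftWave x) τ := by
  set f : ℂ → ℂ := fun z => Complex.exp (-(2 * Real.pi * Complex.I * τ * z)) * wave x z with hf
  have hrect : ∀ T : ℝ, DifferentiableOn ℂ f
      (uIcc (-T) T ×ℂ uIcc (-(1 / 4)) 0) := by
    intro T z hz
    have hy : z.im ∈ Icc (-(1 / 4) : ℝ) 0 := by
      have := hz.2
      rwa [mem_preimage, uIcc_of_le (by norm_num)] at this
    have hc : Complex.cosh (Real.pi * z) ≠ 0 := by
      have e : Real.pi * z = ((Real.pi * z.re : ℝ) : ℂ) - ((-(Real.pi * z.im) : ℝ) : ℂ) *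
          Complex.I := by
        nth_rewrite 1 [← Complex.re_add_im z]
        push_cast
        ring
      rw [e]
      exact cosh_strip_ne_zero (lt_of_lt_of_le (Real.cosh_pos _) (cosh_add_cos_strip hy _))
    have h1 : DifferentiableAt ℂ (fun z : ℂ => Complex.tanh (Real.pi * z)) z := by
      simp_rw [Complex.tanh_eq_sinh_div_cosh]
      exact DifferentiableAt.div (by fun_prop) (by fun_prop) hc
    have h2 : DifferentiableAt ℂ (wave x) z := by
      unfold wave
      exact DifferentiableAt.div (by fun_prop) (by fun_prop) hc
    exact (DifferentiableAt.mul (by fun_prop) h2).differentiableWithinAt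
  have hbot : ∀ v : ℝ, f (v + ((-(1 / 4) : ℝ) : ℂ) * Complex.I) =
      Real.exp (-(Real.pi * τ / 2)) * (Real.fourierChar (-(v * τ)) • shiftWave x v) := by
    intro v
    rw [hf, Circle.smul_def, Real.fourierChar_apply, shiftWave, Complex.ofReal_exp, smul_eq_mul,
      ← mul_assoc, ← Complex.exp_add]
    simp only
    congr 2
    · push_cast
      ring_nf
      rw [Complex.I_sq]
      ring
    · push_cast
      ring
  have htop : ∀ v : ℝ, f (v + ((0 : ℝ) : ℂ) * Complex.I) =
      Real.fourierChar (-(v * τ)) • realWave x v := by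
    intro v
    rw [hf, Circle.smul_def, Real.fourierChar_apply, realWave, smul_eq_mul]
    simp only [Complex.ofReal_zero, zero_mul, add_zero]
    congr 2
    push_cast
    ring
  have hch : Continuous fun v : ℝ => Real.fourierChar (-(v * τ)) := by fun_prop
  have itop : Integrable fun v : ℝ => f (v + ((0 : ℝ) : ℂ) * Complex.I) := by
    simp_rw [htop]
    exact (integrable_realWave x).mono (hch.smul (continuous_realWave x)).aestronglyMeasurable
      (ae_of_all _ fun v => by simp)
  have ibot : Integrable fun v : ℝ => f (v + ((-(1 / 4) : ℝ) : ℂ) * Complex.I) := by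
    simp_rw [hbot]
    refine Integrable.const_mul ?_ _
    exact (integrable_shiftWave hx).mono (hch.smul (continuous_shiftWave x)).aestronglyMeasurable
      (ae_of_all _ fun v => by simp)
  have hside : ∀ σ : ℝ, |σ| = 1 → Tendsto (fun T : ℝ => Complex.I •
      ∫ y : ℝ in (-(1 / 4) : ℝ)..0, f (((σ * T : ℝ) : ℂ) + y * Complex.I)) atTop (𝓝 0) := by
    intro σ hσ
    refine squeeze_zero_norm (a := fun T => Real.exp (2 * Real.pi * |τ|) *
      (√2 * (Real.cosh (Real.pi * T))⁻¹) * |0 - (-(1 / 4))|) (fun T => ?_) ?_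
    · rw [norm_smul, Complex.norm_I, one_mul]
      refine intervalIntegral.norm_integral_le_of_norm_le_const fun y hy => ?_
      rw [uIoc_of_le (by norm_num)] at hy
      have hy' : y ∈ Icc (-(1 / 4) : ℝ) 0 := ⟨hy.1.le, hy.2⟩
      rw [hf, norm_mul]
      have hcosh : Real.cosh (Real.pi * (σ * T)) = Real.cosh (Real.pi * T) := by
        rw [← Real.cosh_abs, abs_mul, abs_mul, hσ, one_mul, ← abs_mul, Real.cosh_abs]
      have h1 := norm_wave_strip_le hx (σ * T) hy'
      rw [hcosh] at h1
      have h2 : ‖Complex.exp (-(2 * Real.pi * Complex.I * τ * (((σ * T : ℝ) : ℂ) +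
          y * Complex.I)))‖ ≤ Real.exp (2 * Real.pi * |τ|) := by
        have e : (-(2 * Real.pi * Complex.I * τ * (((σ * T : ℝ) : ℂ) + y * Complex.I))) =
          ((2 * Real.pi * τ * y : ℝ) : ℂ) + ((-(2 * Real.pi * τ * (σ * T)) : ℝ) : ℂ) *
            Complex.I := by
          push_cast
          ring_nf
          rw [Complex.I_sq]
          ring
        rw [Complex.norm_exp, e, Complex.add_re, Complex.ofReal_re, Complex.re_ofReal_mul,
          Complex.I_re, mul_zero, add_zero, mul_assoc]
        refine Real.exp_le_exp.2 (mul_le_mul_of_nonneg_left ?_ (by positivity))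
        refine (le_abs_self _).trans ?_
        rw [abs_mul]
        refine mul_le_of_le_one_right (abs_nonneg _) ?_
        rw [abs_le]
        constructor <;> linarith [hy'.1, hy'.2]
      gcongr
    · have := ((tendsto_inv_cosh_pi.const_mul √2).const_mul
        (Real.exp (2 * Real.pi * |τ|))).mul_const |(0 : ℝ) - (-(1 / 4))|
      simpa using this
  have hlim : Tendsto (fun T : ℝ =>
      (∫ v in (-T)..T, f (v + ((-(1 / 4) : ℝ) : ℂ) * Complex.I)) -
      (∫ v in (-T)..T, f (v + ((0 : ℝ) : ℂ) * Complex.I)) +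
      Complex.I • (∫ y : ℝ in (-(1 / 4) : ℝ)..0, f (((1 * T : ℝ) : ℂ) + y * Complex.I)) -
      Complex.I • (∫ y : ℝ in (-(1 / 4) : ℝ)..0, f (((-1 * T : ℝ) : ℂ) + y * Complex.I)))
      atTop (𝓝 ((∫ v : ℝ, f (v + ((-(1 / 4) : ℝ) : ℂ) * Complex.I)) -
        (∫ v : ℝ, f (v + ((0 : ℝ) : ℂ) * Complex.I)) + 0 - 0)) :=
    (((intervalIntegral_tendsto_integral ibot tendsto_neg_atTop_atBot tendsto_id).sub
      (intervalIntegral_tendsto_integral itop tendsto_neg_atTop_atBot tendsto_id)).add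
      (hside 1 (by simp))).sub (hside (-1) (by simp))
  have hzero : ∀ T : ℝ, (∫ v in (-T)..T, f (v + ((-(1 / 4) : ℝ) : ℂ) * Complex.I)) -
      (∫ v in (-T)..T, f (v + ((0 : ℝ) : ℂ) * Complex.I)) +
      Complex.I • (∫ y : ℝ in (-(1 / 4) : ℝ)..0, f (((1 * T : ℝ) : ℂ) + y * Complex.I)) -
      Complex.I • (∫ y : ℝ in (-(1 / 4) : ℝ)..0, f (((-1 * T : ℝ) : ℂ) + y * Complex.I)) = 0 := by
    intro T
    have h := Complex.integral_boundary_rect_eq_zero_of_differentiableOn f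
      ⟨-T, -(1 / 4)⟩ ⟨T, 0⟩ (hrect T)
    rw [one_mul, neg_one_mul]
    exact h
  simp_rw [hzero] at hlim
  have h := tendsto_nhds_unique tendsto_const_nhds hlim
  simp_rw [hbot, htop] at h
  rw [integral_const_mul] at h
  simp_rw [Real.fourier_real_eq]
  linear_combination h

/-! ### The isometry identity -/

theorem shiftWave_mul_conj (x v v' : ℝ) : shiftWave x v * conj (shiftWave x v') =
    Complex.exp (-(Complex.I * (Complex.tanh (Real.pi * (v - Complex.I / 4 : ℂ)) -
      conj (Complex.tanh (Real.pi * (v' - Complex.I / 4 : ℂ))))) * x) *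
    (Complex.cosh (Real.pi * (v - Complex.I / 4 : ℂ)) *
      conj (Complex.cosh (Real.pi * (v' - Complex.I / 4 : ℂ))))⁻¹ := by
  rw [shiftWave, shiftWave, wave, wave, map_div₀, div_mul_div_comm, ← Complex.exp_conj,
    ← Complex.exp_add, div_eq_mul_inv]
  congr 2
  simp only [map_neg, map_mul, Complex.conj_I, Complex.conj_ofReal]
  ring

/-- The Laplace transform in `x` of a product of two shifted waves is a convolution kernel in `v`:
this is the addition theorem for `tanh`. -/
theorem integral_shiftWave_mul_conj (v v' : ℝ) :
    ∫ x in Ioi (0 : ℝ), shiftWave x v * conj (shiftWave x v') =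
      ((Real.cosh (Real.pi * (v - v')))⁻¹ : ℝ) := by
  set z : ℂ := Real.pi * (v - Complex.I / 4 : ℂ) with hz
  set z' : ℂ := Real.pi * (v' - Complex.I / 4 : ℂ) with hz'
  have hc : Complex.cosh z ≠ 0 := cosh_shift_ne_zero v
  have hc' : Complex.cosh (conj z') ≠ 0 := by
    rw [Complex.cosh_conj]
    exact (map_ne_zero _).2 (cosh_shift_ne_zero v')
  have him : ∀ u : ℝ, (Complex.tanh (Real.pi * (u - Complex.I / 4 : ℂ))).im < 0 := by
    intro u
    have e : 2 * (Real.pi / 4) = Real.pi / 2 := by ring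
    have hp := Real.cosh_pos (2 * (Real.pi * u))
    rw [pi_mul_shift, im_tanh_strip, e, Real.cos_pi_div_two, Real.sin_pi_div_two, add_zero]
    · rw [neg_lt_zero]; positivity
    · rw [e, Real.cos_pi_div_two, add_zero]; exact hp
  set α : ℂ := -(Complex.I * (Complex.tanh z - conj (Complex.tanh z'))) with hα
  have hre : α.re < 0 := by
    rw [hα]
    simp only [Complex.neg_re, Complex.I_mul_re, Complex.sub_im, Complex.conj_im]
    linarith [him v, him v']
  simp_rw [shiftWave_mul_conj]
  rw [integral_mul_const, integral_exp_mul_complex_Ioi hre]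
  have hα0 : α ≠ 0 := fun h => by rw [h] at hre; simp at hre
  have key : -α * (Complex.cosh z * conj (Complex.cosh z')) =
      Real.cosh (Real.pi * (v - v')) := by
    have e1 : z - conj z' = ((Real.pi * (v - v') : ℝ) : ℂ) - (Real.pi / 2) * Complex.I := by
      rw [hz, hz']
      simp only [map_mul, map_sub, map_div₀, Complex.conj_ofReal, Complex.conj_I, map_ofNat]
      push_cast
      ring
    have e2 : -α * (Complex.cosh z * conj (Complex.cosh z')) =
        Complex.I * Complex.sinh (z - conj z') := by
      rw [hα, Complex.sinh_sub, Complex.tanh_eq_sinh_div_cosh, Complex.tanh_eq_sinh_div_cosh,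
        map_div₀, ← Complex.cosh_conj, ← Complex.sinh_conj]
      field_simp
    rw [e2, e1, Complex.sinh_sub, Complex.cosh_mul_I, Complex.sinh_mul_I, Complex.cos_pi_div_two,
      Complex.sin_pi_div_two, Complex.ofReal_cosh]
    ring_nf
    rw [Complex.I_sq]
    ring
  change -Complex.exp (α * ((0 : ℝ) : ℂ)) / α * (Complex.cosh z * conj (Complex.cosh z'))⁻¹ = _
  rw [Complex.ofReal_zero, mul_zero, Complex.exp_zero, Complex.ofReal_inv, ← key]
  clear_value α
  field_simp

theorem inv_cosh_pi_pos (y : ℝ) : 0 < (Real.cosh (Real.pi * y))⁻¹ := inv_pos.2 (Real.cosh_pos _)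

theorem inv_cosh_pi_neg (y : ℝ) : (Real.cosh (Real.pi * -y))⁻¹ = (Real.cosh (Real.pi * y))⁻¹ := by
  rw [mul_neg, Real.cosh_neg]

theorem integral_norm_shiftWave_mul_le (v v' : ℝ) :
    IntegrableOn (fun x => ‖shiftWave x v‖ * ‖shiftWave x v'‖) (Ioi 0) ∧
    ∫ x in Ioi (0 : ℝ), ‖shiftWave x v‖ * ‖shiftWave x v'‖ ≤
      (Real.cosh (Real.pi * (v - v')))⁻¹ + (Real.cosh (Real.pi * (v + v')))⁻¹ := by
  set c := Real.cosh (2 * (Real.pi * v)) with hc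
  set c' := Real.cosh (2 * (Real.pi * v')) with hc'
  have h0 : 0 < c := Real.cosh_pos _
  have h0' : 0 < c' := Real.cosh_pos _
  have e : (fun x => ‖shiftWave x v‖ * ‖shiftWave x v'‖) = fun x =>
      Real.exp (-(1 / c + 1 / c') * x) * (√(2 / c) * √(2 / c')) := by
    ext x
    rw [norm_shiftWave, norm_shiftWave, mul_mul_mul_comm, ← Real.exp_add]
    congr 2
    ring
  have hneg : -(1 / c + 1 / c') < 0 := by
    rw [neg_lt_zero]; positivity
  rw [e]
  refine ⟨(integrableOn_exp_mul_Ioi hneg 0).mul_const _, ?_⟩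
  rw [integral_mul_const, integral_exp_mul_Ioi hneg, mul_zero, Real.exp_zero]
  set P := Real.cosh (Real.pi * (v + v')) with hP
  set N := Real.cosh (Real.pi * (v - v')) with hN
  have hPpos : 0 < P := Real.cosh_pos _
  have hNpos : 0 < N := Real.cosh_pos _
  have hA : c = Real.cosh (Real.pi * (v + v') + Real.pi * (v - v')) := by rw [hc]; ring_nf
  have hB : c' = Real.cosh (Real.pi * (v + v') - Real.pi * (v - v')) := by rw [hc']; ring_nf
  have hsum : c + c' = 2 * (P * N) := by
    rw [hA, hB, Real.cosh_add, Real.cosh_sub]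
    ring
  have hprod : c * c' ≤ (P + N) ^ 2 := by
    rw [hA, hB, Real.cosh_add, Real.cosh_sub]
    have h1 := Real.cosh_sq (Real.pi * (v + v'))
    have h2 := Real.cosh_sq (Real.pi * (v - v'))
    rw [← hP] at h1 ⊢
    rw [← hN] at h2 ⊢
    have : (P * N + Real.sinh (Real.pi * (v + v')) * Real.sinh (Real.pi * (v - v'))) *
        (P * N - Real.sinh (Real.pi * (v + v')) * Real.sinh (Real.pi * (v - v'))) =
        P ^ 2 * N ^ 2 - (P ^ 2 - 1) * (N ^ 2 - 1) := by
      linear_combination (N ^ 2 - 1) * h1 + Real.sinh (Real.pi * (v + v')) ^ 2 * h2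
    rw [this]
    nlinarith [mul_pos hPpos hNpos]
  have hsq : √(2 / c) * √(2 / c') = 2 * √(c * c') / (c * c') := by
    rw [← Real.sqrt_mul (by positivity), Real.sqrt_eq_iff_mul_self_eq (by positivity)
      (by positivity)]
    have := Real.mul_self_sqrt (mul_pos h0 h0').le
    field_simp
    nlinarith
  have hle : √(c * c') ≤ P + N := Real.sqrt_le_iff.2 ⟨by positivity, hprod⟩
  rw [hsq]
  calc -1 / (-(1 / c + 1 / c')) * (2 * √(c * c') / (c * c')) = 2 * √(c * c') / (c + c') := by
        field_simp
        ring
    _ ≤ 2 * (P + N) / (2 * (P * N)) := by rw [hsum]; gcongr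
    _ = N⁻¹ + P⁻¹ := by field_simp

theorem integrable_mul_comp_add {f g : ℝ → ℝ} (hf : Integrable f) (hg : Integrable g)
    (hgc : Continuous g) : Integrable fun p : ℝ × ℝ => f p.1 * g (p.1 + p.2) := by
  have hm : AEStronglyMeasurable (fun p : ℝ × ℝ => f p.1 * g (p.1 + p.2))
      ((volume : Measure ℝ).prod volume) :=
    hf.aestronglyMeasurable.comp_fst.mul (by fun_prop : Continuous fun p : ℝ × ℝ =>
      g (p.1 + p.2)).aestronglyMeasurable
  refine (integrable_prod_iff hm).2 ⟨ae_of_all _ fun v => ?_, ?_⟩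
  · exact (hg.comp_add_left v).const_mul (f v)
  · simp_rw [norm_mul, integral_const_mul]
    have : ∀ v : ℝ, ∫ y, ‖g (v + y)‖ = ∫ y, ‖g y‖ := fun v =>
      integral_add_left_eq_self (fun y => ‖g y‖) v
    simp_rw [this]
    exact hf.norm.mul_const _

theorem integrable_mul_comp_sub {f g : ℝ → ℝ} (hf : Integrable f) (hg : Integrable g)
    (hgc : Continuous g) : Integrable fun p : ℝ × ℝ => f p.1 * g (p.1 - p.2) := by
  have hm : AEStronglyMeasurable (fun p : ℝ × ℝ => f p.1 * g (p.1 - p.2))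
      ((volume : Measure ℝ).prod volume) :=
    hf.aestronglyMeasurable.comp_fst.mul (by fun_prop : Continuous fun p : ℝ × ℝ =>
      g (p.1 - p.2)).aestronglyMeasurable
  refine (integrable_prod_iff hm).2 ⟨ae_of_all _ fun v => ?_, ?_⟩
  · exact (hg.comp_sub_left v).const_mul (f v)
  · simp_rw [norm_mul, integral_const_mul]
    have : ∀ v : ℝ, ∫ y, ‖g (v - y)‖ = ∫ y, ‖g y‖ := fun v =>
      integral_sub_left_eq_self (fun y => ‖g y‖) _ v
    simp_rw [this]
    exact hf.norm.mul_const _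

theorem continuous_inv_cosh_pi : Continuous fun v : ℝ => (Real.cosh (Real.pi * v))⁻¹ := by
  fun_prop (disch := exact fun v => (Real.cosh_pos _).ne')

/-- Schur's test for the kernel `1 / cosh π(v - v') + 1 / cosh π(v + v')`. -/
theorem integrable_schur {φ : ℝ → ℂ} (hφ : MemLp φ 2) :
    Integrable (fun p : ℝ × ℝ => ‖φ p.1‖ * ‖φ p.2‖ *
      ((Real.cosh (Real.pi * (p.1 - p.2)))⁻¹ + (Real.cosh (Real.pi * (p.1 + p.2)))⁻¹)) (volume.prod volume) := by
  have hsq : Integrable fun v => ‖φ v‖ ^ 2 :=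
    (memLp_two_iff_integrable_sq_norm hφ.aestronglyMeasurable).1 hφ
  have h1 := (integrable_mul_comp_sub hsq integrable_inv_cosh continuous_inv_cosh_pi).add
    (integrable_mul_comp_add hsq integrable_inv_cosh continuous_inv_cosh_pi)
  have h2 : Integrable fun p : ℝ × ℝ => ‖φ p.2‖ ^ 2 * (Real.cosh (Real.pi * (p.2 - p.1)))⁻¹ +
      ‖φ p.2‖ ^ 2 * (Real.cosh (Real.pi * (p.2 + p.1)))⁻¹ := h1.swap
  have hk : Continuous fun p : ℝ × ℝ => (Real.cosh (Real.pi * (p.1 - p.2)))⁻¹ +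
      (Real.cosh (Real.pi * (p.1 + p.2)))⁻¹ :=
    (continuous_inv_cosh_pi.comp (by fun_prop : Continuous fun p : ℝ × ℝ => p.1 - p.2)).add
      (continuous_inv_cosh_pi.comp (by fun_prop : Continuous fun p : ℝ × ℝ => p.1 + p.2))
  refine (h1.add h2).mono' ((hφ.aestronglyMeasurable.norm.comp_fst.mul
    hφ.aestronglyMeasurable.norm.comp_snd).mul hk.aestronglyMeasurable)
    (ae_of_all _ fun p => ?_)
  have p1 := inv_cosh_pi_pos (p.1 - p.2)
  have p2 := inv_cosh_pi_pos (p.1 + p.2)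
  have e1 : (Real.cosh (Real.pi * (p.2 - p.1)))⁻¹ = (Real.cosh (Real.pi * (p.1 - p.2)))⁻¹ := by
    rw [← inv_cosh_pi_neg, neg_sub]
  rw [Real.norm_of_nonneg (by positivity)]
  simp only [Pi.add_apply]
  rw [e1, add_comm p.2 p.1, ← mul_add, ← mul_add, ← add_mul]
  gcongr
  nlinarith [two_mul_le_add_sq ‖φ p.1‖ ‖φ p.2‖, norm_nonneg (φ p.1), norm_nonneg (φ p.2)]

/-- The absolute convergence needed to exchange the order of integration in the square of
`∫ E(x, v) φ(v) dv`, for a kernel whose Gram kernel passes Schur's test. -/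
theorem integrable_triple {E : ℝ → ℝ → ℂ} (hE : Continuous fun p : ℝ × ℝ => E p.1 p.2)
    {φ : ℝ → ℂ} (hφm : AEStronglyMeasurable φ) {k : ℝ × ℝ → ℝ}
    (hk : Integrable (fun p => ‖φ p.1‖ * ‖φ p.2‖ * k p) (volume.prod volume))
    (hEk : ∀ v v', IntegrableOn (fun x => ‖E x v‖ * ‖E x v'‖) (Ioi 0) ∧
      ∫ x in Ioi (0 : ℝ), ‖E x v‖ * ‖E x v'‖ ≤ k (v, v')) :
    Integrable (fun q : ℝ × (ℝ × ℝ) => (E q.1 q.2.1 * φ q.2.1) *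
      conj (E q.1 q.2.2 * φ q.2.2))
      ((volume.restrict (Ioi (0 : ℝ))).prod (volume.prod volume)) := by
  have s1 : Continuous fun q : ℝ × (ℝ × ℝ) => E q.1 q.2.1 :=
    hE.comp
      (by fun_prop : Continuous fun q : ℝ × (ℝ × ℝ) => ((q.1, q.2.1) : ℝ × ℝ))
  have s2 : Continuous fun q : ℝ × (ℝ × ℝ) => E q.1 q.2.2 :=
    hE.comp
      (by fun_prop : Continuous fun q : ℝ × (ℝ × ℝ) => ((q.1, q.2.2) : ℝ × ℝ))
  have m1 : AEStronglyMeasurable (fun q : ℝ × (ℝ × ℝ) => φ q.2.1)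
      ((volume.restrict (Ioi (0 : ℝ))).prod (volume.prod volume)) := hφm.comp_fst.comp_snd
  have m2 : AEStronglyMeasurable (fun q : ℝ × (ℝ × ℝ) => φ q.2.2)
      ((volume.restrict (Ioi (0 : ℝ))).prod (volume.prod volume)) := hφm.comp_snd.comp_snd
  have hm : AEStronglyMeasurable (fun q : ℝ × (ℝ × ℝ) => (E q.1 q.2.1 * φ q.2.1) *
      conj (E q.1 q.2.2 * φ q.2.2))
      ((volume.restrict (Ioi (0 : ℝ))).prod (volume.prod volume)) :=
    (s1.aestronglyMeasurable.mul m1).mul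
      (Complex.continuous_conj.comp_aestronglyMeasurable (s2.aestronglyMeasurable.mul m2))
  have hnorm : ∀ q : ℝ × (ℝ × ℝ), ‖(E q.1 q.2.1 * φ q.2.1) *
      conj (E q.1 q.2.2 * φ q.2.2)‖ =
      (‖E q.1 q.2.1‖ * ‖E q.1 q.2.2‖) * (‖φ q.2.1‖ * ‖φ q.2.2‖) := by
    intro q
    rw [norm_mul, RCLike.norm_conj, norm_mul, norm_mul]
    ring
  have hA : ∀ p : ℝ × ℝ, Integrable (fun x : ℝ => (E x p.1 * φ p.1) *
      conj (E x p.2 * φ p.2)) (volume.restrict (Ioi 0)) := by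
    intro p
    have c1 : Continuous fun x : ℝ => E x p.1 :=
      s1.comp (by fun_prop : Continuous fun x : ℝ => ((x, p) : ℝ × (ℝ × ℝ)))
    have c2 : Continuous fun x : ℝ => E x p.2 :=
      s2.comp (by fun_prop : Continuous fun x : ℝ => ((x, p) : ℝ × (ℝ × ℝ)))
    have c3 : Continuous fun x : ℝ => (E x p.1 * φ p.1) * conj (E x p.2 * φ p.2) :=
      (c1.mul_const _).mul (Complex.continuous_conj.comp (c2.mul_const _))
    have hi := (hEk p.1 p.2).1.mul_const (‖φ p.1‖ * ‖φ p.2‖)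
    have hle : ∀ x : ℝ, ‖(E x p.1 * φ p.1) * conj (E x p.2 * φ p.2)‖ ≤
        (‖E x p.1‖ * ‖E x p.2‖) * (‖φ p.1‖ * ‖φ p.2‖) := fun x =>
      (hnorm (x, p)).le
    exact hi.mono' c3.aestronglyMeasurable (ae_of_all _ hle)
  have hB : Integrable (fun p : ℝ × ℝ => ∫ x in Ioi (0 : ℝ), ‖(E x p.1 * φ p.1) *
      conj (E x p.2 * φ p.2)‖) (volume.prod volume) := by
    have hle : ∀ p : ℝ × ℝ, ‖∫ x in Ioi (0 : ℝ), ‖(E x p.1 * φ p.1) *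
        conj (E x p.2 * φ p.2)‖‖ ≤ ‖φ p.1‖ * ‖φ p.2‖ * k p := by
      intro p
      have hn : ∀ x : ℝ, ‖(E x p.1 * φ p.1) * conj (E x p.2 * φ p.2)‖ =
        (‖E x p.1‖ * ‖E x p.2‖) * (‖φ p.1‖ * ‖φ p.2‖) := fun x => hnorm (x, p)
      rw [Real.norm_of_nonneg (integral_nonneg fun x => norm_nonneg _)]
      simp_rw [hn]
      rw [integral_mul_const, mul_comm]
      gcongr
      exact (hEk p.1 p.2).2
    have hm' : AEStronglyMeasurable (fun p : ℝ × ℝ => ∫ x in Ioi (0 : ℝ),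
        ‖(E x p.1 * φ p.1) * conj (E x p.2 * φ p.2)‖) (volume.prod volume) :=
      hm.norm.prod_swap.integral_prod_right'
    exact hk.mono' hm' (ae_of_all _ hle)
  exact (integrable_prod_iff' hm).2 ⟨ae_of_all _ hA, hB⟩

theorem integral_fourier_mul_inv_cosh {ψ : ℝ → ℂ} (h1 : Integrable ψ) (v' : ℝ) :
    ∫ v, 𝓕 ψ v * ((Real.cosh (Real.pi * (v - v')))⁻¹ : ℝ) =
      𝓕 (fun τ => ψ τ * ((Real.cosh (Real.pi * τ))⁻¹ : ℝ)) v' := by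
  have hg : Integrable fun v : ℝ => (((Real.cosh (Real.pi * (v - v')))⁻¹ : ℝ) : ℂ) :=
    (integrable_inv_cosh.comp_sub_right v').ofReal
  rw [integral_fourier_mul_eq_integral_mul_fourier h1 hg, Real.fourier_real_eq]
  congr 1
  ext τ
  rw [fourier_comp_sub_right (fun v : ℝ => (((Real.cosh (Real.pi * v))⁻¹ : ℝ) : ℂ)),
    fourier_inv_cosh, mul_smul_comm, mul_comm v' τ]

/-- The identity behind the isometry: for `G(x) = ∫ 𝓕(shiftWave x)(τ) ψ(τ) dτ` one has
`∫₀^∞ |G|² = ∫ |ψ|² / cosh πτ`. -/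
theorem integral_norm_sq_shiftWave {ψ : ℝ → ℂ} (h1 : Integrable ψ) (h2 : MemLp ψ 2) :
    IntegrableOn (fun x => ‖∫ v, shiftWave x v * 𝓕 ψ v‖ ^ 2) (Ioi 0) ∧
    ∫ x in Ioi (0 : ℝ), ‖∫ v, shiftWave x v * 𝓕 ψ v‖ ^ 2 =
      ∫ τ, ‖ψ τ‖ ^ 2 * (Real.cosh (Real.pi * τ))⁻¹ := by
  have hφ := memLp_fourier h1 h2
  have hint := integrable_triple continuous_shiftWave_uncurry hφ.aestronglyMeasurable
    (integrable_schur hφ) integral_norm_shiftWave_mul_le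
  have hsq : ∀ x : ℝ, ((‖∫ v, shiftWave x v * 𝓕 ψ v‖ ^ 2 : ℝ) : ℂ) =
      ∫ p : ℝ × ℝ, (shiftWave x p.1 * 𝓕 ψ p.1) * conj (shiftWave x p.2 * 𝓕 ψ p.2)
        ∂((volume : Measure ℝ).prod volume) := by
    intro x
    rw [integral_prod_mul (fun v => shiftWave x v * 𝓕 ψ v)
      (fun v => conj (shiftWave x v * 𝓕 ψ v)), integral_conj, Complex.mul_conj,
      Complex.normSq_eq_norm_sq]
  have hI : IntegrableOn (fun x => ((‖∫ v, shiftWave x v * 𝓕 ψ v‖ ^ 2 : ℝ) : ℂ)) (Ioi 0) := by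
    simp_rw [hsq]
    exact hint.integral_prod_left
  refine ⟨hI.re, ?_⟩
  have hmain : ∫ x in Ioi (0 : ℝ), ((‖∫ v, shiftWave x v * 𝓕 ψ v‖ ^ 2 : ℝ) : ℂ) =
      ∫ τ, ((‖ψ τ‖ ^ 2 * (Real.cosh (Real.pi * τ))⁻¹ : ℝ) : ℂ) := by
    simp_rw [hsq]
    rw [integral_integral_swap hint]
    have hk : ∀ p : ℝ × ℝ, ∫ x in Ioi (0 : ℝ), (shiftWave x p.1 * 𝓕 ψ p.1) *
        conj (shiftWave x p.2 * 𝓕 ψ p.2) =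
        (𝓕 ψ p.1 * ((Real.cosh (Real.pi * (p.1 - p.2)))⁻¹ : ℝ)) * conj (𝓕 ψ p.2) := by
      intro p
      rw [← integral_shiftWave_mul_conj, ← integral_const_mul, ← integral_mul_const]
      congr 1
      ext x
      rw [map_mul]
      ring
    have hint2 := hint.integral_prod_right
    simp_rw [hk] at hint2 ⊢
    rw [integral_prod_symm _ hint2]
    simp only [integral_mul_const, integral_fourier_mul_inv_cosh h1]
    have hb : ∀ τ : ℝ, ‖(((Real.cosh (Real.pi * τ))⁻¹ : ℝ) : ℂ)‖ ≤ 1 := by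
      intro τ
      rw [Complex.norm_real, Real.norm_of_nonneg (inv_cosh_pi_pos τ).le]
      exact inv_le_one_of_one_le₀ (Real.one_le_cosh _)
    have hcm : AEStronglyMeasurable (fun τ : ℝ => (((Real.cosh (Real.pi * τ))⁻¹ : ℝ) : ℂ)) volume :=
      (Complex.continuous_ofReal.comp continuous_inv_cosh_pi).aestronglyMeasurable
    have g1 : Integrable fun τ => ψ τ * ((Real.cosh (Real.pi * τ))⁻¹ : ℝ) :=
      h1.mul_bdd hcm (ae_of_all _ hb)
    have g2 : MemLp (fun τ => ψ τ * ((Real.cosh (Real.pi * τ))⁻¹ : ℝ)) 2 := by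
      refine h2.mono (h2.aestronglyMeasurable.mul hcm) (ae_of_all _ fun τ => ?_)
      rw [norm_mul]
      exact mul_le_of_le_one_right (norm_nonneg _) (hb τ)
    have hP := integral_conj_fourier_mul_fourier h1 h2 g1 g2
    simp_rw [mul_comm (𝓕 (fun τ => ψ τ * (((Real.cosh (Real.pi * τ))⁻¹ : ℝ) : ℂ)) _)]
    rw [hP]
    congr 1
    ext τ
    rw [← mul_assoc, mul_comm (conj (ψ τ)), Complex.mul_conj, Complex.normSq_eq_norm_sq]
    push_cast
    rfl
  rw [integral_complex_ofReal, integral_complex_ofReal] at hmain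
  exact_mod_cast hmain

/-! ### The transform of functions supported away from the endpoints -/

/-- The integral `∫₀¹ q(s, x) h(s) ds`. -/
def kernelTransform (h : ℝ → ℂ) (x : ℝ) : ℂ := ∫ s in Ioo (0 : ℝ) 1, kernelQ s x * h s

/-- `h ∈ L²(0, 1)` vanishes near the endpoints `0` and `1`. -/
def IsTruncated (h : ℝ → ℂ) : Prop :=
  MemLp h 2 (volume.restrict (Ioo (0 : ℝ) 1)) ∧ ∃ a b : ℝ, 0 < a ∧ b < 1 ∧ ∀ s ∉ Icc a b, h s = 0

/-- The function `ψ` of the parameter `τ` with `∫₀¹ q(s, x) h(s) ds = ∫ 𝓕(shiftWave x)(τ) ψ(τ) dτ`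
and `|ψ|² / cosh πτ dτ = |h|² ds`. -/
def paramFun (h : ℝ → ℂ) (τ : ℝ) : ℂ :=
  (√Real.pi * √(1 - specValue τ) * Real.exp (-(Real.pi * τ / 2)) : ℝ) * h (specValue τ)

theorem specDensity_smul_kernelQ (h : ℝ → ℂ) {x : ℝ} (hx : 0 < x) (τ : ℝ) :
    specDensity τ • (kernelQ (specValue τ) x * h (specValue τ)) =
      𝓕 (shiftWave x) τ * paramFun h τ := by
  have hs := specValue_mem τ
  have h1 : 0 < 1 - specValue τ := sub_pos.2 hs.2
  have key : specDensity τ * (2 * √Real.pi * (specValue τ * √(1 - specValue τ)))⁻¹ =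
      √Real.pi * √(1 - specValue τ) := by
    have p1 := Real.sqrt_pos.2 h1
    have p2 := Real.sqrt_pos.2 Real.pi_pos
    have := hs.1
    rw [specDensity]
    nth_rewrite 1 [← Real.sq_sqrt Real.pi_pos.le]
    field_simp
    exact (Real.sq_sqrt h1.le).symm
  rw [kernelQ_eq hs hx, expParam_specValue, fourier_realWave_eq hx.le, paramFun, Complex.real_smul,
    ← key]
  push_cast
  ring

theorem norm_paramFun_sq (h : ℝ → ℂ) (τ : ℝ) :
    ‖paramFun h τ‖ ^ 2 * (Real.cosh (Real.pi * τ))⁻¹ =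
      specDensity τ • ‖h (specValue τ)‖ ^ 2 := by
  have hs := specValue_mem τ
  have h1 : 0 < 1 - specValue τ := sub_pos.2 hs.2
  have e1 : Real.exp (-(Real.pi * τ / 2)) ^ 2 * (Real.cosh (Real.pi * τ))⁻¹ = 2 * specValue τ := by
    have hE := Real.exp_pos (Real.pi * τ)
    rw [← Real.exp_nat_mul, specValue, Real.cosh_eq,
      show ((2 : ℕ) : ℝ) * -(Real.pi * τ / 2) = -(Real.pi * τ) by push_cast; ring,
      show 2 * Real.pi * τ = Real.pi * τ + Real.pi * τ by ring, Real.exp_add, Real.exp_neg]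
    field_simp
    ring
  rw [paramFun, norm_mul, Complex.norm_real, Real.norm_of_nonneg (by positivity), mul_pow, mul_pow,
    mul_pow, Real.sq_sqrt Real.pi_pos.le, Real.sq_sqrt h1.le, specDensity, smul_eq_mul]
  linear_combination Real.pi * (1 - specValue τ) * ‖h (specValue τ)‖ ^ 2 * e1

theorem continuousOn_expParam : ContinuousOn expParam (Ioo 0 1) := by
  intro s hs
  have h : 0 < 1 / s - 1 := by
    have := (one_lt_div hs.1).2 hs.2
    linarith
  have h0 : s ≠ 0 := hs.1.ne'
  unfold expParam
  have h1 : ContinuousAt (fun s : ℝ => 1 / s - 1) s := by fun_prop (disch := exact h0)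
  exact ((h1.log h.ne').div_const _).continuousWithinAt

instance : IsFiniteMeasure (volume.restrict (Ioo (0 : ℝ) 1)) :=
  ⟨by rw [Measure.restrict_apply_univ]; exact measure_Ioo_lt_top⟩

/-- Away from the endpoints the weight relating `paramFun h` to `h` is bounded. -/
theorem IsTruncated.exists_norm_paramFun_le {h : ℝ → ℂ} (hh : IsTruncated h) :
    ∃ C, 0 ≤ C ∧ ∀ τ, ‖paramFun h τ‖ ≤ C * (specDensity τ * ‖h (specValue τ)‖) := by
  obtain ⟨-, a, b, ha, hb, hsupp⟩ := hh
  have hsub : Icc a b ⊆ Ioo 0 1 := fun s hs => ⟨ha.trans_le hs.1, hs.2.trans_lt hb⟩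
  have hK : IsCompact (expParam '' Icc a b) :=
    isCompact_Icc.image_of_continuousOn (continuousOn_expParam.mono hsub)
  have hcont : Continuous fun τ => √Real.pi * √(1 - specValue τ) * Real.exp (-(Real.pi * τ / 2)) *
      (specDensity τ)⁻¹ := by
    have h1 := continuous_specValue
    have h2 := continuous_specDensity.inv₀ fun τ => (specDensity_pos τ).ne'
    exact (by fun_prop : Continuous fun τ => √Real.pi * √(1 - specValue τ) *
      Real.exp (-(Real.pi * τ / 2))).mul h2
  obtain ⟨C, hC⟩ := hK.exists_bound_of_continuousOn hcont.continuousOn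
  refine ⟨|C|, abs_nonneg C, fun τ => ?_⟩
  have hd := specDensity_pos τ
  by_cases hτ : specValue τ ∈ Icc a b
  · have h1 := hC τ ⟨specValue τ, hτ, expParam_specValue τ⟩
    have e : ‖paramFun h τ‖ = ‖√Real.pi * √(1 - specValue τ) * Real.exp (-(Real.pi * τ / 2)) *
      (specDensity τ)⁻¹‖ * (specDensity τ * ‖h (specValue τ)‖) := by
      rw [paramFun, norm_mul, Complex.norm_real, norm_mul _ (specDensity τ)⁻¹, norm_inv,
        Real.norm_of_nonneg hd.le]
      field_simp
    rw [e]
    have := h1.trans (le_abs_self C)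
    gcongr
  · rw [paramFun, hsupp _ hτ, mul_zero, norm_zero]
    positivity

theorem aestronglyMeasurable_paramFun {h : ℝ → ℂ}
    (hh : AEStronglyMeasurable h (volume.restrict (Ioo (0 : ℝ) 1))) :
    AEStronglyMeasurable (paramFun h) volume := by
  have h1 := continuous_specValue
  refine Continuous.aestronglyMeasurable ?_ |>.mul
    (hh.comp_quasiMeasurePreserving quasiMeasurePreserving_specValue)
  fun_prop

theorem IsTruncated.integrable_paramFun {h : ℝ → ℂ} (hh : IsTruncated h) :
    Integrable (paramFun h) := by
  obtain ⟨C, hC0, hC⟩ := hh.exists_norm_paramFun_le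
  have h1 : IntegrableOn (fun s => ‖h s‖) (Ioo 0 1) := (hh.1.integrable one_le_two).norm
  rw [integrableOn_unit_iff_integrable_specValue] at h1
  exact (h1.const_mul C).mono' (aestronglyMeasurable_paramFun hh.1.aestronglyMeasurable)
    (ae_of_all _ hC)

theorem IsTruncated.memLp_paramFun {h : ℝ → ℂ} (hh : IsTruncated h) : MemLp (paramFun h) 2 := by
  obtain ⟨C, hC0, hC⟩ := hh.exists_norm_paramFun_le
  have h1 : IntegrableOn (fun s => ‖h s‖ ^ 2) (Ioo 0 1) :=
    (memLp_two_iff_integrable_sq_norm hh.1.aestronglyMeasurable).1 hh.1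
  rw [integrableOn_unit_iff_integrable_specValue] at h1
  have hm := aestronglyMeasurable_paramFun hh.1.aestronglyMeasurable
  refine (memLp_two_iff_integrable_sq_norm hm).2
    ((h1.const_mul (C ^ 2 * (2 * Real.pi))).mono' (hm.norm.pow 2) (ae_of_all _ fun τ => ?_))
  have hd := specDensity_pos τ
  have hs := specValue_mem τ
  have hd2 : specDensity τ ≤ 2 * Real.pi := by
    rw [specDensity]
    refine mul_le_of_le_one_right (by positivity) ?_
    nlinarith [hs.1, hs.2]
  rw [Real.norm_of_nonneg (by positivity), smul_eq_mul]
  calc ‖paramFun h τ‖ ^ 2 ≤ (C * (specDensity τ * ‖h (specValue τ)‖)) ^ 2 := by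
        gcongr
        exact hC τ
    _ = C ^ 2 * specDensity τ * (specDensity τ * ‖h (specValue τ)‖ ^ 2) := by ring
    _ ≤ _ := by gcongr

theorem norm_fourier_shiftWave_le {x : ℝ} (hx : 0 ≤ x) (τ : ℝ) :
    ‖𝓕 (shiftWave x) τ‖ ≤ ∫ v, √2 * (Real.cosh (Real.pi * v))⁻¹ := by
  rw [Real.fourier_real_eq]
  refine norm_integral_le_of_norm_le (integrable_inv_cosh.const_mul _) (ae_of_all _ fun v => ?_)
  rw [Circle.norm_smul]
  exact norm_shiftWave_le hx v

theorem IsTruncated.integrableOn {h : ℝ → ℂ} (hh : IsTruncated h) {x : ℝ} (hx : 0 < x) :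
    IntegrableOn (fun s => kernelQ s x * h s) (Ioo 0 1) := by
  rw [integrableOn_unit_iff_integrable_specValue]
  simp_rw [specDensity_smul_kernelQ h hx]
  exact hh.integrable_paramFun.bdd_mul
    (continuous_fourier (integrable_shiftWave hx.le)).aestronglyMeasurable
    (ae_of_all _ (norm_fourier_shiftWave_le hx.le))

theorem IsTruncated.kernelTransform_eq {h : ℝ → ℂ} (hh : IsTruncated h) {x : ℝ} (hx : 0 < x) :
    kernelTransform h x = ∫ v, shiftWave x v * 𝓕 (paramFun h) v := by
  rw [kernelTransform, integral_unit_eq_integral_specValue]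
  simp_rw [specDensity_smul_kernelQ h hx]
  exact integral_fourier_mul_eq_integral_mul_fourier (integrable_shiftWave hx.le)
    hh.integrable_paramFun

theorem IsTruncated.memLp_kernelTransform {h : ℝ → ℂ} (hh : IsTruncated h) :
    MemLp (kernelTransform h) 2 (volume.restrict (Ioi (0 : ℝ))) := by
  have hae : kernelTransform h =ᵐ[volume.restrict (Ioi (0 : ℝ))]
      fun x => ∫ v, shiftWave x v * 𝓕 (paramFun h) v := by
    filter_upwards [ae_restrict_mem measurableSet_Ioi] with x hx
    exact hh.kernelTransform_eq hx
  refine (memLp_congr_ae hae).2 ((memLp_two_iff_integrable_sq_norm ?_).2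
    (integral_norm_sq_shiftWave hh.integrable_paramFun hh.memLp_paramFun).1)
  have hc : Continuous fun p : ℝ × ℝ => shiftWave p.1 p.2 * 𝓕 (paramFun h) p.2 :=
    continuous_shiftWave_uncurry.mul
      ((continuous_fourier hh.integrable_paramFun).comp continuous_snd)
  exact (hc.stronglyMeasurable.integral_prod_right (ν := volume)).aestronglyMeasurable

/-- On functions vanishing near the endpoints the transform is isometric. -/
theorem IsTruncated.eLpNorm_kernelTransform {h : ℝ → ℂ} (hh : IsTruncated h) :
    eLpNorm (kernelTransform h) 2 (volume.restrict (Ioi (0 : ℝ))) =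
      eLpNorm h 2 (volume.restrict (Ioo (0 : ℝ) 1)) := by
  rw [hh.memLp_kernelTransform.eLpNorm_eq_integral_rpow_norm (by norm_num) (by norm_num),
    hh.1.eLpNorm_eq_integral_rpow_norm (by norm_num) (by norm_num)]
  congr 2
  simp only [ENNReal.toReal_ofNat, Real.rpow_ofNat]
  rw [integral_unit_eq_integral_specValue]
  simp_rw [← norm_paramFun_sq h]
  rw [← (integral_norm_sq_shiftWave hh.integrable_paramFun hh.memLp_paramFun).2]
  refine setIntegral_congr_fun measurableSet_Ioi fun x hx => ?_
  simp only [hh.kernelTransform_eq hx]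

theorem isTruncated_indicator {h : ℝ → ℂ} (hh : MemLp h 2 (volume.restrict (Ioo (0 : ℝ) 1)))
    {a b : ℝ} (ha : 0 < a) (hb : b < 1) : IsTruncated ((Icc a b).indicator h) :=
  ⟨hh.indicator measurableSet_Icc, a, b, ha, hb, fun _ hs => indicator_of_notMem hs _⟩

theorem IsTruncated.sub {h k : ℝ → ℂ} (hh : IsTruncated h) (hk : IsTruncated k) :
    IsTruncated (h - k) := by
  obtain ⟨h1, a, b, ha, hb, hs⟩ := hh
  obtain ⟨k1, a', b', ha', hb', ks⟩ := hk
  refine ⟨h1.sub k1, min a a', max b b', lt_min ha ha', max_lt hb hb', fun s hsn => ?_⟩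
  have e1 : s ∉ Icc a b := fun hm => hsn ⟨(min_le_left _ _).trans hm.1, hm.2.trans (le_max_left _ _)⟩
  have e2 : s ∉ Icc a' b' := fun hm =>
    hsn ⟨(min_le_right _ _).trans hm.1, hm.2.trans (le_max_right _ _)⟩
  rw [Pi.sub_apply, hs s e1, ks s e2, sub_zero]

theorem IsTruncated.kernelTransform_sub {h k : ℝ → ℂ} (hh : IsTruncated h) (hk : IsTruncated k)
    {x : ℝ} (hx : 0 < x) :
    kernelTransform (h - k) x = kernelTransform h x - kernelTransform k x := by
  rw [kernelTransform, kernelTransform, kernelTransform,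
    ← integral_sub (hh.integrableOn hx) (hk.integrableOn hx)]
  simp only [Pi.sub_apply, mul_sub]

/-- Truncations exhausting `(0, 1)` converge in `L²`. -/
theorem tendsto_eLpNorm_indicator_sub {ι : Type*} {l : Filter ι} [l.IsCountablyGenerated]
    {S : ι → Set ℝ} (hS : ∀ i, MeasurableSet (S i))
    (hlim : ∀ s ∈ Ioo (0 : ℝ) 1, ∀ᶠ i in l, s ∈ S i) {h : ℝ → ℂ}
    (hh : MemLp h 2 (volume.restrict (Ioo (0 : ℝ) 1))) :
    Tendsto (fun i => eLpNorm ((S i).indicator h - h) 2 (volume.restrict (Ioo (0 : ℝ) 1))) l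
      (𝓝 0) := by
  have h2 : ∀ i, eLpNorm ((S i).indicator h - h) 2 (volume.restrict (Ioo (0 : ℝ) 1)) =
      (∫⁻ s in Ioo (0 : ℝ) 1, ‖((S i).indicator h - h) s‖ₑ ^ (2 : ℝ)) ^ (1 / 2 : ℝ) := by
    intro i
    rw [eLpNorm_eq_lintegral_rpow_enorm_toReal (by norm_num) (by norm_num)]
    norm_num
  simp_rw [h2]
  have h3 : Tendsto (fun i => ∫⁻ s in Ioo (0 : ℝ) 1, ‖((S i).indicator h - h) s‖ₑ ^ (2 : ℝ)) l
      (𝓝 (∫⁻ s in Ioo (0 : ℝ) 1, 0)) := by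
    refine tendsto_lintegral_filter_of_dominated_convergence' (fun s => ‖h s‖ₑ ^ (2 : ℝ))
      (Eventually.of_forall fun i => ?_) (Eventually.of_forall fun i => ae_of_all _ fun s => ?_)
      ?_ ?_
    · exact ((hh.aestronglyMeasurable.indicator (hS i)).sub
        hh.aestronglyMeasurable).enorm.pow_const _
    · by_cases hs : s ∈ S i
      · simp [hs]
      · simp [hs]
    · have := hh.eLpNorm_lt_top
      have h4 := (eLpNorm_lt_top_iff_lintegral_rpow_enorm_lt_top (p := 2) (by norm_num)
        (by norm_num)).1 this
      simpa using h4.ne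
    · filter_upwards [ae_restrict_mem measurableSet_Ioo] with s hs
      refine tendsto_const_nhds.congr' ?_
      filter_upwards [hlim s hs] with i hi
      simp [hi]
  have h4 := ((ENNReal.continuous_rpow_const (y := (1 / 2 : ℝ))).tendsto _).comp h3
  simpa [Function.comp_def] using h4

/-! ### The spectral transform as an isometry of `L²` spaces -/

/-- An exhaustion of `(0, 1)` by compact intervals. -/
def cutSet (n : ℕ) : Set ℝ := Icc (1 / ((n : ℝ) + 2)) (1 - 1 / ((n : ℝ) + 2))

theorem eventually_mem_cutSet {s : ℝ} (hs : s ∈ Ioo (0 : ℝ) 1) : ∀ᶠ n in atTop, s ∈ cutSet n := by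
  have h : Tendsto (fun n : ℕ => 1 / ((n : ℝ) + 2)) atTop (𝓝 0) :=
    tendsto_const_nhds.div_atTop (tendsto_atTop_add_const_right _ _ tendsto_natCast_atTop_atTop)
  filter_upwards [h.eventually_lt_const hs.1, h.eventually_lt_const (sub_pos.2 hs.2)] with n h1 h2
  exact ⟨h1.le, by linarith⟩

theorem isTruncated_cutSet (n : ℕ) (h : L2On (Ioo 0 1)) :
    IsTruncated ((cutSet n).indicator h) := by
  have : 0 < 1 / ((n : ℝ) + 2) := by positivity
  exact isTruncated_indicator (Lp.memLp h) this (by linarith)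

/-- The truncated transform `h ↦ ∫_{cutSet n} q(s, ·) h(s) ds`. -/
def truncTransform (n : ℕ) : L2On (Ioo 0 1) →ₗ[ℂ] L2On (Ioi 0) where
  toFun h := (isTruncated_cutSet n h).memLp_kernelTransform.toLp
  map_add' h k := by
    rw [← MemLp.toLp_add]
    refine MemLp.toLp_congr _ _ ?_
    filter_upwards [ae_restrict_mem measurableSet_Ioi] with x hx
    rw [Pi.add_apply, kernelTransform, kernelTransform, kernelTransform,
      ← integral_add ((isTruncated_cutSet n h).integrableOn hx)
        ((isTruncated_cutSet n k).integrableOn hx)]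
    refine integral_congr_ae ?_
    filter_upwards [Lp.coeFn_add h k] with s hs
    by_cases hm : s ∈ cutSet n
    · simp only [indicator_of_mem hm, hs, Pi.add_apply, mul_add]
    · simp only [indicator_of_notMem hm, mul_zero, add_zero]
  map_smul' c h := by
    rw [RingHom.id_apply, ← MemLp.toLp_const_smul]
    refine MemLp.toLp_congr _ _ ?_
    filter_upwards with x
    rw [Pi.smul_apply, kernelTransform, kernelTransform, smul_eq_mul, ← integral_const_mul]
    refine integral_congr_ae ?_
    filter_upwards [Lp.coeFn_smul c h] with s hs
    by_cases hm : s ∈ cutSet n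
    · simp only [indicator_of_mem hm, hs, Pi.smul_apply, smul_eq_mul]
      ring
    · simp only [indicator_of_notMem hm, mul_zero]

theorem truncTransform_apply (n : ℕ) (h : L2On (Ioo 0 1)) :
    truncTransform n h = (isTruncated_cutSet n h).memLp_kernelTransform.toLp := rfl

theorem tendsto_toLp_cutSet (h : L2On (Ioo 0 1)) :
    Tendsto (fun n => (isTruncated_cutSet n h).1.toLp) atTop (𝓝 h) := by
  have h1 := tendsto_eLpNorm_indicator_sub (l := atTop) (S := cutSet) (fun _ => measurableSet_Icc)
    (fun s hs => eventually_mem_cutSet hs) (Lp.memLp h)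
  have h2 := (Lp.tendsto_Lp_iff_tendsto_eLpNorm'' (fun n => (cutSet n).indicator h)
    (fun n => (isTruncated_cutSet n h).1) h (Lp.memLp h)).2 h1
  rwa [Lp.toLp_coeFn] at h2

theorem norm_truncTransform (n : ℕ) (h : L2On (Ioo 0 1)) :
    ‖truncTransform n h‖ = ‖(isTruncated_cutSet n h).1.toLp‖ := by
  rw [truncTransform_apply, Lp.norm_toLp, Lp.norm_toLp,
    (isTruncated_cutSet n h).eLpNorm_kernelTransform]

theorem dist_truncTransform (n m : ℕ) (h : L2On (Ioo 0 1)) :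
    dist (truncTransform n h) (truncTransform m h) =
      dist ((isTruncated_cutSet n h).1.toLp) ((isTruncated_cutSet m h).1.toLp) := by
  have hn := isTruncated_cutSet n h
  have hm := isTruncated_cutSet m h
  rw [dist_eq_norm, dist_eq_norm, truncTransform_apply, truncTransform_apply, ← MemLp.toLp_sub,
    ← MemLp.toLp_sub, Lp.norm_toLp, Lp.norm_toLp, ← (hn.sub hm).eLpNorm_kernelTransform]
  congr 1
  refine eLpNorm_congr_ae ?_
  filter_upwards [ae_restrict_mem measurableSet_Ioi] with x hx
  exact (hn.kernelTransform_sub hm hx).symm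

theorem tendsto_truncTransform (h : L2On (Ioo 0 1)) :
    Tendsto (fun n => truncTransform n h) atTop
      (𝓝 (limUnder atTop fun n => truncTransform n h)) := by
  have h1 := (tendsto_toLp_cutSet h).cauchySeq
  have h2 : CauchySeq fun n => truncTransform n h := by
    rw [Metric.cauchySeq_iff] at h1 ⊢
    simpa only [dist_truncTransform] using h1
  exact tendsto_nhds_limUnder (cauchySeq_tendsto_of_complete h2)

/-- The transform `V` as a linear isometry, defined as the strong limit of its truncations. -/
def spectralIsometry : L2On (Ioo 0 1) →ₗᵢ[ℂ] L2On (Ioi 0) where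
  toLinearMap := linearMapOfTendsto (fun h => limUnder atTop fun n => truncTransform n h)
    truncTransform (tendsto_pi_nhds.2 tendsto_truncTransform)
  norm_map' h := by
    have h1 := (tendsto_truncTransform h).norm
    simp_rw [norm_truncTransform] at h1
    exact tendsto_nhds_unique h1 (tendsto_toLp_cutSet h).norm

theorem tendsto_spectralIsometry (h : L2On (Ioo 0 1)) :
    Tendsto (fun n => truncTransform n h) atTop (𝓝 (spectralIsometry h)) :=
  tendsto_truncTransform h

/-- Where the defining integral converges absolutely, it represents the transform. -/
theorem coeFn_spectralIsometry (h : L2On (Ioo 0 1))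
    (hint : ∀ x > 0, IntegrableOn (fun s => kernelQ s x * h s) (Ioo 0 1)) :
    spectralIsometry h =ᵐ[volume.restrict (Ioi (0 : ℝ))] kernelTransform h := by
  obtain ⟨ns, hns, hae⟩ :=
    (tendstoInMeasure_of_tendsto_Lp (tendsto_spectralIsometry h)).exists_seq_tendsto_ae
  have hall : ∀ᵐ x ∂(volume.restrict (Ioi (0 : ℝ))), ∀ n,
      truncTransform n h x = kernelTransform ((cutSet n).indicator h) x :=
    ae_all_iff.2 fun n => (isTruncated_cutSet n h).memLp_kernelTransform.coeFn_toLp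
  filter_upwards [hae, hall, ae_restrict_mem measurableSet_Ioi] with x h1 h2 hx
  simp_rw [h2] at h1
  refine tendsto_nhds_unique h1 ?_
  refine tendsto_integral_of_dominated_convergence (fun s => ‖kernelQ s x * h s‖)
    (fun n => ((isTruncated_cutSet (ns n) h).integrableOn hx).aestronglyMeasurable)
    (hint x hx).norm (fun n => ae_of_all _ fun s => ?_) ?_
  · rw [norm_mul, norm_mul]
    gcongr
    exact norm_indicator_le_norm_self _ _
  · filter_upwards [ae_restrict_mem measurableSet_Ioo] with s hs
    refine tendsto_const_nhds.congr' ?_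
    filter_upwards [hns.tendsto_atTop.eventually (eventually_mem_cutSet hs)] with n hn
    rw [indicator_of_mem hn]

/-- The transform of `h ∈ L²(0, 1)` given as a function. -/
theorem coeFn_spectralIsometry_toLp {h : ℝ → ℂ}
    (hh : MemLp h 2 (volume.restrict (Ioo (0 : ℝ) 1)))
    (hint : ∀ x > 0, IntegrableOn (fun s => kernelQ s x * h s) (Ioo 0 1)) :
    spectralIsometry hh.toLp =ᵐ[volume.restrict (Ioi (0 : ℝ))] kernelTransform h := by
  have hc : ∀ x, (fun s => kernelQ s x * hh.toLp h s) =ᵐ[volume.restrict (Ioo (0 : ℝ) 1)]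
      fun s => kernelQ s x * h s := by
    intro x
    filter_upwards [hh.coeFn_toLp] with s hs
    rw [hs]
  refine (coeFn_spectralIsometry _ fun x hx => (hint x hx).congr (hc x).symm).trans
    (ae_of_all _ fun x => ?_)
  exact integral_congr_ae (hc x)

theorem intervalIntegral_eq_kernelTransform (h : ℝ → ℂ) {a a' : ℝ} (ha : 0 < a) (ha' : 0 < a')
    (haa : a + a' < 1) (x : ℝ) :
    ∫ s in a..(1 - a'), kernelQ s x * h s =
      kernelTransform ((Icc a (1 - a')).indicator h) x := by
  have hsub : Icc a (1 - a') ⊆ Ioo 0 1 := fun s hs =>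
    ⟨ha.trans_le hs.1, by linarith [hs.2]⟩
  rw [intervalIntegral.integral_of_le (by linarith), ← integral_Icc_eq_integral_Ioc,
    kernelTransform]
  have e : (fun s => kernelQ s x * (Icc a (1 - a')).indicator h s) =
      (Icc a (1 - a')).indicator fun s => kernelQ s x * h s := by
    ext s
    by_cases hs : s ∈ Icc a (1 - a')
    · simp only [indicator_of_mem hs]
    · simp only [indicator_of_notMem hs, mul_zero]
  rw [e, setIntegral_indicator measurableSet_Icc, inter_eq_right.2 hsub]

theorem isSpectralTransform_spectralIsometry : IsSpectralTransform spectralIsometry := by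
  intro h
  have hmem := Lp.memLp h
  refine ⟨fun a ha a' ha' haa => ?_, ?_⟩
  · have ht := isTruncated_indicator hmem ha (by linarith : 1 - a' < 1)
    have hsub : Icc a (1 - a') ⊆ Ioo 0 1 := fun s hs =>
      ⟨ha.trans_le hs.1, by linarith [hs.2]⟩
    refine ⟨fun x hx => ?_, ?_⟩
    · refine ((ht.integrableOn hx).mono_set hsub).congr_fun (fun s hs => ?_) measurableSet_Icc
      simp only [indicator_of_mem hs]
    · simp_rw [intervalIntegral_eq_kernelTransform h ha ha' haa]
      exact ht.memLp_kernelTransform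
  · have hev : ∀ᶠ p : ℝ × ℝ in 𝓝[>] (0 : ℝ) ×ˢ 𝓝[>] (0 : ℝ), 0 < p.1 ∧ 0 < p.2 ∧ p.1 + p.2 < 1 := by
      have h1 : ∀ᶠ t : ℝ in 𝓝[>] (0 : ℝ), 0 < t ∧ t < 1 / 2 :=
        Ioo_mem_nhdsGT (by norm_num : (0 : ℝ) < 1 / 2)
      filter_upwards [h1.prod_mk h1] with p hp
      exact ⟨hp.1.1, hp.2.1, by linarith [hp.1.2, hp.2.2]⟩
    have hlim := tendsto_eLpNorm_indicator_sub (l := 𝓝[>] (0 : ℝ) ×ˢ 𝓝[>] (0 : ℝ))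
      (S := fun p : ℝ × ℝ => Icc p.1 (1 - p.2)) (fun _ => measurableSet_Icc) (fun s hs => by
        have h1 : ∀ᶠ t : ℝ in 𝓝[>] (0 : ℝ), t < s :=
          nhdsWithin_le_nhds (Iio_mem_nhds hs.1)
        have h2 : ∀ᶠ t : ℝ in 𝓝[>] (0 : ℝ), t < 1 - s :=
          nhdsWithin_le_nhds (Iio_mem_nhds (sub_pos.2 hs.2))
        filter_upwards [h1.prod_mk h2] with p hp
        exact ⟨hp.1.le, by linarith [hp.2]⟩) hmem
    refine hlim.congr' ?_
    filter_upwards [hev] with p hp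
    have ht := isTruncated_indicator hmem hp.1 (by linarith [hp.2.1] : 1 - p.2 < 1)
    have h1 := coeFn_spectralIsometry_toLp ht.1 fun x hx => ht.integrableOn hx
    obtain ⟨d, hd⟩ : ∃ d : L2On (Ioo 0 1), d = ht.1.toLp _ - h := ⟨_, rfl⟩
    have h2 : ‖spectralIsometry d‖ₑ = ‖d‖ₑ := by
      rw [enorm_eq_iff_norm_eq, spectralIsometry.norm_map]
    have e1 : eLpNorm ((Icc p.1 (1 - p.2)).indicator h - ⇑h) 2 (volume.restrict (Ioo (0 : ℝ) 1)) =
        eLpNorm d 2 (volume.restrict (Ioo (0 : ℝ) 1)) := by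
      refine eLpNorm_congr_ae ?_
      rw [hd]
      filter_upwards [Lp.coeFn_sub (ht.1.toLp _) h, ht.1.coeFn_toLp] with s hs1 hs2
      rw [hs1, Pi.sub_apply, Pi.sub_apply, hs2]
    rw [hd, map_sub, ← hd, Lp.enorm_def, Lp.enorm_def] at h2
    rw [e1, ← h2]
    refine eLpNorm_congr_ae ?_
    filter_upwards [Lp.coeFn_sub (spectralIsometry (ht.1.toLp _)) (spectralIsometry h), h1]
      with x hx1 hx2
    rw [hx1, Pi.sub_apply, hx2, intervalIntegral_eq_kernelTransform h hp.1 hp.2.1 hp.2.2]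

/-! ### Transforms of band-limited functions -/

theorem tanh_pi_mul (v : ℝ) : Real.tanh (Real.pi * v) = 1 - 2 * specValue v := by
  have h := Real.exp_pos (Real.pi * v)
  rw [specValue, Real.tanh_eq, show 2 * Real.pi * v = Real.pi * v + Real.pi * v by ring,
    Real.exp_add, Real.exp_neg]
  field_simp
  ring

theorem inv_cosh_pi_sq (v : ℝ) :
    (Real.cosh (Real.pi * v))⁻¹ ^ 2 = 2 / Real.pi * specDensity v := by
  have h := Real.exp_pos (Real.pi * v)
  rw [specDensity, specValue, Real.cosh_eq,
    show 2 * Real.pi * v = Real.pi * v + Real.pi * v by ring, Real.exp_add, Real.exp_neg]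
  field_simp
  ring

/-- The substitution `t = tanh πv`. -/
theorem integral_comp_tanh (f : ℝ → ℂ) :
    ∫ v, (((Real.cosh (Real.pi * v))⁻¹ ^ 2 : ℝ) : ℂ) * f (Real.tanh (Real.pi * v)) =
      (1 / Real.pi : ℝ) * ∫ t in (-1 : ℝ)..1, f t := by
  have h1 : ∫ t in (-1 : ℝ)..1, f t = 2 * ∫ s in Ioo (0 : ℝ) 1, f (1 - 2 * s) := by
    rw [← integral_Ioc_eq_integral_Ioo, ← intervalIntegral.integral_of_le zero_le_one]
    rw [intervalIntegral.integral_comp_sub_mul f two_ne_zero, Complex.real_smul,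
      ← mul_assoc]
    norm_num
  rw [h1, integral_unit_eq_integral_specValue, ← integral_const_mul, ← integral_const_mul]
  refine integral_congr_ae (ae_of_all _ fun v => ?_)
  simp only [tanh_pi_mul, inv_cosh_pi_sq, Complex.real_smul]
  push_cast
  ring

/-- A bounded Borel function. -/
def IsBoundedSymbol (φ : ℝ → ℂ) : Prop := Measurable φ ∧ ∃ C, ∀ t, ‖φ t‖ ≤ C

/-- The function `conj φ`, `t ∈ (-1, 1)`, in the coordinate `t = tanh πv` and weighted like
`realWave`. -/
def bandWave (φ : ℝ → ℂ) (v : ℝ) : ℂ :=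
  conj (φ (Real.tanh (Real.pi * v))) * ((Real.cosh (Real.pi * v))⁻¹ : ℝ)

theorem IsBoundedSymbol.aestronglyMeasurable_bandWave {φ : ℝ → ℂ} (hφ : IsBoundedSymbol φ) :
    AEStronglyMeasurable (bandWave φ) volume := by
  have h1 : Measurable fun v : ℝ => Real.tanh (Real.pi * v) :=
    (continuous_tanh.comp (continuous_const.mul continuous_id)).measurable
  have h2 : Measurable fun v : ℝ => conj (φ (Real.tanh (Real.pi * v))) :=
    Complex.continuous_conj.measurable.comp (hφ.1.comp h1)
  exact (h2.mul (Complex.continuous_ofReal.comp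
    continuous_inv_cosh_pi).measurable).aestronglyMeasurable

theorem IsBoundedSymbol.exists_norm_bandWave_le {φ : ℝ → ℂ} (hφ : IsBoundedSymbol φ) :
    ∃ C, 0 ≤ C ∧ ∀ v, ‖bandWave φ v‖ ≤ C * (Real.cosh (Real.pi * v))⁻¹ := by
  obtain ⟨-, C, hC⟩ := hφ
  refine ⟨C, (norm_nonneg _).trans (hC 0), fun v => ?_⟩
  have := inv_cosh_pi_pos v
  rw [bandWave, norm_mul, RCLike.norm_conj, Complex.norm_real, Real.norm_of_nonneg this.le]
  gcongr
  exact hC _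

theorem IsBoundedSymbol.integrable_bandWave {φ : ℝ → ℂ} (hφ : IsBoundedSymbol φ) :
    Integrable (bandWave φ) := by
  obtain ⟨C, -, hC⟩ := hφ.exists_norm_bandWave_le
  exact (integrable_inv_cosh.const_mul C).mono' hφ.aestronglyMeasurable_bandWave (ae_of_all _ hC)

theorem IsBoundedSymbol.memLp_bandWave {φ : ℝ → ℂ} (hφ : IsBoundedSymbol φ) :
    MemLp (bandWave φ) 2 := by
  obtain ⟨C, hC0, hC⟩ := hφ.exists_norm_bandWave_le
  have hm := hφ.aestronglyMeasurable_bandWave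
  refine (memLp_two_iff_integrable_sq_norm hm).2
    ((integrable_inv_cosh.const_mul (C ^ 2)).mono' (hm.norm.pow 2) (ae_of_all _ fun v => ?_))
  have h0 := inv_cosh_pi_pos v
  have h1 : (Real.cosh (Real.pi * v))⁻¹ ≤ 1 := inv_le_one_of_one_le₀ (Real.one_le_cosh _)
  rw [Real.norm_of_nonneg (by positivity)]
  calc ‖bandWave φ v‖ ^ 2 ≤ (C * (Real.cosh (Real.pi * v))⁻¹) ^ 2 := by
        gcongr
        exact hC v
    _ = C ^ 2 * ((Real.cosh (Real.pi * v))⁻¹ * (Real.cosh (Real.pi * v))⁻¹) := by ring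
    _ ≤ C ^ 2 * ((Real.cosh (Real.pi * v))⁻¹ * 1) := by gcongr
    _ = _ := by rw [mul_one]

/-- The element of `L²(0, 1)` that `V` maps to `x ↦ π⁻¹ ∫_{-1}^1 e^{-ixt} φ(t) dt`. -/
def bandPreimage (φ : ℝ → ℂ) (s : ℝ) : ℂ :=
  conj (𝓕 (bandWave φ) (expParam s)) * ((√(Real.pi * (1 - s)))⁻¹ : ℝ)

theorem IsBoundedSymbol.aestronglyMeasurable_bandPreimage {φ : ℝ → ℂ} (hφ : IsBoundedSymbol φ) :
    AEStronglyMeasurable (bandPreimage φ) (volume.restrict (Ioo (0 : ℝ) 1)) := by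
  have hF := continuous_fourier hφ.integrable_bandWave
  refine ContinuousOn.aestronglyMeasurable ?_ measurableSet_Ioo
  have h1 : ContinuousOn (fun s : ℝ => (√(Real.pi * (1 - s)))⁻¹) (Ioo 0 1) :=
    ContinuousOn.inv₀ (by fun_prop) fun s hs =>
      (Real.sqrt_pos.2 (mul_pos Real.pi_pos (sub_pos.2 hs.2))).ne'
  exact (Complex.continuous_conj.comp_continuousOn (hF.comp_continuousOn continuousOn_expParam)).mul
    (Complex.continuous_ofReal.comp_continuousOn h1)

theorem IsBoundedSymbol.memLp_bandPreimage {φ : ℝ → ℂ} (hφ : IsBoundedSymbol φ) :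
    MemLp (bandPreimage φ) 2 (volume.restrict (Ioo (0 : ℝ) 1)) := by
  have hF := continuous_fourier hφ.integrable_bandWave
  have h2 : Integrable fun τ => ‖𝓕 (bandWave φ) τ‖ ^ 2 :=
    (memLp_two_iff_integrable_sq_norm hF.aestronglyMeasurable).1
      (memLp_fourier hφ.integrable_bandWave hφ.memLp_bandWave)
  rw [memLp_two_iff_integrable_sq_norm hφ.aestronglyMeasurable_bandPreimage]
  refine (integrableOn_unit_iff_integrable_specValue _).2 ?_
  have e : ∀ τ, specDensity τ • ‖bandPreimage φ (specValue τ)‖ ^ 2 =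
      2 * specValue τ * ‖𝓕 (bandWave φ) τ‖ ^ 2 := by
    intro τ
    have hs := specValue_mem τ
    have h1 : 0 < 1 - specValue τ := sub_pos.2 hs.2
    rw [bandPreimage, expParam_specValue, norm_mul, RCLike.norm_conj, Complex.norm_real, mul_pow,
      norm_inv, inv_pow, Real.norm_of_nonneg (Real.sqrt_nonneg _),
      Real.sq_sqrt (mul_pos Real.pi_pos h1).le, specDensity, smul_eq_mul]
    have := Real.pi_pos
    field_simp
  simp_rw [e]
  refine h2.bdd_mul (c := 2) (by have := continuous_specValue; fun_prop) (ae_of_all _ fun τ => ?_)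
  have hs := specValue_mem τ
  rw [Real.norm_of_nonneg (by linarith [hs.1])]
  linarith [hs.2]

/-- In the parameter `τ` the kernel `q(·, x)` and the weight of `bandPreimage` cancel exactly. -/
theorem specDensity_smul_kernelQ_bandPreimage (φ : ℝ → ℂ) {x : ℝ} (hx : 0 < x) (τ : ℝ) :
    specDensity τ • (kernelQ (specValue τ) x * bandPreimage φ (specValue τ)) =
      conj (𝓕 (bandWave φ) τ) * 𝓕 (realWave x) τ := by
  have hs := specValue_mem τ
  have h1 : 0 < 1 - specValue τ := sub_pos.2 hs.2
  have key : specDensity τ * (2 * √Real.pi * (specValue τ * √(1 - specValue τ)))⁻¹ *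
      (√(Real.pi * (1 - specValue τ)))⁻¹ = 1 := by
    have p1 := Real.sqrt_pos.2 h1
    have p2 := Real.sqrt_pos.2 Real.pi_pos
    have := hs.1
    have s1 := Real.sq_sqrt h1.le
    have s2 := Real.sq_sqrt Real.pi_pos.le
    rw [specDensity, Real.sqrt_mul Real.pi_pos.le]
    field_simp
    rw [s1, s2]
  rw [kernelQ_eq hs hx, expParam_specValue, bandPreimage, expParam_specValue, Complex.real_smul]
  have key' := congrArg (fun r : ℝ => (r : ℂ)) key
  push_cast at key' ⊢
  linear_combination conj (𝓕 (bandWave φ) τ) * 𝓕 (realWave x) τ * key'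

theorem realWave_eq_bandWave (x : ℝ) :
    realWave x = bandWave fun t => Complex.exp (Complex.I * x * t) := by
  ext v
  rw [realWave_eq, bandWave, ← Complex.exp_conj]
  simp only [map_mul, Complex.conj_I, Complex.conj_ofReal]
  ring_nf

theorem isBoundedSymbol_exp (x : ℝ) :
    IsBoundedSymbol fun t : ℝ => Complex.exp (Complex.I * x * t) := by
  refine ⟨by fun_prop, 1, fun t => ?_⟩
  have h : Complex.I * x * t = ((x * t : ℝ) : ℂ) * Complex.I := by push_cast; ring
  simp only [h, Complex.norm_exp_ofReal_mul_I, le_refl]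

theorem memLp_realWave (x : ℝ) : MemLp (realWave x) 2 := by
  rw [realWave_eq_bandWave]
  exact (isBoundedSymbol_exp x).memLp_bandWave

theorem IsBoundedSymbol.integrableOn_kernelQ_mul {φ : ℝ → ℂ} (hφ : IsBoundedSymbol φ) {x : ℝ}
    (hx : 0 < x) : IntegrableOn (fun s => kernelQ s x * bandPreimage φ s) (Ioo 0 1) := by
  rw [integrableOn_unit_iff_integrable_specValue]
  simp_rw [specDensity_smul_kernelQ_bandPreimage φ hx]
  have h1 := memLp_fourier hφ.integrable_bandWave hφ.memLp_bandWave
  have h2 := memLp_fourier (integrable_realWave x) (memLp_realWave x)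
  exact h1.star.integrable_mul h2

/-- The range of the transform contains the Fourier transforms of all bounded functions on
`(-1, 1)`, by Parseval's identity in the parameter `τ`. -/
theorem IsBoundedSymbol.coeFn_spectralIsometry {φ : ℝ → ℂ} (hφ : IsBoundedSymbol φ) :
    spectralIsometry hφ.memLp_bandPreimage.toLp =ᵐ[volume.restrict (Ioi (0 : ℝ))] fun x =>
      (1 / Real.pi : ℝ) * ∫ t in (-1 : ℝ)..1, Complex.exp (-(Complex.I * x * t)) * φ t := by
  refine (coeFn_spectralIsometry_toLp hφ.memLp_bandPreimage fun x hx =>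
    hφ.integrableOn_kernelQ_mul hx).trans ?_
  filter_upwards [ae_restrict_mem measurableSet_Ioi] with x hx
  rw [kernelTransform, integral_unit_eq_integral_specValue]
  simp_rw [specDensity_smul_kernelQ_bandPreimage φ hx]
  rw [integral_conj_fourier_mul_fourier hφ.integrable_bandWave hφ.memLp_bandWave
    (integrable_realWave x) (memLp_realWave x), ← integral_comp_tanh]
  refine integral_congr_ae (ae_of_all _ fun v => ?_)
  simp only [realWave_eq, bandWave, map_mul, Complex.conj_conj, Complex.conj_ofReal]
  push_cast
  ring

/-! ### The sinc kernel -/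

theorem integral_exp_eq_sinc (c : ℝ) :
    ∫ t in (-1 : ℝ)..1, Complex.exp (-(Complex.I * c * t)) = (2 * Real.sinc c : ℝ) := by
  rcases eq_or_ne c 0 with rfl | hc
  · norm_num
  · have hc' : -(Complex.I * c) ≠ 0 := by simpa using hc
    simp_rw [← neg_mul]
    rw [neg_mul, integral_exp_mul_complex hc', Real.sinc_of_ne_zero hc]
    push_cast
    rw [Complex.sin]
    have hc2 : (c : ℂ) ≠ 0 := by exact_mod_cast hc
    field_simp
    rw [show Complex.I * (c : ℂ) = c * Complex.I by ring]
    ring_nf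
    rw [Complex.I_sq]
    ring_nf

/-- The preimage under `V` of `(2/π) sinc(· - y)`. -/
def sincPreimage (y : ℝ) : L2On (Ioo 0 1) := (isBoundedSymbol_exp y).memLp_bandPreimage.toLp

theorem coeFn_spectralIsometry_sincPreimage (y : ℝ) :
    spectralIsometry (sincPreimage y) =ᵐ[volume.restrict (Ioi (0 : ℝ))] fun x =>
      ((2 * (1 / Real.pi * Real.sinc (x - y)) : ℝ) : ℂ) := by
  refine (isBoundedSymbol_exp y).coeFn_spectralIsometry.trans (ae_of_all _ fun x => ?_)
  have h : ∀ t : ℝ, Complex.exp (-(Complex.I * x * t)) * Complex.exp (Complex.I * y * t) =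
      Complex.exp (-(Complex.I * (x - y : ℝ) * t)) := by
    intro t
    rw [← Complex.exp_add]
    congr 1
    push_cast
    ring
  simp only [h, integral_exp_eq_sinc]
  push_cast
  ring

theorem conj_coeFn_spectralIsometry_sincPreimage (x : ℝ) :
    (fun y => (1 / 2 : ℂ) * conj (spectralIsometry (sincPreimage x) y))
      =ᵐ[volume.restrict (Ioi (0 : ℝ))] fun y => ((1 / Real.pi * Real.sinc (x - y) : ℝ) : ℂ) := by
  filter_upwards [coeFn_spectralIsometry_sincPreimage x] with y hy
  rw [hy, Complex.conj_ofReal, ← neg_sub x y, Real.sinc_neg]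
  push_cast
  ring

theorem integrableOn_sinc_mul (g : L2On (Ioi 0)) (x : ℝ) :
    IntegrableOn (fun y : ℝ => ((1 / Real.pi * Real.sinc (x - y) : ℝ) : ℂ) * g y) (Ioi 0) := by
  have h1 : Integrable (fun y => conj (spectralIsometry (sincPreimage x) y) * g y)
      (volume.restrict (Ioi (0 : ℝ))) :=
    (Lp.memLp (spectralIsometry (sincPreimage x))).star.integrable_mul (Lp.memLp g)
  refine (h1.const_mul (1 / 2)).congr ?_
  filter_upwards [conj_coeFn_spectralIsometry_sincPreimage x] with y hy
  rw [← hy]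
  ring

theorem integral_sinc_mul (g : L2On (Ioi 0)) (x : ℝ) :
    ∫ y in Ioi (0 : ℝ), ((1 / Real.pi * Real.sinc (x - y) : ℝ) : ℂ) * g y =
      1 / 2 * ⟪spectralIsometry (sincPreimage x), g⟫_ℂ := by
  rw [L2.inner_def, ← integral_const_mul]
  refine integral_congr_ae ?_
  filter_upwards [conj_coeFn_spectralIsometry_sincPreimage x] with y hy
  rw [← hy, RCLike.inner_apply]
  ring

/-- The form in which the `q(s, ·)` are generalized eigenfunctions: as a function of `s`, the
conjugate of `s q(s, x)` is the preimage under `V` of the sinc kernel `π⁻¹ sinc(· - x)`. -/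
theorem kernelQ_mul_eq_conj_bandPreimage {s x : ℝ} (hs : s ∈ Ioo (0 : ℝ) 1) (hx : 0 < x) :
    kernelQ s x * s =
      1 / 2 * conj (bandPreimage (fun t => Complex.exp (Complex.I * x * t)) s) := by
  have h1 : 0 < 1 - s := sub_pos.2 hs.2
  rw [kernelQ_eq hs hx, bandPreimage, ← realWave_eq_bandWave, map_mul, Complex.conj_conj,
    Complex.conj_ofReal]
  have key : (2 * √Real.pi * (s * √(1 - s)))⁻¹ * s = 1 / 2 * (√(Real.pi * (1 - s)))⁻¹ := by
    have p1 := Real.sqrt_pos.2 h1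
    have p2 := Real.sqrt_pos.2 Real.pi_pos
    have := hs.1
    rw [Real.sqrt_mul Real.pi_pos.le]
    field_simp
  have key' := congrArg (fun r : ℝ => (r : ℂ)) key
  push_cast at key' ⊢
  linear_combination 𝓕 (realWave x) (expParam s) * key'

/-- The transform turns multiplication by `s` into the integral operator with sinc kernel. -/
theorem coeFn_spectralIsometry_mulId (h : L2On (Ioo 0 1)) :
    ∀ᵐ x ∂(volume.restrict (Ioi (0 : ℝ))), spectralIsometry (mulId h) x =
      ∫ y in Ioi (0 : ℝ), ((1 / Real.pi * Real.sinc (x - y) : ℝ) : ℂ) * spectralIsometry h y := by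
  have hae : ∀ x > 0, (fun s => kernelQ s x * mulId h s) =ᵐ[volume.restrict (Ioo (0 : ℝ) 1)]
      fun s => (1 / 2 : ℂ) * (conj (sincPreimage x s) * h s) := by
    intro x hx
    filter_upwards [mulOp_coeFn _ memLp_id_unit h, ae_restrict_mem measurableSet_Ioo,
      (isBoundedSymbol_exp x).memLp_bandPreimage.coeFn_toLp] with s h1 hs h2
    rw [mulId, h1, sincPreimage, h2, ← mul_assoc, kernelQ_mul_eq_conj_bandPreimage hs hx, mul_assoc]
  have hint : ∀ x > 0, IntegrableOn (fun s => kernelQ s x * mulId h s) (Ioo 0 1) := by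
    intro x hx
    have h1 : Integrable (fun s => conj (sincPreimage x s) * h s)
        (volume.restrict (Ioo (0 : ℝ) 1)) :=
      (Lp.memLp (sincPreimage x)).star.integrable_mul (Lp.memLp h)
    exact (h1.const_mul (1 / 2)).congr (hae x hx).symm
  filter_upwards [coeFn_spectralIsometry _ hint, ae_restrict_mem measurableSet_Ioi] with x h1 hx
  rw [h1, integral_sinc_mul, spectralIsometry.inner_map_map, L2.inner_def, kernelTransform,
    integral_congr_ae (hae x hx), integral_const_mul]
  simp only [RCLike.inner_apply, mul_comm]

/-! ### A uniqueness theorem for Fourier transforms of functions on a half line -/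

/-- For `Re u ∈ [0, 1]` the point `tanh(iπu/4)` lies in the upper half of the closed unit disc; the
line `Re u = 0` is mapped to the diameter `(-1, 1)`. -/
def halfDiscMap (u : ℂ) : ℂ := Complex.tanh (Real.pi / 4 * Complex.I * u)

theorem halfDiscMap_arg (u : ℂ) : Real.pi / 4 * Complex.I * u =
    ((-(Real.pi / 4 * u.im) : ℝ) : ℂ) - ((-(Real.pi / 4 * u.re) : ℝ) : ℂ) * Complex.I := by
  apply Complex.ext <;> simp

theorem halfDiscMap_denom_pos {u : ℂ} (h0 : 0 ≤ u.re) (h1 : u.re ≤ 1) :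
    0 < Real.cosh (2 * -(Real.pi / 4 * u.im)) + Real.cos (2 * -(Real.pi / 4 * u.re)) := by
  have h2 : 0 ≤ Real.cos (2 * -(Real.pi / 4 * u.re)) := by
    have := Real.pi_pos
    refine Real.cos_nonneg_of_neg_pi_div_two_le_of_le ?_ ?_ <;> nlinarith
  have := Real.cosh_pos (2 * -(Real.pi / 4 * u.im))
  linarith

theorem im_halfDiscMap {u : ℂ} (h0 : 0 ≤ u.re) (h1 : u.re ≤ 1) :
    (halfDiscMap u).im = Real.sin (Real.pi / 2 * u.re) /
      (Real.cosh (2 * -(Real.pi / 4 * u.im)) + Real.cos (2 * -(Real.pi / 4 * u.re))) := by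
  rw [halfDiscMap, halfDiscMap_arg, im_tanh_strip (halfDiscMap_denom_pos h0 h1), ← neg_div,
    ← Real.sin_neg]
  congr 2
  ring

theorem im_halfDiscMap_nonneg {u : ℂ} (h0 : 0 ≤ u.re) (h1 : u.re ≤ 1) :
    0 ≤ (halfDiscMap u).im := by
  rw [im_halfDiscMap h0 h1]
  have := Real.pi_pos
  exact div_nonneg (Real.sin_nonneg_of_nonneg_of_le_pi (by positivity) (by nlinarith))
    (halfDiscMap_denom_pos h0 h1).le

theorem im_halfDiscMap_pos {u : ℂ} (h0 : 0 < u.re) (h1 : u.re ≤ 1) : 0 < (halfDiscMap u).im := by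
  rw [im_halfDiscMap h0.le h1]
  have := Real.pi_pos
  exact div_pos (Real.sin_pos_of_pos_of_lt_pi (by positivity) (by nlinarith))
    (halfDiscMap_denom_pos h0.le h1)

theorem differentiableAt_halfDiscMap {u : ℂ} (h0 : 0 ≤ u.re) (h1 : u.re ≤ 1) :
    DifferentiableAt ℂ halfDiscMap u := by
  have h := cosh_strip_ne_zero (halfDiscMap_denom_pos h0 h1)
  rw [← halfDiscMap_arg] at h
  unfold halfDiscMap
  simp_rw [Complex.tanh_eq_sinh_div_cosh]
  fun_prop (disch := exact h)

/-- A bounded holomorphic function on the upper half plane whose boundary values vanish on an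
interval vanishes identically. On the half disc over the interval this is the three lines theorem,
transplanted by `halfDiscMap`. -/
theorem eq_zero_of_vanishing_on_interval {f : ℂ → ℂ} (hc : ContinuousOn f {z | 0 ≤ z.im})
    (hd : DifferentiableOn ℂ f {z | 0 < z.im}) {C : ℝ} (hC : ∀ z, 0 ≤ z.im → ‖f z‖ ≤ C) {c r : ℝ}
    (hr : 0 < r) (h0 : ∀ t ∈ Ioo (c - r) (c + r), f (t : ℝ) = 0) {z : ℂ} (hz : 0 ≤ z.im) :
    f z = 0 := by
  set φ : ℂ → ℂ := fun u => c + r * halfDiscMap u with hφ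
  have him : ∀ u, (φ u).im = r * (halfDiscMap u).im := fun u => by simp [hφ]
  have hφc : ∀ u : ℂ, 0 ≤ u.re → u.re ≤ 1 → DifferentiableAt ℂ φ u := fun u hu0 hu1 =>
    ((differentiableAt_halfDiscMap hu0 hu1).const_mul _).const_add _
  have hmaps : ∀ u : ℂ, 0 ≤ u.re → u.re ≤ 1 → 0 ≤ (φ u).im := fun u hu0 hu1 => by
    rw [him]
    exact mul_nonneg hr.le (im_halfDiscMap_nonneg hu0 hu1)
  have hmaps' : ∀ u : ℂ, 0 < u.re → u.re ≤ 1 → 0 < (φ u).im := fun u hu0 hu1 => by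
    rw [him]
    exact mul_pos hr (im_halfDiscMap_pos hu0 hu1)
  have hstrip : DiffContOnCl ℂ (f ∘ φ) (Complex.HadamardThreeLines.verticalStrip 0 1) := by
    refine ⟨hd.comp (fun u hu => (hφc u hu.1.le hu.2.le).differentiableWithinAt) fun u hu =>
      hmaps' u hu.1 hu.2.le, ?_⟩
    have hcl : closure (Complex.HadamardThreeLines.verticalStrip 0 1) ⊆
        Complex.HadamardThreeLines.verticalClosedStrip 0 1 :=
      closure_minimal (fun u hu => ⟨hu.1.le, hu.2.le⟩) (isClosed_Icc.preimage Complex.continuous_re)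
    refine ContinuousOn.mono ?_ hcl
    exact hc.comp (fun u hu => (hφc u hu.1 hu.2).continuousAt.continuousWithinAt) fun u hu =>
      hmaps u hu.1 hu.2
  -- The three lines theorem with the bound `0` on the line that is mapped to the interval.
  have hzero : ∀ t : ℝ, 0 < t → t < 1 → f (φ t) = 0 := by
    intro t ht0 ht1
    have h1 := Complex.HadamardThreeLines.norm_le_interp_of_mem_verticalClosedStrip₀₁' (f ∘ φ)
      (z := (t : ℂ)) (a := 0) (b := C) ⟨ht0.le, ht1.le⟩ hstrip
      ⟨C, by
        rintro _ ⟨u, hu, rfl⟩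
        exact hC _ (hmaps u hu.1 hu.2)⟩
      (fun u hu => by
        have hu0 : u.re = 0 := hu
        have e : φ u = ((c + r * Real.tanh (-(Real.pi / 4 * u.im)) : ℝ) : ℂ) := by
          rw [hφ]
          simp only [halfDiscMap]
          rw [halfDiscMap_arg, hu0]
          push_cast
          simp
        have ht := Real.neg_one_lt_tanh (-(Real.pi / 4 * u.im))
        have ht' := Real.tanh_lt_one (-(Real.pi / 4 * u.im))
        rw [Function.comp_apply, e, h0 _ ⟨by nlinarith, by nlinarith⟩, norm_zero])
      (fun u hu => hC _ (hmaps u (by rw [show u.re = 1 from hu]; norm_num)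
        (by rw [show u.re = 1 from hu])))
    rw [Complex.ofReal_re, Real.zero_rpow (by linarith), zero_mul] at h1
    exact norm_le_zero_iff.1 h1
  have hopen : IsOpen {z : ℂ | 0 < z.im} := isOpen_lt continuous_const Complex.continuous_im
  have hupper : EqOn f 0 {z : ℂ | 0 < z.im} := by
    refine (hd.analyticOnNhd hopen).eqOn_zero_of_preconnected_of_frequently_eq_zero
      (convex_halfSpace_im_gt 0).isPreconnected
      (hmaps' ((1 / 2 : ℝ) : ℂ) (by norm_num) (by norm_num)) ?_
    -- The zeros `φ t = c + i r tan(πt/4)` accumulate at `φ (1/2)`.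
    have htend : Tendsto (fun t : ℝ => φ t) (𝓝[>] (1 / 2 : ℝ)) (𝓝[≠] (φ ((1 / 2 : ℝ) : ℂ))) := by
      refine tendsto_nhdsWithin_iff.2 ⟨?_, ?_⟩
      · have h1 : ContinuousAt (fun t : ℝ => φ t) (1 / 2) :=
          ContinuousAt.comp (f := fun t : ℝ => (t : ℂ))
            (hφc _ (by norm_num) (by norm_num)).continuousAt Complex.continuous_ofReal.continuousAt
        exact h1.tendsto.mono_left nhdsWithin_le_nhds
      · filter_upwards [Ioo_mem_nhdsGT (by norm_num : (1 / 2 : ℝ) < 1)] with t ht heq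
        have e : ∀ t : ℝ, φ t = c + r * ((Real.tan (Real.pi / 4 * t) : ℝ) * Complex.I) := by
          intro t
          rw [hφ]
          simp only [halfDiscMap]
          rw [show (Real.pi / 4 * Complex.I * t : ℂ) = ((Real.pi / 4 * t : ℝ) : ℂ) * Complex.I by
            push_cast; ring, Complex.tanh_mul_I, Complex.ofReal_tan]
        have hpi := Real.pi_pos
        have h2 : Real.tan (Real.pi / 4 * (1 / 2)) < Real.tan (Real.pi / 4 * t) :=
          Real.tan_lt_tan_of_lt_of_lt_pi_div_two (by nlinarith) (by nlinarith [ht.2])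
            (by nlinarith [ht.1])
        rw [mem_singleton_iff, e, e] at heq
        have h3 := congrArg Complex.im heq
        simp only [Complex.add_im, Complex.ofReal_im, Complex.im_ofReal_mul, Complex.I_im,
          zero_add, mul_one] at h3
        have h4 := mul_left_cancel₀ hr.ne' h3
        linarith
    have hev : ∀ᶠ t : ℝ in 𝓝[>] (1 / 2 : ℝ), f (φ t) = 0 := by
      filter_upwards [Ioo_mem_nhdsGT (by norm_num : (1 / 2 : ℝ) < 1)] with t ht
      exact hzero t (by linarith [ht.1]) ht.2
    exact htend.frequently hev.frequently
  have hlim : Tendsto (fun ε : ℝ => z + ε * Complex.I) (𝓝[>] 0) (𝓝[{z | 0 ≤ z.im}] z) := by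
    refine tendsto_nhdsWithin_iff.2 ⟨?_, ?_⟩
    · have h1 : Continuous fun ε : ℝ => z + ε * Complex.I := by fun_prop
      have h2 := h1.tendsto 0
      simp only [Complex.ofReal_zero, zero_mul, add_zero] at h2
      exact h2.mono_left nhdsWithin_le_nhds
    · filter_upwards [self_mem_nhdsWithin] with ε hε
      have : (0 : ℝ) < ε := hε
      simp only [Complex.add_im, Complex.mul_I_im, Complex.ofReal_re]
      linarith
  have h1 : Tendsto (fun ε : ℝ => f (z + ε * Complex.I)) (𝓝[>] 0) (𝓝 (f z)) :=
    (hc z hz).tendsto.comp hlim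
  refine tendsto_nhds_unique (h1.congr' ?_) (tendsto_const_nhds (x := (0 : ℂ)))
  filter_upwards [self_mem_nhdsWithin] with ε hε
  have : (0 : ℝ) < ε := hε
  refine hupper ?_
  simp only [mem_ofPred_eq, Complex.add_im, Complex.mul_I_im, Complex.ofReal_re]
  linarith

/-- The integral `∫₀^∞ e^{ixζ} G(x) dx`, for `Im ζ ≥ 0`. -/
def halfLineTransform (G : ℝ → ℂ) (ζ : ℂ) : ℂ :=
  ∫ x in Ioi (0 : ℝ), Complex.exp (Complex.I * x * ζ) * G x

theorem norm_exp_I_mul (x : ℝ) (ζ : ℂ) :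
    ‖Complex.exp (Complex.I * x * ζ)‖ = Real.exp (-(x * ζ.im)) := by
  rw [Complex.norm_exp, mul_assoc, Complex.I_mul_re, Complex.im_ofReal_mul]

theorem norm_exp_I_mul_le_one {x : ℝ} (hx : 0 < x) {ζ : ℂ} (hζ : 0 ≤ ζ.im) :
    ‖Complex.exp (Complex.I * x * ζ)‖ ≤ 1 := by
  rw [norm_exp_I_mul, Real.exp_le_one_iff]
  have := mul_nonneg hx.le hζ
  linarith

section HalfLine

variable {G : ℝ → ℂ}

theorem aestronglyMeasurable_exp_mul (hG : IntegrableOn G (Ioi 0)) (ζ : ℂ) :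
    AEStronglyMeasurable (fun x : ℝ => Complex.exp (Complex.I * x * ζ) * G x)
      (volume.restrict (Ioi (0 : ℝ))) :=
  (by fun_prop : Continuous fun x : ℝ => Complex.exp (Complex.I * x * ζ)).aestronglyMeasurable.mul
    hG.aestronglyMeasurable

theorem norm_exp_mul_le {x : ℝ} (hx : 0 < x) {ζ : ℂ} (hζ : 0 ≤ ζ.im) :
    ‖Complex.exp (Complex.I * x * ζ) * G x‖ ≤ ‖G x‖ := by
  rw [norm_mul]
  exact mul_le_of_le_one_left (norm_nonneg _) (norm_exp_I_mul_le_one hx hζ)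

theorem integrableOn_exp_mul (hG : IntegrableOn G (Ioi 0)) {ζ : ℂ} (hζ : 0 ≤ ζ.im) :
    IntegrableOn (fun x : ℝ => Complex.exp (Complex.I * x * ζ) * G x) (Ioi 0) := by
  refine hG.norm.mono' (aestronglyMeasurable_exp_mul hG ζ) ?_
  filter_upwards [ae_restrict_mem measurableSet_Ioi] with x hx
  exact norm_exp_mul_le hx hζ

theorem norm_halfLineTransform_le (hG : IntegrableOn G (Ioi 0)) {ζ : ℂ} (hζ : 0 ≤ ζ.im) :
    ‖halfLineTransform G ζ‖ ≤ ∫ x in Ioi (0 : ℝ), ‖G x‖ := by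
  refine norm_integral_le_of_norm_le hG.norm ?_
  filter_upwards [ae_restrict_mem measurableSet_Ioi] with x hx
  exact norm_exp_mul_le hx hζ

theorem continuousOn_halfLineTransform (hG : IntegrableOn G (Ioi 0)) :
    ContinuousOn (halfLineTransform G) {ζ | 0 ≤ ζ.im} := by
  refine continuousOn_of_dominated (bound := fun x => ‖G x‖)
    (fun ζ _ => aestronglyMeasurable_exp_mul hG ζ) (fun ζ hζ => ?_) hG.norm
    (ae_of_all _ fun x => by fun_prop)
  filter_upwards [ae_restrict_mem measurableSet_Ioi] with x hx
  exact norm_exp_mul_le hx hζ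

theorem differentiableOn_halfLineTransform (hG : IntegrableOn G (Ioi 0)) :
    DifferentiableOn ℂ (halfLineTransform G) {ζ | 0 < ζ.im} := by
  intro ζ hζ
  have hζ' : 0 < ζ.im := hζ
  have hs : {w : ℂ | ζ.im / 2 < w.im} ∈ 𝓝 ζ :=
    (isOpen_lt continuous_const Complex.continuous_im).mem_nhds (half_lt_self hζ')
  have h := hasDerivAt_integral_of_dominated_loc_of_deriv_le (𝕜 := ℂ)
    (μ := volume.restrict (Ioi (0 : ℝ))) (x₀ := ζ)
    (F := fun w (x : ℝ) => Complex.exp (Complex.I * x * w) * G x)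
    (F' := fun w (x : ℝ) => Complex.exp (Complex.I * x * w) * (Complex.I * x) * G x)
    (bound := fun x => (ζ.im / 2)⁻¹ * ‖G x‖) hs
    (Eventually.of_forall fun w => aestronglyMeasurable_exp_mul hG w)
    (integrableOn_exp_mul hG hζ'.le)
    ((by fun_prop : Continuous fun x : ℝ => Complex.exp (Complex.I * x * ζ) *
      (Complex.I * x)).aestronglyMeasurable.mul hG.aestronglyMeasurable)
    (by
      filter_upwards [ae_restrict_mem measurableSet_Ioi] with x hx w hw
      have hx0 : (0 : ℝ) < x := hx
      have hw' : ζ.im / 2 < w.im := hw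
      rw [norm_mul, norm_mul, norm_exp_I_mul, norm_mul, Complex.norm_I, one_mul, Complex.norm_real,
        Real.norm_of_nonneg hx0.le]
      gcongr
      -- `y ≤ e^y` at `y = x Im ζ / 2`
      have h1 : x * (ζ.im / 2) ≤ Real.exp (x * w.im) := by
        have h2 := Real.add_one_le_exp (x * w.im)
        nlinarith
      rw [Real.exp_neg, inv_mul_le_iff₀ (Real.exp_pos _), ← div_eq_mul_inv,
        le_div_iff₀ (half_pos hζ')]
      exact h1)
    (hG.norm.const_mul _)
    (ae_of_all _ fun x w _ => by
      have h1 : HasDerivAt (fun w : ℂ => Complex.I * x * w) (Complex.I * x) w := by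
        simpa using (hasDerivAt_id w).const_mul (Complex.I * (x : ℂ))
      exact h1.cexp.mul_const _)
  exact h.2.differentiableAt.differentiableWithinAt

end HalfLine

theorem ae_eq_zero_of_fourier_eq_zero {f : ℝ → ℂ} (hf : Integrable f) (h : ∀ ξ, 𝓕 f ξ = 0) :
    f =ᵐ[volume] 0 := by
  refine ae_eq_zero_of_integral_contDiff_smul_eq_zero hf.locallyIntegrable fun g hg hgs => ?_
  have hgc : ContDiff ℝ (⊤ : ℕ∞) fun x => (g x : ℂ) := Complex.ofRealCLM.contDiff.comp hg
  have hgs' : HasCompactSupport fun x => (g x : ℂ) := hgs.comp_left Complex.ofReal_zero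
  set ψ := hgs'.toSchwartzMap hgc with hψ
  have h1 : 𝓕 (𝓕⁻ ψ : SchwartzMap ℝ ℂ) = ψ := FourierTransform.fourier_fourierInv_eq ψ
  have h2 := integral_fourier_mul_eq_integral_mul_fourier (𝓕⁻ ψ : SchwartzMap ℝ ℂ).integrable hf
  rw [← SchwartzMap.fourier_coe, h1] at h2
  simp only [h, mul_zero, integral_zero] at h2
  simp only [Complex.real_smul]
  exact h2

/-- An integrable function on the half line whose Fourier transform vanishes on an interval
vanishes. -/
theorem ae_eq_zero_of_halfLineTransform_eq_zero {G : ℝ → ℂ} (hG : IntegrableOn G (Ioi 0)) {c r : ℝ}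
    (hr : 0 < r) (h0 : ∀ t ∈ Ioo (c - r) (c + r), halfLineTransform G (t : ℝ) = 0) :
    G =ᵐ[volume.restrict (Ioi (0 : ℝ))] 0 := by
  have h1 : Integrable ((Ioi (0 : ℝ)).indicator G) := (integrable_indicator_iff measurableSet_Ioi).2 hG
  have h2 := ae_eq_zero_of_fourier_eq_zero h1 fun ξ => by
    have h3 := eq_zero_of_vanishing_on_interval (continuousOn_halfLineTransform hG)
      (differentiableOn_halfLineTransform hG) (fun z hz => norm_halfLineTransform_le hG hz) hr h0
      (z := ((-(2 * Real.pi * ξ) : ℝ) : ℂ)) (by rw [Complex.ofReal_im])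
    rw [Real.fourier_real_eq_integral_exp_smul, ← h3, halfLineTransform,
      ← integral_indicator measurableSet_Ioi]
    refine integral_congr_ae (ae_of_all _ fun x => ?_)
    by_cases hx : x ∈ Ioi (0 : ℝ)
    · simp only [indicator_of_mem hx, smul_eq_mul]
      congr 2
      push_cast
      ring
    · simp only [indicator_of_notMem hx, smul_zero]
  filter_upwards [ae_restrict_of_ae h2, ae_restrict_mem measurableSet_Ioi] with x hx hx0
  rwa [indicator_of_mem hx0] at hx

/-! ### Surjectivity of the spectral transform -/

theorem isBoundedSymbol_indicator (a b : ℝ) :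
    IsBoundedSymbol ((Ioc a b).indicator fun _ => (1 : ℂ)) := by
  refine ⟨measurable_const.indicator measurableSet_Ioc, 1, fun t => ?_⟩
  refine (norm_indicator_le_norm_self _ t).trans ?_
  rw [norm_one]

theorem integral_exp_mul_indicator {a b : ℝ} (ha : -1 ≤ a) (hab : a ≤ b) (hb : b ≤ 1) (x : ℝ) :
    ∫ t in (-1 : ℝ)..1, Complex.exp (-(Complex.I * x * t)) *
      (Ioc a b).indicator (fun _ => (1 : ℂ)) t =
      ∫ t in a..b, Complex.exp (-(Complex.I * x * t)) := by
  have e : (fun t : ℝ => Complex.exp (-(Complex.I * x * t)) *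
      (Ioc a b).indicator (fun _ => (1 : ℂ)) t) =
      (Ioc a b).indicator fun t : ℝ => Complex.exp (-(Complex.I * x * t)) := by
    ext t
    by_cases ht : t ∈ Ioc a b
    · simp only [indicator_of_mem ht, mul_one]
    · simp only [indicator_of_notMem ht, mul_zero]
  rw [e, intervalIntegral.integral_of_le (by linarith), intervalIntegral.integral_of_le hab,
    setIntegral_indicator measurableSet_Ioc, inter_eq_right.2 (Ioc_subset_Ioc ha hb)]

/-- Translating the band multiplies the Fourier integral by a character. -/
theorem integral_exp_translate (x c d : ℝ) :
    ∫ t in c..(c + d), Complex.exp (-(Complex.I * x * t)) =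
      Complex.exp (-(Complex.I * x * c)) * ∫ t in (0 : ℝ)..d, Complex.exp (-(Complex.I * x * t)) := by
  rw [← intervalIntegral.integral_const_mul]
  have h := intervalIntegral.integral_comp_add_left (a := 0) (b := d)
    (fun t : ℝ => Complex.exp (-(Complex.I * x * t))) c
  rw [add_zero] at h
  rw [← h]
  refine intervalIntegral.integral_congr fun t _ => ?_
  simp only [← Complex.exp_add]
  congr 1
  push_cast
  ring

theorem ae_integral_exp_ne_zero {d : ℝ} (hd : 0 < d) :
    ∀ᵐ x : ℝ, ∫ t in (0 : ℝ)..d, Complex.exp (-(Complex.I * x * t)) ≠ 0 := by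
  have hcount : (insert 0 (range fun n : ℤ => 2 * Real.pi * n / d)).Countable :=
    (countable_range _).insert _
  filter_upwards [hcount.ae_notMem volume] with x hx h
  rw [mem_insert_iff, not_or] at hx
  have hne : -(Complex.I * x) ≠ 0 := by simpa using hx.1
  simp_rw [← neg_mul] at h
  rw [neg_mul, integral_exp_mul_complex hne, div_eq_zero_iff, or_iff_left hne, Complex.ofReal_zero,
    mul_zero, Complex.exp_zero, sub_eq_zero, Complex.exp_eq_one_iff] at h
  obtain ⟨n, hn⟩ := h
  refine hx.2 ⟨-n, ?_⟩
  have h1 : ((-(x * d) : ℝ) : ℂ) = ((n * (2 * Real.pi) : ℝ) : ℂ) := by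
    have := Complex.I_ne_zero
    apply mul_right_cancel₀ this
    push_cast
    linear_combination hn
  have h2 := Complex.ofReal_injective h1
  simp only [Int.cast_neg]
  rw [div_eq_iff hd.ne']
  linarith

/-- A vector orthogonal to the range of `V` has, after multiplication by the transform of a short
interval, a Fourier transform vanishing on an interval. -/
theorem eq_zero_of_orthogonal_range {g : L2On (Ioi 0)}
    (hg : ∀ h, ⟪spectralIsometry h, g⟫_ℂ = 0) : g = 0 := by
  set k : ℝ → ℂ := fun x => ∫ t in (0 : ℝ)..(1 / 2), Complex.exp (-(Complex.I * x * t)) with hk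
  have hV : ∀ c : ℝ, c ∈ Icc (-1 : ℝ) (1 / 2) →
      spectralIsometry (isBoundedSymbol_indicator c (c + 1 / 2)).memLp_bandPreimage.toLp
        =ᵐ[volume.restrict (Ioi (0 : ℝ))] fun x =>
          (1 / Real.pi : ℝ) * (Complex.exp (-(Complex.I * x * c)) * k x) := by
    intro c hc
    refine (isBoundedSymbol_indicator c (c + 1 / 2)).coeFn_spectralIsometry.trans
      (ae_of_all _ fun x => ?_)
    simp only [hk]
    rw [integral_exp_mul_indicator hc.1 (by linarith) (by linarith [hc.2]), integral_exp_translate]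
  have hpi : (Real.pi : ℂ) ≠ 0 := by exact_mod_cast Real.pi_ne_zero
  have hG : IntegrableOn (fun x => conj (k x) * g x) (Ioi 0) := by
    have h1 : Integrable (fun x => conj (spectralIsometry
        (isBoundedSymbol_indicator 0 (0 + 1 / 2)).memLp_bandPreimage.toLp x) * g x)
        (volume.restrict (Ioi (0 : ℝ))) :=
      (Lp.memLp (spectralIsometry _)).star.integrable_mul (Lp.memLp g)
    refine (h1.const_mul (Real.pi : ℂ)).congr ?_
    filter_upwards [hV 0 (by norm_num)] with x hx
    rw [hx]
    simp only [Complex.ofReal_zero, mul_zero, neg_zero, Complex.exp_zero, one_mul, map_mul,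
      Complex.conj_ofReal]
    push_cast
    field_simp
  -- For `|t| < 1/2` the interval `(t, t + 1/2]` is contained in the band `[-1, 1]`.
  have hzero := ae_eq_zero_of_halfLineTransform_eq_zero hG (c := 0) (r := 1 / 2) (by norm_num)
    fun t ht => by
      have h1 := hg (isBoundedSymbol_indicator t (t + 1 / 2)).memLp_bandPreimage.toLp
      rw [L2.inner_def] at h1
      have h2 : ∫ x in Ioi (0 : ℝ), inner ℂ (spectralIsometry
          (isBoundedSymbol_indicator t (t + 1 / 2)).memLp_bandPreimage.toLp x) (g x) =
          (1 / Real.pi : ℝ) * halfLineTransform (fun x => conj (k x) * g x) t := by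
        rw [halfLineTransform, ← integral_const_mul]
        refine integral_congr_ae ?_
        filter_upwards [hV t ⟨by linarith [ht.1], by linarith [ht.2]⟩] with x hx
        rw [hx, RCLike.inner_apply]
        simp only [map_mul, Complex.conj_ofReal, ← Complex.exp_conj, map_neg, Complex.conj_I]
        ring_nf
      rw [h2] at h1
      refine (mul_eq_zero.1 h1).resolve_left ?_
      exact_mod_cast (one_div_pos.2 Real.pi_pos).ne'
  refine Lp.ext ?_
  filter_upwards [hzero, ae_restrict_of_ae (ae_integral_exp_ne_zero (d := 1 / 2) (by norm_num)),
    Lp.coeFn_zero ℂ 2 (volume.restrict (Ioi (0 : ℝ)))] with x h1 h2 h3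
  rw [h3]
  exact (mul_eq_zero.1 h1).resolve_left ((map_ne_zero _).2 h2)

theorem surjective_spectralIsometry : Function.Surjective spectralIsometry := by
  set R : Submodule ℂ (L2On (Ioi 0)) := LinearMap.range spectralIsometry.toLinearMap
  have hclosed : IsClosed (R : Set (L2On (Ioi 0))) :=
    spectralIsometry.isometry.isClosedEmbedding.isClosed_range
  have : CompleteSpace R := hclosed.completeSpace_coe
  have h1 : Rᗮ = ⊥ := by
    refine (Submodule.eq_bot_iff _).2 fun g hg => eq_zero_of_orthogonal_range fun h => ?_
    exact (Submodule.mem_orthogonal R g).1 hg _ ⟨h, rfl⟩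
  exact LinearMap.range_eq_top.1 (Submodule.orthogonal_eq_bot_iff.1 h1)

/-- The transform `V : L²(0, 1) → L²(ℝ₊)` as a unitary operator. -/
def spectralUnitary : L2On (Ioo 0 1) ≃ₗᵢ[ℂ] L2On (Ioi 0) :=
  LinearIsometryEquiv.ofSurjective spectralIsometry surjective_spectralIsometry

theorem coe_spectralUnitary : ⇑spectralUnitary = spectralIsometry :=
  LinearIsometryEquiv.coe_ofSurjective _ _

/-! ### Multiplication operators and their spectral theory -/

section MulOp

variable {α : Type*} [MeasurableSpace α] {μ : Measure α}

theorem isSelfAdjoint_mulOp {κ : α → ℂ} (hκ : MemLp κ ∞ μ) (hreal : ∀ x, conj (κ x) = κ x) :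
    IsSelfAdjoint (mulOp κ hκ) := by
  rw [ContinuousLinearMap.isSelfAdjoint_iff_isSymmetric]
  intro f g
  change ⟪mulOp κ hκ f, g⟫_ℂ = ⟪f, mulOp κ hκ g⟫_ℂ
  rw [L2.inner_def, L2.inner_def]
  refine integral_congr_ae ?_
  filter_upwards [mulOp_coeFn κ hκ f, mulOp_coeFn κ hκ g] with x h1 h2
  rw [h1, h2, RCLike.inner_apply, RCLike.inner_apply, map_mul, hreal]
  ring

end MulOp

theorem isSelfAdjoint_mulId : IsSelfAdjoint mulId :=
  isSelfAdjoint_mulOp _ fun s => Complex.conj_ofReal s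

theorem smul_sub_mulId_coeFn (l : ℂ) (f : L2On (Ioo 0 1)) :
    (algebraMap ℂ (L2On (Ioo 0 1) →L[ℂ] L2On (Ioo 0 1)) l - mulId) f
      =ᵐ[volume.restrict (Ioo (0 : ℝ) 1)] fun s => (l - s) * f s := by
  have h : (algebraMap ℂ (L2On (Ioo 0 1) →L[ℂ] L2On (Ioo 0 1)) l - mulId) f = l • f - mulId f := by
    rw [Algebra.algebraMap_eq_smul_one]
    rfl
  rw [h]
  filter_upwards [Lp.coeFn_sub (l • f) (mulId f), Lp.coeFn_smul l f,
    mulOp_coeFn _ memLp_id_unit f] with s h1 h2 h3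
  rw [h1, Pi.sub_apply, h2, Pi.smul_apply, mulId, h3, smul_eq_mul, sub_mul]

/-- Off `[0, 1]` the resolvent is multiplication by the bounded function `(l - s)⁻¹`. -/
theorem isUnit_smul_sub_mulId {l : ℂ} (hl : l ∉ Complex.ofReal '' Icc (0 : ℝ) 1) :
    IsUnit (algebraMap ℂ (L2On (Ioo 0 1) →L[ℂ] L2On (Ioo 0 1)) l - mulId) := by
  have hclosed : IsClosed (Complex.ofReal '' Icc (0 : ℝ) 1) :=
    (isCompact_Icc.image Complex.continuous_ofReal).isClosed
  obtain ⟨δ, hδ, hball⟩ := Metric.isOpen_iff.1 hclosed.isOpen_compl l hl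
  have hdist : ∀ s ∈ Ioo (0 : ℝ) 1, δ ≤ ‖l - s‖ := by
    intro s hs
    by_contra hlt
    have hmem : (s : ℂ) ∈ Metric.ball l δ := by
      rw [Metric.mem_ball, dist_comm, dist_eq_norm]
      exact not_le.1 hlt
    exact hball hmem ⟨s, ⟨hs.1.le, hs.2.le⟩, rfl⟩
  have hκ : MemLp (fun s : ℝ => (l - s)⁻¹) ∞ (volume.restrict (Ioo (0 : ℝ) 1)) := by
    refine memLp_top_of_bound (by fun_prop : Measurable fun s : ℝ =>
      (l - s)⁻¹).aestronglyMeasurable δ⁻¹ ?_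
    filter_upwards [ae_restrict_mem measurableSet_Ioo] with s hs
    rw [norm_inv]
    exact inv_anti₀ hδ (hdist s hs)
  have hne : ∀ s ∈ Ioo (0 : ℝ) 1, l - s ≠ 0 := fun s hs =>
    norm_pos_iff.1 (hδ.trans_le (hdist s hs))
  refine ⟨⟨_, mulOp _ hκ, ?_, ?_⟩, rfl⟩
  · refine ContinuousLinearMap.ext fun f => Lp.ext ?_
    rw [mul_apply_eq_comp]
    filter_upwards [smul_sub_mulId_coeFn l (mulOp _ hκ f), mulOp_coeFn _ hκ f,
      ae_restrict_mem measurableSet_Ioo] with s h1 h2 hs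
    rw [h1, h2, mul_inv_cancel_left₀ (hne s hs)]
    rfl
  · refine ContinuousLinearMap.ext fun f => Lp.ext ?_
    rw [mul_apply_eq_comp]
    filter_upwards [mulOp_coeFn _ hκ ((algebraMap ℂ (L2On (Ioo 0 1) →L[ℂ] L2On (Ioo 0 1)) l -
      mulId) f), smul_sub_mulId_coeFn l f, ae_restrict_mem measurableSet_Ioo] with s h1 h2 hs
    rw [h1, h2, inv_mul_cancel_left₀ (hne s hs)]
    rfl

/-- The constant function `1` in `L²(0, 1)`. -/
def unitConst : L2On (Ioo 0 1) := (memLp_const (1 : ℂ)).toLp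

theorem coeFn_unitConst : unitConst =ᵐ[volume.restrict (Ioo (0 : ℝ) 1)] fun _ => (1 : ℂ) :=
  (memLp_const (1 : ℂ)).coeFn_toLp

/-- On `[0, 1]` the constant `1` is not in the range of `l - M`, because `(l - s)⁻¹` is not
integrable. -/
theorem not_isUnit_smul_sub_mulId {l : ℝ} (hl : l ∈ Icc (0 : ℝ) 1) :
    ¬ IsUnit (algebraMap ℂ (L2On (Ioo 0 1) →L[ℂ] L2On (Ioo 0 1)) l - mulId) := by
  intro hunit
  obtain ⟨B, hB⟩ := hunit.exists_right_inv
  have h1 : (algebraMap ℂ (L2On (Ioo 0 1) →L[ℂ] L2On (Ioo 0 1)) l - mulId) (B unitConst) =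
      unitConst :=
    congrArg (fun A : L2On (Ioo 0 1) →L[ℂ] L2On (Ioo 0 1) => A unitConst) hB
  have hint : Integrable (B unitConst) (volume.restrict (Ioo (0 : ℝ) 1)) :=
    (Lp.memLp (B unitConst)).integrable one_le_two
  have h2 : Integrable (fun s : ℝ => (s - l)⁻¹) (volume.restrict (Ioo (0 : ℝ) 1)) := by
    refine hint.neg.re.congr ?_
    have h3 := smul_sub_mulId_coeFn l (B unitConst)
    rw [h1] at h3
    have h4 : ∀ᵐ s ∂(volume.restrict (Ioo (0 : ℝ) 1)), s ≠ l :=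
      ae_restrict_of_ae (by simp [ae_iff])
    filter_upwards [h3, coeFn_unitConst, h4] with s e1 e2 e3
    have hne : (l : ℂ) - s ≠ 0 := by
      rw [sub_ne_zero]
      exact_mod_cast e3.symm
    have e4 : -(B unitConst s) = (((s - l)⁻¹ : ℝ) : ℂ) := by
      rw [e2] at e1
      rw [eq_comm, ← mul_right_inj' hne, mul_neg, ← e1]
      have hne' : (s : ℂ) - l ≠ 0 := by
        rw [sub_ne_zero]
        exact_mod_cast e3
      push_cast
      field_simp
      ring
    rw [Pi.neg_apply, e4]
    exact Complex.ofReal_re _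
  have h5 : IntervalIntegrable (fun s : ℝ => (s - l)⁻¹) volume 0 1 := by
    rw [intervalIntegrable_iff_integrableOn_Ioo_of_le zero_le_one]
    exact h2
  rw [intervalIntegrable_sub_inv_iff, uIcc_of_le zero_le_one] at h5
  exact h5.elim zero_ne_one fun h => h hl

theorem spectrum_mulId : spectrum ℂ mulId = Complex.ofReal '' Icc (0 : ℝ) 1 := by
  ext l
  rw [spectrum.mem_iff]
  constructor
  · intro h
    by_contra hl
    exact h (isUnit_smul_sub_mulId hl)
  · rintro ⟨t, ht, rfl⟩
    exact not_isUnit_smul_sub_mulId ht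

theorem mulId_pow_unitConst_coeFn (n : ℕ) :
    (mulId ^ n) unitConst =ᵐ[volume.restrict (Ioo (0 : ℝ) 1)] fun s => (s : ℂ) ^ n := by
  induction n with
  | zero => simpa using coeFn_unitConst
  | succ n ih =>
    rw [pow_succ', mul_apply_eq_comp]
    filter_upwards [mulOp_coeFn _ memLp_id_unit ((mulId ^ n) unitConst), ih] with s h1 h2
    nth_rewrite 1 [mulId]
    rw [h1, h2, pow_succ']

/-- A function on `(0, 1)` is determined by its moments, by the Weierstrass theorem. -/
theorem ae_eq_zero_of_moments_eq_zero {f : ℝ → ℂ} (hf : IntegrableOn f (Ioo 0 1))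
    (hm : ∀ n : ℕ, ∫ s in Ioo (0 : ℝ) 1, (s : ℂ) ^ n * f s = 0) :
    f =ᵐ[volume.restrict (Ioo (0 : ℝ) 1)] 0 := by
  have hbdd : ∀ g : ℝ → ℝ, Continuous g →
      IntegrableOn (fun s => (g s : ℂ) * f s) (Ioo 0 1) := by
    intro g hg
    obtain ⟨C, hC⟩ := isCompact_Icc.exists_bound_of_continuousOn (s := Icc (0 : ℝ) 1) hg.continuousOn
    refine hf.bdd_mul (c := C) (Complex.continuous_ofReal.comp hg).aestronglyMeasurable ?_
    filter_upwards [ae_restrict_mem measurableSet_Ioo] with s hs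
    rw [Complex.norm_real]
    exact hC s ⟨hs.1.le, hs.2.le⟩
  have hpoly : ∀ p : Polynomial ℝ, ∫ s in Ioo (0 : ℝ) 1, ((p.eval s : ℝ) : ℂ) * f s = 0 := by
    intro p
    have e : ∀ s : ℝ, ((p.eval s : ℝ) : ℂ) * f s =
        ∑ n ∈ Finset.range (p.natDegree + 1), (p.coeff n : ℂ) * ((s : ℂ) ^ n * f s) := by
      intro s
      rw [Polynomial.eval_eq_sum_range]
      push_cast
      rw [Finset.sum_mul]
      simp only [mul_assoc]
    simp_rw [e]
    rw [integral_finsetSum]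
    · refine Finset.sum_eq_zero fun n _ => ?_
      rw [integral_const_mul, hm, mul_zero]
    · intro n _
      have h1 := hbdd (fun s => s ^ n) (by fun_prop)
      push_cast at h1
      exact h1.const_mul _
  have hcont : ∀ g : ℝ → ℝ, Continuous g → ∫ s in Ioo (0 : ℝ) 1, (g s : ℂ) * f s = 0 := by
    intro g hg
    have hle : ∀ ε > 0, ‖∫ s in Ioo (0 : ℝ) 1, (g s : ℂ) * f s‖ ≤
        ε * ∫ s in Ioo (0 : ℝ) 1, ‖f s‖ := by
      intro ε hε
      obtain ⟨p, hp⟩ := exists_polynomial_near_of_continuousOn 0 1 g hg.continuousOn ε hε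
      rw [← sub_zero (∫ s in Ioo (0 : ℝ) 1, (g s : ℂ) * f s), ← hpoly p,
        ← integral_sub (hbdd g hg) (hbdd _ p.continuous), ← integral_const_mul]
      refine norm_integral_le_of_norm_le (hf.norm.const_mul ε) ?_
      filter_upwards [ae_restrict_mem measurableSet_Ioo] with s hs
      rw [← sub_mul, norm_mul, ← Complex.ofReal_sub, Complex.norm_real, ← norm_neg, neg_sub]
      have := hp s ⟨hs.1.le, hs.2.le⟩
      gcongr
      exact this.le
    set I := ∫ s in Ioo (0 : ℝ) 1, ‖f s‖
    have hI : 0 ≤ I := integral_nonneg fun s => norm_nonneg _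
    refine norm_le_zero_iff.1 (le_of_forall_pos_le_add fun ε hε => ?_)
    have h1 := hle (ε / (I + 1)) (by positivity)
    refine h1.trans ?_
    rw [zero_add, div_mul_eq_mul_div, div_le_iff₀ (by positivity)]
    nlinarith
  have hind : Integrable ((Ioo (0 : ℝ) 1).indicator f) :=
    (integrable_indicator_iff measurableSet_Ioo).2 hf
  have h0 := ae_eq_zero_of_integral_contDiff_smul_eq_zero hind.locallyIntegrable fun g hg _ => by
    have h1 := hcont g hg.continuous
    rw [← integral_indicator measurableSet_Ioo] at h1
    rw [← h1]
    refine integral_congr_ae (ae_of_all _ fun s => ?_)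
    by_cases hs : s ∈ Ioo (0 : ℝ) 1
    · simp only [indicator_of_mem hs, Complex.real_smul]
    · simp only [indicator_of_notMem hs, smul_zero]
  filter_upwards [ae_restrict_of_ae h0, ae_restrict_mem measurableSet_Ioo] with s h1 hs
  rwa [indicator_of_mem hs] at h1

/-- The constant `1` is a cyclic vector of multiplication by `s`. -/
theorem eq_zero_of_inner_mulId_pow {h : L2On (Ioo 0 1)}
    (h0 : ∀ n : ℕ, ⟪(mulId ^ n) unitConst, h⟫_ℂ = 0) : h = 0 := by
  refine Lp.ext (((ae_eq_zero_of_moments_eq_zero ((Lp.memLp h).integrable one_le_two)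
    fun n => ?_)).trans (Lp.coeFn_zero ℂ 2 _).symm)
  rw [← h0 n, L2.inner_def]
  refine integral_congr_ae ?_
  filter_upwards [mulId_pow_unitConst_coeFn n] with s hs
  rw [hs, RCLike.inner_apply, map_pow, Complex.conj_ofReal, mul_comm]

/-! ### The spectral measure of multiplication by `s` -/

theorem memLp_indicator_one {Δ : Set ℝ} (hΔ : MeasurableSet Δ) :
    MemLp (Δ.indicator fun _ => (1 : ℂ)) ∞ (volume.restrict (Ioo (0 : ℝ) 1)) := by
  refine memLp_top_of_bound (measurable_const.indicator hΔ).aestronglyMeasurable 1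
    (ae_of_all _ fun t => ?_)
  refine (norm_indicator_le_norm_self _ t).trans ?_
  rw [norm_one]

open Classical in
/-- Restriction to `Δ`, i.e. multiplication by the indicator function of `Δ`, for measurable
`Δ ⊆ ℝ`; it is `0` by convention if `Δ` is not measurable. -/
def cutOp (Δ : Set ℝ) : L2On (Ioo 0 1) →L[ℂ] L2On (Ioo 0 1) :=
  if hΔ : MeasurableSet Δ then mulOp _ (memLp_indicator_one hΔ) else 0

theorem cutOp_eq_mulOp {Δ : Set ℝ} (hΔ : MeasurableSet Δ) :
    cutOp Δ = mulOp _ (memLp_indicator_one hΔ) :=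
  dif_pos hΔ

theorem cutOp_coeFn {Δ : Set ℝ} (hΔ : MeasurableSet Δ) (h : L2On (Ioo 0 1)) :
    cutOp Δ h =ᵐ[volume.restrict (Ioo (0 : ℝ) 1)] Δ.indicator h := by
  rw [cutOp_eq_mulOp hΔ]
  filter_upwards [mulOp_coeFn _ (memLp_indicator_one hΔ) h] with s hs
  rw [hs]
  by_cases hm : s ∈ Δ
  · simp only [indicator_of_mem hm, one_mul]
  · simp only [indicator_of_notMem hm, zero_mul]

theorem cutOp_inter {Δ Δ' : Set ℝ} (hΔ : MeasurableSet Δ) (hΔ' : MeasurableSet Δ') :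
    cutOp (Δ ∩ Δ') = cutOp Δ * cutOp Δ' := by
  refine ContinuousLinearMap.ext fun h => Lp.ext ?_
  rw [mul_apply_eq_comp]
  filter_upwards [cutOp_coeFn (hΔ.inter hΔ') h, cutOp_coeFn hΔ (cutOp Δ' h),
    cutOp_coeFn hΔ' h] with s h1 h2 h3
  rw [h1, h2, ← indicator_indicator]
  by_cases hm : s ∈ Δ
  · rw [indicator_of_mem hm, indicator_of_mem hm, h3]
  · rw [indicator_of_notMem hm, indicator_of_notMem hm]

theorem isStarProjection_cutOp {Δ : Set ℝ} (hΔ : MeasurableSet Δ) : IsStarProjection (cutOp Δ) := by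
  refine ⟨?_, ?_⟩
  · rw [IsIdempotentElem, ← cutOp_inter hΔ hΔ, inter_self]
  · rw [cutOp_eq_mulOp hΔ]
    refine isSelfAdjoint_mulOp _ fun s => ?_
    by_cases hm : s ∈ Δ
    · simp only [indicator_of_mem hm, map_one]
    · simp only [indicator_of_notMem hm, map_zero]

theorem cutOp_empty : cutOp ∅ = 0 := by
  refine ContinuousLinearMap.ext fun h => Lp.ext ?_
  filter_upwards [cutOp_coeFn MeasurableSet.empty h,
    Lp.coeFn_zero ℂ 2 (volume.restrict (Ioo (0 : ℝ) 1))] with s h1 h2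
  rw [h1, indicator_empty, zero_apply, h2]
  rfl

theorem cutOp_univ : cutOp univ = 1 := by
  refine ContinuousLinearMap.ext fun h => Lp.ext ?_
  filter_upwards [cutOp_coeFn MeasurableSet.univ h] with s h1
  rw [h1, indicator_univ]
  rfl

theorem sum_cutOp {Δ : ℕ → Set ℝ} (hΔ : ∀ n, MeasurableSet (Δ n))
    (hd : Pairwise (Function.onFun Disjoint Δ)) (F : Finset ℕ) (h : L2On (Ioo 0 1)) :
    ∑ n ∈ F, cutOp (Δ n) h = cutOp (⋃ n ∈ F, Δ n) h := by
  classical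
  induction F using Finset.induction_on with
  | empty => simp [cutOp_empty]
  | insert n F hn ih =>
    have hF : MeasurableSet (⋃ m ∈ F, Δ m) := Finset.measurableSet_biUnion _ fun m _ => hΔ m
    have hdis : Disjoint (Δ n) (⋃ m ∈ F, Δ m) := by
      rw [disjoint_iUnion₂_right]
      intro m hm
      exact hd fun e => hn (e ▸ hm)
    rw [Finset.sum_insert hn, ih, Finset.set_biUnion_insert]
    refine Lp.ext ?_
    filter_upwards [Lp.coeFn_add (cutOp (Δ n) h) (cutOp (⋃ m ∈ F, Δ m) h), cutOp_coeFn (hΔ n) h,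
      cutOp_coeFn hF h, cutOp_coeFn ((hΔ n).union hF) h] with s h1 h2 h3 h4
    rw [h1, Pi.add_apply, h2, h3, h4, indicator_union_of_disjoint hdis]

theorem hasSum_cutOp {Δ : ℕ → Set ℝ} (hΔ : ∀ n, MeasurableSet (Δ n))
    (hd : Pairwise (Function.onFun Disjoint Δ)) (h : L2On (Ioo 0 1)) :
    HasSum (fun n => cutOp (Δ n) h) (cutOp (⋃ n, Δ n) h) := by
  have hU : MeasurableSet (⋃ n, Δ n) := MeasurableSet.iUnion hΔ
  have hF : ∀ F : Finset ℕ, MeasurableSet (⋃ n ∈ F, Δ n) := fun F =>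
    Finset.measurableSet_biUnion _ fun m _ => hΔ m
  -- Off the union nothing is cut away, so that the cut sets exhaust `ℝ`.
  have hlim := tendsto_eLpNorm_indicator_sub (l := (atTop : Filter (Finset ℕ)))
    (S := fun F => (⋃ n ∈ F, Δ n) ∪ (⋃ n, Δ n)ᶜ) (fun F => (hF F).union hU.compl)
    (fun s _ => by
      by_cases hs : s ∈ ⋃ n, Δ n
      · obtain ⟨n, hn⟩ := mem_iUnion.1 hs
        filter_upwards [eventually_ge_atTop {n}] with F hFn
        exact Or.inl (mem_iUnion₂.2 ⟨n, hFn (Finset.mem_singleton_self n), hn⟩)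
      · exact Eventually.of_forall fun F => Or.inr hs) (Lp.memLp (cutOp (⋃ n, Δ n) h))
  rw [HasSum]
  simp_rw [sum_cutOp hΔ hd]
  refine (Lp.tendsto_Lp_iff_tendsto_eLpNorm' _ _).2 (hlim.congr fun F => ?_)
  refine eLpNorm_congr_ae ?_
  filter_upwards [cutOp_coeFn hU h, cutOp_coeFn (hF F) h] with s h1 h2
  rw [Pi.sub_apply, Pi.sub_apply, h2]
  congr 1
  by_cases hs : s ∈ ⋃ n ∈ F, Δ n
  · have hs' : s ∈ ⋃ n, Δ n := by
      obtain ⟨n, -, hn⟩ := mem_iUnion₂.1 hs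
      exact mem_iUnion.2 ⟨n, hn⟩
    rw [indicator_of_mem (mem_union_left _ hs), h1, indicator_of_mem hs, indicator_of_mem hs']
  · rw [indicator_of_notMem hs]
    by_cases hs' : s ∈ ⋃ n, Δ n
    · exact indicator_of_notMem (fun hm => hm.elim hs fun hc => hc hs') _
    · rw [indicator_of_mem (mem_union_right _ hs'), h1, indicator_of_notMem hs']

/-- The measure `|h(s)|² ds` on `(0, 1)`. -/
def densityMeasure (h : L2On (Ioo 0 1)) : Measure ℝ :=
  (volume.restrict (Ioo (0 : ℝ) 1)).withDensity fun s => ((‖h s‖₊ ^ 2 : NNReal) : ℝ≥0∞)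

theorem measurable_nnnorm_sq (h : L2On (Ioo 0 1)) : Measurable fun s => ‖h s‖₊ ^ 2 :=
  (Lp.stronglyMeasurable h).measurable.nnnorm.pow_const 2

theorem ofReal_norm_cutOp_sq {Δ : Set ℝ} (hΔ : MeasurableSet Δ) (h : L2On (Ioo 0 1)) :
    ENNReal.ofReal (‖cutOp Δ h‖ ^ 2) = densityMeasure h Δ := by
  have h1 : ENNReal.ofReal (‖cutOp Δ h‖ ^ 2) = ‖cutOp Δ h‖ₑ ^ 2 := by
    rw [ENNReal.ofReal_pow (norm_nonneg _), ofReal_norm]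
  rw [h1, Lp.enorm_def, eLpNorm_congr_ae (cutOp_coeFn hΔ h), densityMeasure,
    withDensity_apply _ hΔ, eLpNorm_eq_lintegral_rpow_enorm_toReal (by norm_num) (by norm_num),
    ENNReal.toReal_ofNat, ← ENNReal.rpow_natCast, ← ENNReal.rpow_mul]
  norm_num
  rw [← lintegral_indicator hΔ]
  refine lintegral_congr fun s => ?_
  by_cases hs : s ∈ Δ
  · simp only [indicator_of_mem hs]
    rfl
  · simp [indicator_of_notMem hs]

theorem densityMeasure_absolutelyContinuous (h : L2On (Ioo 0 1)) : densityMeasure h ≪ volume :=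
  (withDensity_absolutelyContinuous _ _).trans Measure.absolutelyContinuous_restrict

theorem integrable_densityMeasure (h : L2On (Ioo 0 1)) :
    Integrable (fun t : ℝ => t) (densityMeasure h) := by
  rw [densityMeasure, integrable_withDensity_iff_integrable_smul (measurable_nnnorm_sq h)]
  have h1 : Integrable (fun s => ‖h s‖ ^ 2) (volume.restrict (Ioo (0 : ℝ) 1)) :=
    (memLp_two_iff_integrable_sq_norm (Lp.aestronglyMeasurable h)).1 (Lp.memLp h)
  refine h1.mono' ((measurable_nnnorm_sq h).aestronglyMeasurable.smul
    measurable_id.aestronglyMeasurable) ?_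
  filter_upwards [ae_restrict_mem measurableSet_Ioo] with s hs
  rw [NNReal.smul_def, smul_eq_mul, norm_mul, NNReal.coe_pow, coe_nnnorm, norm_pow, norm_norm,
    Real.norm_of_nonneg hs.1.le]
  exact mul_le_of_le_one_right (by positivity) hs.2.le

theorem integral_densityMeasure (h : L2On (Ioo 0 1)) :
    ((∫ t, t ∂(densityMeasure h) : ℝ) : ℂ) = ⟪h, mulId h⟫_ℂ := by
  rw [densityMeasure, integral_withDensity_eq_integral_smul (measurable_nnnorm_sq h),
    ← integral_complex_ofReal, L2.inner_def]
  refine integral_congr_ae ?_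
  filter_upwards [mulOp_coeFn _ memLp_id_unit h] with s hs
  rw [mulId, hs, RCLike.inner_apply, NNReal.smul_def, smul_eq_mul, mul_assoc, RCLike.mul_conj]
  push_cast
  exact mul_comm _ _

/-! ### Transport by the unitary transform -/

/-- The operator `K = V M V⁻¹`. -/
def sincOperator : L2On (Ioi 0) →L[ℂ] L2On (Ioi 0) := spectralUnitary.conjStarAlgEquiv mulId

theorem sincOperator_apply (g : L2On (Ioi 0)) :
    sincOperator g = spectralUnitary (mulId (spectralUnitary.symm g)) := rfl

theorem isSincOperator_sincOperator : IsSincOperator sincOperator := by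
  intro g
  refine ⟨integrableOn_sinc_mul g, ?_⟩
  have h1 := coeFn_spectralIsometry_mulId (spectralUnitary.symm g)
  rwa [← coe_spectralUnitary, spectralUnitary.apply_symm_apply] at h1

theorem isSelfAdjoint_sincOperator : IsSelfAdjoint sincOperator :=
  isSelfAdjoint_mulId.map spectralUnitary.conjStarAlgEquiv

theorem spectrum_sincOperator : spectrum ℂ sincOperator = Complex.ofReal '' Icc (0 : ℝ) 1 := by
  rw [sincOperator, AlgEquiv.spectrum_eq, spectrum_mulId]

theorem hasSimpleSpectrum_sincOperator : HasSimpleSpectrum sincOperator := by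
  refine ⟨spectralUnitary unitConst, ?_⟩
  rw [Submodule.topologicalClosure_eq_top_iff, Submodule.eq_bot_iff]
  intro g hg
  have h1 : ∀ n : ℕ, ⟪(mulId ^ n) unitConst, spectralUnitary.symm g⟫_ℂ = 0 := by
    intro n
    rw [← spectralUnitary.inner_map_map, spectralUnitary.apply_symm_apply]
    have h2 : (sincOperator ^ n) (spectralUnitary unitConst) =
        spectralUnitary ((mulId ^ n) unitConst) := by
      rw [sincOperator, ← map_pow, LinearIsometryEquiv.conjStarAlgEquiv_apply_apply,
        spectralUnitary.symm_apply_apply]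
    rw [← h2]
    exact (Submodule.mem_orthogonal _ g).1 hg _ (Submodule.subset_span ⟨n, rfl⟩)
  have h3 := eq_zero_of_inner_mulId_pow h1
  rwa [map_eq_zero_iff _ spectralUnitary.symm.injective] at h3

/-- The spectral measure of `K`: restriction of `V⁻¹ g` to `Δ`. -/
def sincSpectralMeasure : ProjectionValuedMeasure (L2On (Ioi 0)) where
  toFun Δ := spectralUnitary.conjStarAlgEquiv (cutOp Δ)
  isStarProjection Δ hΔ := (isStarProjection_cutOp hΔ).map spectralUnitary.conjStarAlgEquiv
  map_empty := by rw [cutOp_empty, map_zero]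
  map_univ := by rw [cutOp_univ, map_one]
  map_inter Δ Δ' hΔ hΔ' := by rw [cutOp_inter hΔ hΔ', map_mul]
  hasSum_iUnion Δ hΔ hd g := by
    simp only [LinearIsometryEquiv.conjStarAlgEquiv_apply_apply]
    exact (hasSum_cutOp hΔ hd (spectralUnitary.symm g)).mapL
      (spectralUnitary.toContinuousLinearEquiv : L2On (Ioo 0 1) →L[ℂ] L2On (Ioi 0))

theorem diag_sincSpectralMeasure (g : L2On (Ioi 0)) :
    sincSpectralMeasure.diag g = densityMeasure (spectralUnitary.symm g) := by
  refine Measure.ext fun Δ hΔ => ?_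
  rw [ProjectionValuedMeasure.diag_apply _ _ hΔ, ← ofReal_norm_cutOp_sq hΔ]
  congr 2
  exact spectralUnitary.norm_map _

theorem isAbsolutelyContinuousOp_sincOperator : IsAbsolutelyContinuousOp sincOperator := by
  refine ⟨sincSpectralMeasure, fun g => ?_, fun g => ?_⟩
  · rw [diag_sincSpectralMeasure]
    refine ⟨integrable_densityMeasure _, ?_⟩
    rw [integral_densityMeasure, ← spectralUnitary.inner_map_map,
      spectralUnitary.apply_symm_apply, sincOperator_apply]
  · rw [diag_sincSpectralMeasure]
    exact densityMeasure_absolutelyContinuous _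

end SincWienerHopf

end

theorem mainTheorem1 :
    SincWienerHopf.SpectralFunctionExists ∧
    ∃ (K : SincWienerHopf.L2On (Ioi 0) →L[ℂ] SincWienerHopf.L2On (Ioi 0))
      (V : SincWienerHopf.L2On (Ioo 0 1) ≃ₗᵢ[ℂ] SincWienerHopf.L2On (Ioi 0)),
      SincWienerHopf.IsSincOperator K ∧
      SincWienerHopf.IsSpectralTransform V ∧
      (∀ h : SincWienerHopf.L2On (Ioo 0 1),
        ∀ᵐ s ∂(volume.restrict (Ioo (0 : ℝ) 1)), V.symm (K (V h)) s = (s : ℂ) * h s) ∧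
      (∀ g : SincWienerHopf.L2On (Ioi 0), K g = V (SincWienerHopf.mulId (V.symm g))) ∧
      IsSelfAdjoint K ∧
      spectrum ℂ K = Complex.ofReal '' Icc (0 : ℝ) 1 ∧
      SincWienerHopf.HasSimpleSpectrum K ∧
      SincWienerHopf.IsAbsolutelyContinuousOp K := by
  refine ⟨SincWienerHopf.spectralFunctionExists, SincWienerHopf.sincOperator,
    SincWienerHopf.spectralUnitary, SincWienerHopf.isSincOperator_sincOperator, ?_, fun h => ?_,
    SincWienerHopf.sincOperator_apply, SincWienerHopf.isSelfAdjoint_sincOperator,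
    SincWienerHopf.spectrum_sincOperator, SincWienerHopf.hasSimpleSpectrum_sincOperator,
    SincWienerHopf.isAbsolutelyContinuousOp_sincOperator⟩
  · rw [SincWienerHopf.coe_spectralUnitary]
    exact SincWienerHopf.isSpectralTransform_spectralIsometry
  · rw [SincWienerHopf.sincOperator_apply, LinearIsometryEquiv.symm_apply_apply,
      LinearIsometryEquiv.symm_apply_apply]
    exact SincWienerHopf.mulOp_coeFn _ SincWienerHopf.memLp_id_unit h
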